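/- **Setting.** Let $n\ge 2$, $1\le m<p$ be integers and $a\in(0,1)$. For a positive definite $p\times p$ matrix $\Sigma$ with unit diagonal, let $X_1,\dots,X_n$ be i.i.d. $\mathcal N_p(0,\Sigma)$, let $(\varepsilon_{k,i})_{1\le k\le n,\,1\le i\le p}$ be i.i.d. Bernoulli variables with parameter $a$, independent of $X_1,\dots,X_n$, and observe $Y_k=(\varepsilon_{k,1}X_{k,1},\dots,\varepsilon_{k,p}X_{k,p})$. Expectation, variance and covariance in this model are written $\mathbb E_{a,\Sigma},\operatorname{Var}_{a,\Sigma},\operatorname{Cov}_{a,\Sigma}$. Put $$\widehat{\mathcal A}_{n,p,m}=\frac{1}{n(n-1)(p-m)^2}\,\frac1{\sqrt{2m}}\sum_{1\le k\ne l\le n}\ \sum_{j=1}^m\ \sum_{m+1\le i_1,i_2\le p}Y_{k,i_1}Y_{k,i_1-j}Y_{l,i_2}Y_{l,i_2-j}.$$ For $\alpha>0$ let $\mathcal T(\alpha)$ be the set of symmetric positive definite Toeplitz matrices $\Sigma=(\sigma_{|i-j|})_{1\le i,j\le p}$ with $\sigma_0=1$ and $\sum_{1\le j<p}\sigma_j^2j^{2\alpha}\le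 1$. **Proposition.** $\widehat{\mathcal A}_{n,p,m}$ is square integrable under $\Sigma=I$ and under every $\Sigma\in\mathcal T(\alpha)$, and the following hold. 1. (Null hypothesis $\Sigma=I$.) $\mathbb E_{a,I}(\widehat{\mathcal A}_{n,p,m})=0$ and $\operatorname{Var}_{a,I}(\widehat{\mathcal A}_{n,p,m})=\dfrac{a^4}{n(n-1)(p-m)^2}$. Moreover, along any sequence of parameters with $n\to\infty$, $p\to\infty$, $m\to\infty$, $m<p$, $a\in(0,1)$ and $a^2n(p-m)\to\infty$, $$\frac{n(p-m)}{a^2}\,\widehat{\mathcal A}_{n,p,m}\longrightarrow\mathcal N(0,1)\quad\text{in distribution under } \Sigma=I.$$ 2. (Alternative, moments.) For all $\alpha>0$ and $\Sigma\in\mathcal T(\alpha)$, $$\mathbb E_{a,\Sigma}(\widehat{\mathcal A}_{n,p,m})=\frac{a^4}{\sqrt{2m}}\sum_{j=1}^m\sigma_j^2,\qquad \operatorname{Var}_{a,\Sigma}(\widehat{\mathcal A}_{n,p,m})=\frac{R_1}{n(n-1)(p-m)^4}+\frac{R_2}{n(p-m)^2},$$ where, with $\Gamma_{jj'}=\operatorname{Cov}_{a,\Sigma}\Big(\sum_{i=m+1}^pY_{1,i}Y_{1,i-j},\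 \sum_{i=m+1}^pY_{1,i}Y_{1,i-j'}\Big)$, $$R_1=\frac1m\sum_{j,j'=1}^m\Gamma_{jj'}^2,\qquad R_2=\frac{2a^4}{m}\sum_{j,j'=1}^m\sigma_j\sigma_{j'}\Gamma_{jj'}.$$ 3. (Alternative, bounds.) For every $\alpha>1/4$ there are a constant $C>0$ and a sequence $r(m)\to0$ as $m\to\infty$, both depending only on $\alpha$, such that for all $n\ge2$, $1\le m<p$, $a\in(0,1)$ and $\Sigma\in\mathcal T(\alpha)$, writing $E=\mathbb E_{a,\Sigma}(\widehat{\mathcal A}_{n,p,m})$, $$R_1\le (p-m)^2\Big\{a^4(1+r(m))+E\,\big(C a^2m+C a^3m^{3/2-2\alpha}\big)+E^2\,C m^2\Big\},$$ $$R_2\le (p-m)\Big\{a^2E\,r(m)+E^{3/2}\big(C a\,m^{1/4}+C a^2m^{3/4-\alpha}\big)+E^2\,C m\Big\}.$$ -/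

import Mathlib

open MeasureTheory ProbabilityTheory Filter Topology

noncomputable section

namespace ToeplitzMissing

/-- `S` has constant diagonals. -/
def IsToeplitz {p : ℕ} (S : Matrix (Fin p) (Fin p) ℝ) : Prop :=
  ∀ i j k l : Fin p, (i : ℤ) - (j : ℤ) = (k : ℤ) - (l : ℤ) → S i j = S k l

/-- The entry `σ_j` of `S` on its `j`-th diagonal, read off the first column
(and `0` if `S` has no `j`-th diagonal). -/
def diagCoeff {p : ℕ} (S : Matrix (Fin p) (Fin p) ℝ) (j : ℕ) : ℝ :=
  if h : j < p then S ⟨j, h⟩ ⟨0, by omega⟩ else 0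

/-- The class `T(α)` of `p × p` matrices: symmetric positive definite Toeplitz matrices with unit
diagonal and `∑_{1 ≤ j < p} σ_j² j^{2α} ≤ 1`.  (`Matrix.PosDef` over `ℝ` includes symmetry.) -/
def toeplitzClass (α : ℝ) (p : ℕ) : Set (Matrix (Fin p) (Fin p) ℝ) :=
  {S | S.PosDef ∧ IsToeplitz S ∧ (∀ i, S i i = 1) ∧
    ∑ j ∈ Finset.Ico 1 p, diagCoeff S j ^ 2 * (j : ℝ) ^ (2 * α) ≤ 1}

/-- The law `P_{a,S}` of `(ε_1 X_1, …, ε_p X_p)`, where `X ∼ N_p(0, S)` and the `ε_i` are i.i.d.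
Bernoulli variables of parameter `a`, independent of `X`. -/
def obsLaw {p : ℕ} (a : unitInterval) (S : Matrix (Fin p) (Fin p) ℝ) : Measure (Fin p → ℝ) :=
  ((Measure.pi fun _ : Fin p => bernoulliMeasure (1 : ℝ) 0 a).prod
      (multivariateGaussian (0 : EuclideanSpace ℝ (Fin p)) S)).map
    fun z i => z.1 i * z.2 i

instance {p : ℕ} (a : unitInterval) (S : Matrix (Fin p) (Fin p) ℝ) :
    IsProbabilityMeasure (obsLaw a S) :=
  Measure.isProbabilityMeasure_map (by fun_prop)

/-- The law of an i.i.d. sample `Y_1, …, Y_n` from `P_{a,S}`. -/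
def sampleLaw (n : ℕ) {p : ℕ} (a : unitInterval) (S : Matrix (Fin p) (Fin p) ℝ) :
    Measure (Fin n → Fin p → ℝ) :=
  Measure.pi fun _ : Fin n => obsLaw a S

instance (n : ℕ) {p : ℕ} (a : unitInterval) (S : Matrix (Fin p) (Fin p) ℝ) :
    IsProbabilityMeasure (sampleLaw n a S) := by
  unfold sampleLaw; infer_instance

/-- `y_{i-j}`; it is only used for `j ≤ i`. -/
def back {p : ℕ} (y : Fin p → ℝ) (i : Fin p) (j : ℕ) : ℝ :=
  y ⟨(i : ℕ) - j, by omega⟩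

/-- The statistic `Â_{n,p,m}`.  Coordinates are numbered from `0`, so that the range
`m + 1 ≤ i₁, i₂ ≤ p` becomes `m ≤ i₁, i₂ < p`. -/
def Ahat (n p m : ℕ) (Y : Fin n → Fin p → ℝ) : ℝ :=
  1 / ((n : ℝ) * ((n : ℝ) - 1) * ((p : ℝ) - m) ^ 2) * (1 / √(2 * (m : ℝ))) *
    ∑ kl : Fin n × Fin n with kl.1 ≠ kl.2, ∑ j ∈ Finset.Icc 1 m,
      ∑ i₁ ∈ Finset.univ.filter (fun i : Fin p => m ≤ (i : ℕ)),
      ∑ i₂ ∈ Finset.univ.filter (fun i : Fin p => m ≤ (i : ℕ)),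
        Y kl.1 i₁ * back (Y kl.1) i₁ j * (Y kl.2 i₂ * back (Y kl.2) i₂ j)

/-- `∑_i y_i y_{i-j}`, the sum over `i = m + 1, …, p` of a single observation `y`. -/
def lagSum (m : ℕ) {p : ℕ} (j : ℕ) (y : Fin p → ℝ) : ℝ :=
  ∑ i ∈ Finset.univ.filter (fun i : Fin p => m ≤ (i : ℕ)), y i * back y i j

/-- `Γ_{j j'}`: the covariance of two lag sums of a single observation under `P_{a,S}`. -/
def lagCov (m : ℕ) {p : ℕ} (a : unitInterval) (S : Matrix (Fin p) (Fin p) ℝ) (j j' : ℕ) : ℝ :=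
  covariance (lagSum m j) (lagSum m j') (obsLaw a S)

/-- The term `R₁` of the variance (from the completely degenerate part of the U-statistic). -/
def R₁ (m : ℕ) {p : ℕ} (a : unitInterval) (S : Matrix (Fin p) (Fin p) ℝ) : ℝ :=
  1 / (m : ℝ) * ∑ j ∈ Finset.Icc 1 m, ∑ j' ∈ Finset.Icc 1 m, lagCov m a S j j' ^ 2

/-- The term `R₂` of the variance (from the linear part of the U-statistic). -/
def R₂ (m : ℕ) {p : ℕ} (a : unitInterval) (S : Matrix (Fin p) (Fin p) ℝ) : ℝ :=
  2 * (a : ℝ) ^ 4 / (m : ℝ) * ∑ j ∈ Finset.Icc 1 m, ∑ j' ∈ Finset.Icc 1 m,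
    diagCoeff S j * diagCoeff S j' * lagCov m a S j j'

/-- `E_{a,S}(Â_{n,p,m})`. -/
def meanA (n p m : ℕ) (a : unitInterval) (S : Matrix (Fin p) (Fin p) ℝ) : ℝ :=
  ∫ Y, Ahat n p m Y ∂(sampleLaw n a S)

/-- `Var_{a,S}(Â_{n,p,m})`. -/
def varA (n p m : ℕ) (a : unitInterval) (S : Matrix (Fin p) (Fin p) ℝ) : ℝ :=
  variance (Ahat n p m) (sampleLaw n a S)

end ToeplitzMissing

end

/-! Up to normalization the statistic is a U-statistic of order two with product kernel `∑_j L_j(y)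
L_j(y')`, where `L_j` is the lag sum of one observation. Centering the `L_j` gives the Hoeffding
decomposition into a constant, a linear part and a degenerate part; the last two are orthogonal, and
their variances are the `R₂` and `R₁` terms (`integral_ustat_eq_and_variance_ustat`). All moments of
U-statistics are obtained by adding one observation at a time (`ustat_cons`): given the past, the
increment is a centered linear form in the lag sums of the new observation.

Bounding `R₁` and `R₂` amounts to estimating the covariances `Γ_{jj'}`. A fourth moment of an
observation is `a` to the number of distinct indices times Wick's sum of three pairings
(`integral_mul_four_obsLaw`). For four distinct indices the product of means cancels exactly,
leaving products of two off-diagonal coefficients. A coincidence of indices costs only a factor `a³`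
(or `a²`, when both pairs agree), but leaves one choice of the second index given the first. Hence
`Γ_{jj'}` is `(p - m)(a² δ_{jj'} + remainder)` (`abs_lagCov_sub_le`). Double sums of the remainder
are controlled by the energies `A = ∑_{j ≤ m} σ_j²` and `B = ∑_{j < p} σ_j² ≤ A + m^{-2α}`. As `a⁴ A
= √(2m) E`, powers of `A` become powers of the mean `E`, and powers of `m^{-α}` go into the
vanishing term; this is where `α > 1/4` enters.

For the central limit theorem, let `v = (p - m) a²` be the common variance of the uncorrelated lag
sums under the null hypothesis. A second-order Taylor expansion in the last increment gives `φ_{k+1}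
≈ φ_k (1 - s² v² m k / 2)` for the characteristic function `φ_k` at `s` of the U-statistic of `k`
observations, so `φ_n ≈ exp(-s² v² m n(n-1)/4)` (`norm_ustatCF_sub_exp_le`). The error involves the
fourth moment of the kernel and the second moment of `∑_j L_j²`. Given the mask, the lag sums are
off-diagonal quadratic forms in independent Gaussian variables, so hypercontractivity
(`integral_quadratic_pow_four_le`) reduces both to second moments of conditional variances. The
result is small with `1/n`, `1/(a² n (p - m))` and `1/m`, and Lévy's continuity theorem concludes.
-/

namespace ToeplitzMissing

/-- All absolute moments of `f` are finite. -/
def HasAllMoments {Ω : Type*} [MeasurableSpace Ω] (f : Ω → ℝ) (μ : Measure Ω) : Prop :=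
  ∀ q : ℕ, MemLp f q μ

/-! ### Functions with finite moments of every order -/

namespace HasAllMoments

variable {Ω : Type*} [MeasurableSpace Ω] {μ : Measure Ω} {f g : Ω → ℝ}

lemma const [IsFiniteMeasure μ] (c : ℝ) : HasAllMoments (fun _ : Ω => c) μ :=
  fun _ => memLp_const c

lemma add (hf : HasAllMoments f μ) (hg : HasAllMoments g μ) :
    HasAllMoments (fun x => f x + g x) μ :=
  fun q => (hf q).add (hg q)

lemma sub (hf : HasAllMoments f μ) (hg : HasAllMoments g μ) :
    HasAllMoments (fun x => f x - g x) μ :=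
  fun q => (hf q).sub (hg q)

/-- Hölder with exponents `2q, 2q`. Closure under products is the reason for asking for all moments
at once: integrability of every polynomial expression below becomes automatic. -/
lemma mul (hf : HasAllMoments f μ) (hg : HasAllMoments g μ) :
    HasAllMoments (fun x => f x * g x) μ := by
  intro q
  have : ENNReal.HolderTriple ((2 * q : ℕ) : ENNReal) ((2 * q : ℕ) : ENNReal) (q : ENNReal) := by
    constructor
    push_cast
    rw [ENNReal.mul_inv (by simp) (by simp), ← two_mul, ← mul_assoc,
      ENNReal.mul_inv_cancel (by simp) (by simp), one_mul]
  exact (hg (2 * q)).mul (hf (2 * q))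

lemma const_mul (c : ℝ) (hf : HasAllMoments f μ) : HasAllMoments (fun x => c * f x) μ :=
  fun q => (hf q).const_mul c

lemma mul_const (hf : HasAllMoments f μ) (c : ℝ) : HasAllMoments (fun x => f x * c) μ :=
  fun q => (hf q).mul_const c

lemma div_const (hf : HasAllMoments f μ) (c : ℝ) : HasAllMoments (fun x => f x / c) μ := by
  simpa only [div_eq_mul_inv] using hf.mul_const c⁻¹

lemma pow [IsFiniteMeasure μ] (hf : HasAllMoments f μ) (k : ℕ) :
    HasAllMoments (fun x => f x ^ k) μ := by
  induction k with
  | zero => simpa using const (μ := μ) 1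
  | succ k ih => simpa only [pow_succ] using ih.mul hf

lemma sum {κ : Type*} {J : Finset κ} {F : κ → Ω → ℝ} (h : ∀ j ∈ J, HasAllMoments (F j) μ) :
    HasAllMoments (fun x => ∑ j ∈ J, F j x) μ := by
  intro q
  exact memLp_finsetSum J fun j hj => h j hj q

lemma integrable (hf : HasAllMoments f μ) : Integrable f μ :=
  memLp_one_iff_integrable.1 (by simpa using hf 1)

lemma memLp_two (hf : HasAllMoments f μ) : MemLp f 2 μ := by
  simpa using hf 2

lemma comp_measurePreserving {Ω' : Type*} [MeasurableSpace Ω'] {μ' : Measure Ω'} {φ : Ω' → Ω}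
    (hf : HasAllMoments f μ) (hφ : MeasurePreserving φ μ' μ) :
    HasAllMoments (fun x => f (φ x)) μ' :=
  fun q => (hf q).comp_measurePreserving hφ

variable {Ω' : Type*} [MeasurableSpace Ω'] {μ' : Measure Ω'}

lemma fst [SFinite μ] [IsProbabilityMeasure μ'] (hf : HasAllMoments f μ) :
    HasAllMoments (fun z : Ω × Ω' => f z.1) (μ.prod μ') :=
  hf.comp_measurePreserving measurePreserving_fst

lemma snd [IsProbabilityMeasure μ] [SFinite μ'] {h : Ω' → ℝ} (hf : HasAllMoments h μ') :
    HasAllMoments (fun z : Ω × Ω' => h z.2) (μ.prod μ') :=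
  hf.comp_measurePreserving measurePreserving_snd

lemma eval {ι : Type*} [Fintype ι] {X : ι → Type*} [∀ i, MeasurableSpace (X i)]
    {ρ : ∀ i, Measure (X i)} [∀ i, IsProbabilityMeasure (ρ i)] (i : ι) {h : X i → ℝ}
    (hf : HasAllMoments h (ρ i)) :
    HasAllMoments (fun x : ∀ i, X i => h (x i)) (Measure.pi ρ) :=
  hf.comp_measurePreserving (measurePreserving_eval ρ i)

end HasAllMoments

/-! ### Peeling off one observation, and the Cauchy–Schwarz inequality -/

section succ
variable {E : Type*} [MeasurableSpace E] (ν : Measure E) [IsProbabilityMeasure ν]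

/-- Adding one observation to an i.i.d. sample. -/
lemma integral_pi_succ {G : Type*} [NormedAddCommGroup G] [NormedSpace ℝ G] (k : ℕ)
    (F : (Fin (k + 1) → E) → G) :
    ∫ Y, F Y ∂(Measure.pi fun _ : Fin (k + 1) => ν) =
      ∫ z, F (Fin.cons z.1 z.2) ∂(ν.prod (Measure.pi fun _ : Fin k => ν)) := by
  have h := (measurePreserving_piFinSuccAbove (fun _ : Fin (k + 1) => ν) 0).symm
  rw [← h.integral_comp']
  simp [MeasurableEquiv.piFinSuccAbove_symm_apply, Fin.insertNthEquiv]

end succ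

/-- Cauchy–Schwarz for real functions all of whose moments are finite. -/
lemma integral_mul_le_sqrt_mul_sqrt {Ω : Type*} [MeasurableSpace Ω] {μ : Measure Ω}
    [IsProbabilityMeasure μ] {f g : Ω → ℝ} (hf : HasAllMoments f μ) (hg : HasAllMoments g μ) :
    ∫ x, f x * g x ∂μ ≤ √(∫ x, f x ^ 2 ∂μ) * √(∫ x, g x ^ 2 ∂μ) := by
  set F := ∫ x, f x ^ 2 ∂μ
  set G := ∫ x, g x ^ 2 ∂μ
  have hF : 0 ≤ F := integral_nonneg fun x => sq_nonneg _
  have hG : 0 ≤ G := integral_nonneg fun x => sq_nonneg _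
  rw [← Real.sqrt_mul hF]
  apply Real.le_sqrt_of_sq_le
  set H := ∫ x, f x * g x ∂μ with hH
  -- The quadratic polynomial `s ↦ E (s f + g)²` is nonnegative, so its discriminant is nonpositive.
  have key : ∀ s : ℝ, 0 ≤ F * (s * s) + (2 * H) * s + G := by
    intro s
    have h1 : ∫ x, (s * f x + g x) ^ 2 ∂μ = F * (s * s) + (2 * H) * s + G := by
      have e : ∀ x, (s * f x + g x) ^ 2 = (s * s) * f x ^ 2 + (2 * s) * (f x * g x) + g x ^ 2 :=
        fun x => by ring
      simp_rw [e]
      rw [integral_add (((hf.pow 2).const_mul _).add ((hf.mul hg).const_mul _)).integrable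
          (hg.pow 2).integrable,
        integral_add ((hf.pow 2).const_mul _).integrable ((hf.mul hg).const_mul _).integrable,
        integral_const_mul, integral_const_mul]
      ring
    rw [← h1]
    exact integral_nonneg fun x => sq_nonneg _
  have := discrim_le_zero key
  unfold discrim at this
  nlinarith

/-- Cauchy–Schwarz against the constant function `1`. -/
lemma sq_integral_le {Ω : Type*} [MeasurableSpace Ω] {μ : Measure Ω}
    [IsProbabilityMeasure μ] {f : Ω → ℝ} (hf : HasAllMoments f μ) :
    ∫ x, |f x| ∂μ ≤ √(∫ x, f x ^ 2 ∂μ) := by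
  have hf' : HasAllMoments (fun x => |f x|) μ := fun q => (hf q).abs
  have := integral_mul_le_sqrt_mul_sqrt hf' (HasAllMoments.const (μ := μ) 1)
  simpa using this

/-! ### Moments of U-statistics of order two with product kernel -/

section iid

variable {E κ : Type*}

/-- The sum over the sample of the `j`-th statistic. -/
noncomputable def colSum (l : κ → E → ℝ) (j : κ) {k : ℕ} (Y : Fin k → E) : ℝ := ∑ i, l j (Y i)

/-- The U-statistic `∑_{i < i'} ∑_j l_j(Y_i) l_j(Y_{i'})`, in closed form. -/
noncomputable def ustat (J : Finset κ) (l : κ → E → ℝ) {k : ℕ} (Y : Fin k → E) : ℝ :=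
  (∑ j ∈ J, (colSum l j Y ^ 2 - ∑ i, l j (Y i) ^ 2)) / 2

lemma colSum_cons (l : κ → E → ℝ) (j : κ) {k : ℕ} (y : E) (Y : Fin k → E) :
    colSum l j (Fin.cons y Y : Fin (k + 1) → E) = l j y + colSum l j Y := by
  simp [colSum, Fin.sum_univ_succ]

/-- The new observation meets the past only through the column sums, in a bilinear form. Every
moment of `ustat` is computed by induction from this recursion, the two factors being independent.
-/
lemma ustat_cons (J : Finset κ) (l : κ → E → ℝ) {k : ℕ} (y : E) (Y : Fin k → E) :
    ustat J l (Fin.cons y Y : Fin (k + 1) → E) = ustat J l Y + ∑ j ∈ J, l j y * colSum l j Y := by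
  simp only [ustat, colSum_cons, Fin.sum_univ_succ, Fin.cons_zero, Fin.cons_succ]
  rw [← sub_eq_iff_eq_add', ← sub_div, ← Finset.sum_sub_distrib, div_eq_iff two_ne_zero,
    Finset.sum_mul]
  exact Finset.sum_congr rfl fun j _ => by ring

lemma ustat_zero (J : Finset κ) (l : κ → E → ℝ) (Y : Fin 0 → E) : ustat J l Y = 0 := by
  simp [ustat, colSum]

lemma colSum_zero (l : κ → E → ℝ) (j : κ) (Y : Fin 0 → E) : colSum l j Y = 0 := by
  simp [colSum]

variable [MeasurableSpace E] {ν : Measure E} [IsProbabilityMeasure ν]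
  {J : Finset κ} {l : κ → E → ℝ}

lemma hasAllMoments_colSum (hl : ∀ j, HasAllMoments (l j) ν) (j : κ) (k : ℕ) :
    HasAllMoments (fun Y : Fin k → E => colSum l j Y) (Measure.pi fun _ => ν) :=
  HasAllMoments.sum fun i _ => (hl j).eval (ρ := fun _ : Fin k => ν) i

lemma hasAllMoments_ustat (hl : ∀ j, HasAllMoments (l j) ν) (k : ℕ) :
    HasAllMoments (fun Y : Fin k → E => ustat J l Y) (Measure.pi fun _ => ν) :=
  (HasAllMoments.sum fun j _ => ((hasAllMoments_colSum hl j k).pow 2).sub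
    (HasAllMoments.sum fun i _ => ((hl j).pow 2).eval (ρ := fun _ : Fin k => ν) i)).div_const 2

section prod
variable {F : Type*} [MeasurableSpace F] {ρ : Measure F} [IsProbabilityMeasure ρ]
  {f : κ → E → ℝ} {g : κ → F → ℝ}

lemma hasAllMoments_sum_mul (hf : ∀ j, HasAllMoments (f j) ν) (hg : ∀ j, HasAllMoments (g j) ρ) :
    HasAllMoments (fun z : E × F => ∑ j ∈ J, f j z.1 * g j z.2) (ν.prod ρ) :=
  HasAllMoments.sum fun j _ => (hf j).fst.mul (hg j).snd

lemma integral_sum_mul (hf : ∀ j, HasAllMoments (f j) ν) (hg : ∀ j, HasAllMoments (g j) ρ) :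
    ∫ z : E × F, ∑ j ∈ J, f j z.1 * g j z.2 ∂(ν.prod ρ) =
      ∑ j ∈ J, (∫ x, f j x ∂ν) * ∫ y, g j y ∂ρ := by
  rw [integral_finsetSum _ fun j _ => ((hf j).fst.mul (hg j).snd).integrable]
  exact Finset.sum_congr rfl fun j _ => integral_prod_mul _ _

lemma integral_mul_sum_mul {h : F → ℝ} (hf : ∀ j, HasAllMoments (f j) ν)
    (hg : ∀ j, HasAllMoments (g j) ρ) (hh : HasAllMoments h ρ) :
    ∫ z : E × F, h z.2 * ∑ j ∈ J, f j z.1 * g j z.2 ∂(ν.prod ρ) =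
      ∑ j ∈ J, (∫ x, f j x ∂ν) * ∫ y, h y * g j y ∂ρ := by
  rw [← integral_sum_mul hf fun j => hh.mul (hg j)]
  congr 1 with z
  rw [Finset.mul_sum]
  exact Finset.sum_congr rfl fun j _ => by ring

/-- The square of a bilinear form is again a bilinear form, indexed by `J ×ˢ J`. -/
lemma integral_sum_mul_sq (hf : ∀ j, HasAllMoments (f j) ν) (hg : ∀ j, HasAllMoments (g j) ρ) :
    ∫ z : E × F, (∑ j ∈ J, f j z.1 * g j z.2) ^ 2 ∂(ν.prod ρ) =
      ∑ i ∈ J, ∑ j ∈ J, (∫ x, f i x * f j x ∂ν) * ∫ y, g i y * g j y ∂ρ := by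
  rw [← Finset.sum_product', ← integral_sum_mul (J := J ×ˢ J)
    (f := fun q : κ × κ => fun x => f q.1 x * f q.2 x)
    (g := fun q : κ × κ => fun y => g q.1 y * g q.2 y)
    (fun q => (hf q.1).mul (hf q.2)) fun q => (hg q.1).mul (hg q.2)]
  congr 1 with z
  rw [sq, Finset.sum_mul_sum, Finset.sum_product]
  exact Finset.sum_congr rfl fun i _ => Finset.sum_congr rfl fun j _ => by ring

end prod

lemma integral_colSum (hl : ∀ j, HasAllMoments (l j) ν) (j : κ) (k : ℕ) :
    ∫ Y, colSum l j Y ∂(Measure.pi fun _ : Fin k => ν) = k * ∫ x, l j x ∂ν := by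
  induction k with
  | zero => simp [colSum_zero]
  | succ k ih =>
    rw [integral_pi_succ]
    simp_rw [colSum_cons]
    rw [integral_add (hl j).fst.integrable (hasAllMoments_colSum hl j k).snd.integrable,
      integral_fun_fst, integral_fun_snd (fun Y : Fin k → E => colSum l j Y), ih]
    simp
    ring

/-- Products of distinct observations integrate to zero by independence and centering; only the `k`
diagonal terms survive. -/
lemma integral_colSum_mul_colSum (hl : ∀ j, HasAllMoments (l j) ν)
    {i j : κ} (hi : ∫ x, l i x ∂ν = 0) (hj : ∫ x, l j x ∂ν = 0) (k : ℕ) :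
    ∫ Y, colSum l i Y * colSum l j Y ∂(Measure.pi fun _ : Fin k => ν) =
      k * ∫ x, l i x * l j x ∂ν := by
  induction k with
  | zero => simp [colSum_zero]
  | succ k ih =>
    have hA := fun j => hasAllMoments_colSum hl j k
    rw [integral_pi_succ]
    have e : ∀ z : E × (Fin k → E), colSum l i (Fin.cons z.1 z.2 : Fin (k + 1) → E) *
        colSum l j (Fin.cons z.1 z.2 : Fin (k + 1) → E) =
        l i z.1 * l j z.1 + l i z.1 * colSum l j z.2 + l j z.1 * colSum l i z.2 +
          colSum l i z.2 * colSum l j z.2 := by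
      intro z
      simp only [colSum_cons]
      ring
    simp_rw [e]
    have m1 := ((hl i).mul (hl j)).fst (μ' := Measure.pi fun _ : Fin k => ν)
    have m2 := (hl i).fst.mul (hA j).snd
    have m3 := (hl j).fst.mul (hA i).snd
    have m4 := ((hA i).mul (hA j)).snd (μ := ν)
    rw [integral_add ((m1.add m2).add m3).integrable m4.integrable,
      integral_add (m1.add m2).integrable m3.integrable,
      integral_add m1.integrable m2.integrable,
      integral_fun_fst (fun x : E => l i x * l j x),
      integral_fun_snd (fun Y : Fin k → E => colSum l i Y * colSum l j Y), ih,
      integral_prod_mul, integral_prod_mul, hi, hj]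
    simp
    ring

lemma integral_ustat (hl : ∀ j, HasAllMoments (l j) ν) (h0 : ∀ j ∈ J, ∫ x, l j x ∂ν = 0) (k : ℕ) :
    ∫ Y, ustat J l Y ∂(Measure.pi fun _ : Fin k => ν) = 0 := by
  induction k with
  | zero => simp [ustat_zero]
  | succ k ih =>
    have hA := fun j => hasAllMoments_colSum hl j k
    rw [integral_pi_succ]
    simp_rw [ustat_cons]
    rw [integral_add (hasAllMoments_ustat hl k).snd.integrable
      (hasAllMoments_sum_mul hl hA).integrable,
      integral_fun_snd (fun Y : Fin k → E => ustat J l Y), ih, integral_sum_mul hl hA,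
      Finset.sum_eq_zero fun j hj => by rw [h0 j hj, zero_mul]]
    simp

/-- Orthogonality of the degenerate and the linear parts. In the inductive expansion every term
other than the induction hypothesis has a factor of mean zero, either from the new observation or
from a column sum. -/
lemma integral_ustat_mul_colSum (hl : ∀ j, HasAllMoments (l j) ν)
    (h0 : ∀ j ∈ J, ∫ x, l j x ∂ν = 0) {j : κ} (hj : j ∈ J) (k : ℕ) :
    ∫ Y, ustat J l Y * colSum l j Y ∂(Measure.pi fun _ : Fin k => ν) = 0 := by
  induction k with
  | zero => simp [ustat_zero]
  | succ k ih =>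
    have hA := fun j => hasAllMoments_colSum hl j k
    have hU := hasAllMoments_ustat (J := J) hl k
    rw [integral_pi_succ]
    have e : ∀ z : E × (Fin k → E), ustat J l (Fin.cons z.1 z.2 : Fin (k + 1) → E) *
        colSum l j (Fin.cons z.1 z.2 : Fin (k + 1) → E) =
        l j z.1 * ustat J l z.2 + ustat J l z.2 * colSum l j z.2 +
          ∑ i ∈ J, (l i z.1 * l j z.1) * colSum l i z.2 +
          ∑ i ∈ J, l i z.1 * (colSum l i z.2 * colSum l j z.2) := by
      intro z
      simp only [colSum_cons, ustat_cons]
      rw [add_mul, mul_add, Finset.sum_mul, add_assoc _ (Finset.sum _ _), ← Finset.sum_add_distrib,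
        mul_comm (ustat J l z.2)]
      congr 1
      exact Finset.sum_congr rfl fun i _ => by ring
    simp_rw [e]
    have m1 := (hl j).fst.mul hU.snd
    have m2 := (hU.mul (hA j)).snd (μ := ν)
    have m3 := hasAllMoments_sum_mul (J := J) (fun i => (hl i).mul (hl j)) hA
    have m4 := hasAllMoments_sum_mul (J := J) hl fun i => (hA i).mul (hA j)
    rw [integral_add ((m1.add m2).add m3).integrable m4.integrable,
      integral_add (m1.add m2).integrable m3.integrable,
      integral_add m1.integrable m2.integrable,
      integral_fun_snd (fun Y : Fin k → E => ustat J l Y * colSum l j Y), ih,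
      integral_prod_mul, h0 j hj, integral_sum_mul (fun i => (hl i).mul (hl j)) hA,
      integral_sum_mul hl fun i => (hA i).mul (hA j),
      Finset.sum_eq_zero (s := J) fun i hi => by rw [integral_colSum hl, h0 i hi, mul_zero, mul_zero],
      Finset.sum_eq_zero (s := J) fun i hi => by rw [h0 i hi, zero_mul]]
    simp

/-- The increment is centered given the past, so second moments add up. The increment at size `k`
contributes `k` times the double sum of squared covariances, and summing over sizes gives `k (k - 1)
/ 2`. -/
lemma integral_ustat_sq (hl : ∀ j, HasAllMoments (l j) ν) (h0 : ∀ j ∈ J, ∫ x, l j x ∂ν = 0)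
    (k : ℕ) :
    ∫ Y, ustat J l Y ^ 2 ∂(Measure.pi fun _ : Fin k => ν) =
      (k : ℝ) * (k - 1) / 2 * ∑ i ∈ J, ∑ j ∈ J, (∫ x, l i x * l j x ∂ν) ^ 2 := by
  induction k with
  | zero => simp [ustat_zero]
  | succ k ih =>
    have hA := fun j => hasAllMoments_colSum hl j k
    have hU := hasAllMoments_ustat (J := J) hl k
    rw [integral_pi_succ]
    have e : ∀ z : E × (Fin k → E), ustat J l (Fin.cons z.1 z.2 : Fin (k + 1) → E) ^ 2 =
        ustat J l z.2 ^ 2 + 2 * (ustat J l z.2 * ∑ i ∈ J, l i z.1 * colSum l i z.2) +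
          (∑ i ∈ J, l i z.1 * colSum l i z.2) ^ 2 := by
      intro z
      simp only [ustat_cons]
      ring
    simp_rw [e]
    have m1 := (hU.pow 2).snd (μ := ν)
    have m2 := ((hU.snd (μ := ν)).mul (hasAllMoments_sum_mul (J := J) hl hA)).const_mul 2
    have m3 := (hasAllMoments_sum_mul (J := J) hl hA).pow 2
    rw [integral_add (m1.add m2).integrable m3.integrable,
      integral_add m1.integrable m2.integrable,
      integral_fun_snd (fun Y : Fin k → E => ustat J l Y ^ 2), ih, integral_const_mul,
      integral_mul_sum_mul hl hA hU, integral_sum_mul_sq hl hA]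
    have e1 : ∑ i ∈ J, (∫ x, l i x ∂ν) *
        ∫ Y, ustat J l Y * colSum l i Y ∂(Measure.pi fun _ : Fin k => ν) = 0 :=
      Finset.sum_eq_zero fun i hi => by rw [h0 i hi, zero_mul]
    have e2 : ∑ i ∈ J, ∑ j ∈ J, (∫ x, l i x * l j x ∂ν) *
        ∫ Y, colSum l i Y * colSum l j Y ∂(Measure.pi fun _ : Fin k => ν) =
        k * ∑ i ∈ J, ∑ j ∈ J, (∫ x, l i x * l j x ∂ν) ^ 2 := by
      rw [Finset.mul_sum]
      refine Finset.sum_congr rfl fun i hi => ?_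
      rw [Finset.mul_sum]
      refine Finset.sum_congr rfl fun j hj => ?_
      rw [integral_colSum_mul_colSum hl (h0 i hi) (h0 j hj)]
      ring
    rw [e1, e2]
    simp
    ring

/-- Fourth moment of a sum of i.i.d. centered variables. -/
lemma integral_sum_pow_four_le {g : E → ℝ} (hg : HasAllMoments g ν) (h0 : ∫ x, g x ∂ν = 0) (k : ℕ) :
    ∫ Y, (∑ i, g (Y i)) ^ 2 ∂(Measure.pi fun _ : Fin k => ν) = k * ∫ x, g x ^ 2 ∂ν ∧
    ∫ Y, (∑ i, g (Y i)) ^ 4 ∂(Measure.pi fun _ : Fin k => ν) ≤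
      k * ∫ x, g x ^ 4 ∂ν + 3 * (k : ℝ) ^ 2 * (∫ x, g x ^ 2 ∂ν) ^ 2 := by
  have h2 : ∀ k : ℕ, ∫ Y, (∑ i, g (Y i)) ^ 2 ∂(Measure.pi fun _ : Fin k => ν) =
      k * ∫ x, g x ^ 2 ∂ν := by
    intro k
    have := integral_colSum_mul_colSum (l := fun _ : Unit => g) (fun _ => hg) (i := ()) (j := ())
      h0 h0 k
    simpa only [colSum, ← sq] using this
  refine ⟨h2 k, ?_⟩
  induction k with
  | zero => simp
  | succ k ih =>
    have hA : HasAllMoments (fun Y : Fin k → E => ∑ i, g (Y i)) (Measure.pi fun _ => ν) :=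
      HasAllMoments.sum fun i _ => hg.eval (ρ := fun _ : Fin k => ν) i
    have hA0 : ∫ Y, ∑ i, g (Y i) ∂(Measure.pi fun _ : Fin k => ν) = 0 := by
      have := integral_colSum (l := fun _ : Unit => g) (fun _ => hg) () k
      simpa [colSum, h0] using this
    rw [integral_pi_succ]
    -- Terms containing the new variable or the past sum to the first power vanish. The term `6 g²
    -- (∑ g)²` gives `6 k (E g²)²`, which fits in `3 (k + 1)² - 3 k²`.
    have e : ∀ z : E × (Fin k → E), (∑ i, g ((Fin.cons z.1 z.2 : Fin (k + 1) → E) i)) ^ 4 =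
        (∑ i, g (z.2 i)) ^ 4 + 4 * (g z.1 * (∑ i, g (z.2 i)) ^ 3) +
          6 * (g z.1 ^ 2 * (∑ i, g (z.2 i)) ^ 2) + 4 * (g z.1 ^ 3 * ∑ i, g (z.2 i)) +
          g z.1 ^ 4 := by
      intro z
      simp only [Fin.sum_univ_succ, Fin.cons_zero, Fin.cons_succ]
      ring
    simp_rw [e]
    have m0 := (hA.pow 4).snd (μ := ν)
    have m1 := (hg.fst.mul (hA.pow 3).snd).const_mul 4
    have m2 := ((hg.pow 2).fst.mul (hA.pow 2).snd).const_mul 6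
    have m3 := ((hg.pow 3).fst.mul hA.snd).const_mul 4
    have m4 := (hg.pow 4).fst (μ' := Measure.pi fun _ : Fin k => ν)
    rw [integral_add (((m0.add m1).add m2).add m3).integrable m4.integrable,
      integral_add ((m0.add m1).add m2).integrable m3.integrable,
      integral_add (m0.add m1).integrable m2.integrable,
      integral_add m0.integrable m1.integrable,
      integral_const_mul, integral_const_mul, integral_const_mul,
      integral_prod_mul g (fun Y : Fin k → E => (∑ i, g (Y i)) ^ 3),
      integral_prod_mul (fun x => g x ^ 2) (fun Y : Fin k → E => (∑ i, g (Y i)) ^ 2),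
      integral_prod_mul (fun x => g x ^ 3) (fun Y : Fin k → E => ∑ i, g (Y i)),
      integral_fun_snd (fun Y : Fin k → E => (∑ i, g (Y i)) ^ 4),
      integral_fun_fst (fun x : E => g x ^ 4), h0, hA0, h2 k]
    simp only [probReal_univ, one_smul]
    push_cast
    have : 0 ≤ (∫ x, g x ^ 2 ∂ν) ^ 2 := sq_nonneg _
    nlinarith

/-- Mean and variance of a U-statistic of order two with a kernel of product form. -/
lemma integral_ustat_eq_and_variance_ustat (hl : ∀ j, HasAllMoments (l j) ν) (k : ℕ) :
    ∫ Y, ustat J l Y ∂(Measure.pi fun _ : Fin k => ν) =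
        (k : ℝ) * (k - 1) / 2 * ∑ j ∈ J, (∫ x, l j x ∂ν) ^ 2 ∧
      variance (fun Y : Fin k → E => ustat J l Y) (Measure.pi fun _ : Fin k => ν) =
        (k : ℝ) * (k - 1) / 2 * ∑ i ∈ J, ∑ j ∈ J, covariance (l i) (l j) ν ^ 2 +
          (k : ℝ) * (k - 1) ^ 2 * ∑ i ∈ J, ∑ j ∈ J,
            (∫ x, l i x ∂ν) * (∫ x, l j x ∂ν) * covariance (l i) (l j) ν := by
  set μ : κ → ℝ := fun j => ∫ x, l j x ∂ν with hμ
  set c : κ → E → ℝ := fun j x => l j x - μ j with hc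
  have hcm : ∀ j, HasAllMoments (c j) ν := fun j => (hl j).sub (HasAllMoments.const _)
  have hc0 : ∀ j, ∫ x, c j x ∂ν = 0 := by
    intro j
    rw [integral_sub (hl j).integrable (integrable_const _)]
    simp [hμ]
  have hcov : ∀ i j, ∫ x, c i x * c j x ∂ν = covariance (l i) (l j) ν := fun i j => rfl
  have hA := fun j => hasAllMoments_colSum hcm j k
  have hU := hasAllMoments_ustat (J := J) hcm k
  -- Hoeffding decomposition: each observation lies in `k - 1` pairs, whence the factor of the
  -- linear part.
  have dec : ∀ Y : Fin k → E, ustat J l Y = (k : ℝ) * (k - 1) / 2 * ∑ j ∈ J, μ j ^ 2 +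
      (ustat J c Y + (k - 1) * ∑ j ∈ J, μ j * colSum c j Y) := by
    intro Y
    have e1 : ∀ j, colSum l j Y = colSum c j Y + k * μ j := by
      intro j
      simp [colSum, hc]
    have e2 : ∀ j, ∑ i, l j (Y i) ^ 2 =
        ∑ i, c j (Y i) ^ 2 + 2 * μ j * colSum c j Y + k * μ j ^ 2 := by
      intro j
      have : ∀ i, l j (Y i) ^ 2 = c j (Y i) ^ 2 + 2 * μ j * c j (Y i) + μ j ^ 2 := by
        intro i
        simp only [hc]
        ring
      simp_rw [this, Finset.sum_add_distrib, ← Finset.mul_sum]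
      simp [colSum]
    simp only [ustat, e1, e2]
    rw [div_eq_iff two_ne_zero, Finset.mul_sum, Finset.mul_sum, add_mul, add_mul,
      div_mul_cancel₀ _ two_ne_zero, Finset.sum_mul, Finset.sum_mul, ← Finset.sum_add_distrib,
      ← Finset.sum_add_distrib]
    exact Finset.sum_congr rfl fun j _ => by ring
  have hB : HasAllMoments (fun Y : Fin k → E => ∑ j ∈ J, μ j * colSum c j Y)
      (Measure.pi fun _ => ν) := HasAllMoments.sum fun j _ => (hA j).const_mul _
  have hB0 : ∫ Y, ∑ j ∈ J, μ j * colSum c j Y ∂(Measure.pi fun _ : Fin k => ν) = 0 := by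
    rw [integral_finsetSum _ fun j _ => ((hA j).const_mul _).integrable]
    refine Finset.sum_eq_zero fun j _ => ?_
    rw [integral_const_mul, integral_colSum hcm, hc0]
    simp
  have hW := hU.add (hB.const_mul ((k : ℝ) - 1))
  have hW0 : ∫ Y, (ustat J c Y + ((k : ℝ) - 1) * ∑ j ∈ J, μ j * colSum c j Y)
      ∂(Measure.pi fun _ : Fin k => ν) = 0 := by
    rw [integral_add hU.integrable (hB.const_mul _).integrable, integral_const_mul, hB0,
      integral_ustat hcm fun j _ => hc0 j]
    simp
  have hmean : ∫ Y, ustat J l Y ∂(Measure.pi fun _ : Fin k => ν) =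
      (k : ℝ) * (k - 1) / 2 * ∑ j ∈ J, μ j ^ 2 := by
    simp_rw [dec]
    rw [integral_add (integrable_const _) hW.integrable, hW0]
    simp
  refine ⟨hmean, ?_⟩
  rw [variance_eq_integral (hasAllMoments_ustat hl k).integrable.aemeasurable, hmean]
  -- The cross term between the degenerate and the linear parts is isolated here; it integrates to
  -- zero by `integral_ustat_mul_colSum`.
  have e : ∀ Y : Fin k → E, (ustat J l Y - (k : ℝ) * (k - 1) / 2 * ∑ j ∈ J, μ j ^ 2) ^ 2 =
      ustat J c Y ^ 2 + (2 * ((k : ℝ) - 1)) * (∑ j ∈ J, μ j * (ustat J c Y * colSum c j Y)) +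
      ((k : ℝ) - 1) ^ 2 * ∑ i ∈ J, ∑ j ∈ J, μ i * μ j * (colSum c i Y * colSum c j Y) := by
    intro Y
    have h1 : ∑ j ∈ J, μ j * (ustat J c Y * colSum c j Y) =
        ustat J c Y * ∑ j ∈ J, μ j * colSum c j Y := by
      rw [Finset.mul_sum]
      exact Finset.sum_congr rfl fun j _ => by ring
    have h2 : ∑ i ∈ J, ∑ j ∈ J, μ i * μ j * (colSum c i Y * colSum c j Y) =
        (∑ j ∈ J, μ j * colSum c j Y) ^ 2 := by
      rw [sq, Finset.sum_mul_sum]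
      exact Finset.sum_congr rfl fun i _ => Finset.sum_congr rfl fun j _ => by ring
    rw [dec, h1, h2]
    ring
  simp_rw [e]
  have m1 := hU.pow 2
  have m2 := (HasAllMoments.sum (J := J) fun j _ => (hU.mul (hA j)).const_mul (μ j)).const_mul
    (2 * ((k : ℝ) - 1))
  have m3' := fun i => HasAllMoments.sum (J := J) fun j _ =>
    ((hA i).mul (hA j)).const_mul (μ i * μ j)
  have m3 := (HasAllMoments.sum (J := J) fun i _ => m3' i).const_mul (((k : ℝ) - 1) ^ 2)
  rw [integral_add (m1.add m2).integrable m3.integrable, integral_add m1.integrable m2.integrable,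
    integral_const_mul, integral_const_mul, integral_ustat_sq hcm fun j _ => hc0 j,
    integral_finsetSum _ fun j _ => ((hU.mul (hA j)).const_mul (μ j)).integrable,
    integral_finsetSum _ fun i _ => (m3' i).integrable]
  have e2 : ∑ j ∈ J, ∫ Y, μ j * (ustat J c Y * colSum c j Y)
      ∂(Measure.pi fun _ : Fin k => ν) = 0 := Finset.sum_eq_zero fun j hj => by
    rw [integral_const_mul, integral_ustat_mul_colSum hcm (fun j _ => hc0 j) hj, mul_zero]
  have e3 : ∑ i ∈ J, ∫ Y, ∑ j ∈ J, μ i * μ j * (colSum c i Y * colSum c j Y)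
      ∂(Measure.pi fun _ : Fin k => ν) =
      k * ∑ i ∈ J, ∑ j ∈ J, μ i * μ j * covariance (l i) (l j) ν := by
    rw [Finset.mul_sum]
    refine Finset.sum_congr rfl fun i _ => ?_
    rw [integral_finsetSum _ fun j _ => (((hA i).mul (hA j)).const_mul (μ i * μ j)).integrable,
      Finset.mul_sum]
    refine Finset.sum_congr rfl fun j _ => ?_
    rw [integral_const_mul, integral_colSum_mul_colSum hcm (hc0 i) (hc0 j), hcov]
    ring
  rw [e2, e3]
  simp only [hcov]
  ring

end iid

/-! ### Taylor bounds and moments of isotropic statistics -/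

section clt

lemma norm_exp_I_sub_taylor_le (x : ℝ) :
    ‖Complex.exp (x * Complex.I) - (1 + x * Complex.I - x ^ 2 / 2)‖ ≤ 4 * |x| ^ 3 := by
  rcases le_or_gt |x| 1 with h | h
  · have hx : ‖(x : ℂ) * Complex.I‖ = |x| := by simp
    have := Complex.exp_bound (x := x * Complex.I) (by rw [hx]; exact h) (n := 3) (by norm_num)
    rw [hx] at this
    have e : ∑ k ∈ Finset.range 3, ((x : ℂ) * Complex.I) ^ k / (k.factorial : ℂ) =
        1 + x * Complex.I - x ^ 2 / 2 := by
      simp [Finset.sum_range_succ, mul_pow, Nat.factorial]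
      ring
    rw [e] at this
    refine this.trans ?_
    rw [mul_comm]
    gcongr
    norm_num [Nat.factorial]
  · have h1 : ‖Complex.exp (x * Complex.I)‖ = 1 := Complex.norm_exp_ofReal_mul_I x
    have h2 : ‖(1 : ℂ) + x * Complex.I - x ^ 2 / 2‖ ≤ 1 + |x| + |x| ^ 2 / 2 := by
      refine (norm_sub_le _ _).trans (add_le_add ((norm_add_le _ _).trans ?_) ?_)
      · simp
      · simp
    refine (norm_sub_le _ _).trans ?_
    rw [h1]
    have h3 : |x| ≤ |x| ^ 3 := le_self_pow₀ h.le (by norm_num)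
    have h4 : |x| ^ 2 ≤ |x| ^ 3 := pow_le_pow_right₀ h.le (by norm_num)
    linarith

/-- By the inequality of arithmetic and geometric means, `4|x|³ ≤ 2ηx² + (2/η)x⁴`, so only even
moments are needed. The parameter `η` stays free and is chosen small only in the final limit. -/
lemma norm_exp_I_sub_taylor_le' (x : ℝ) {η : ℝ} (hη : 0 < η) :
    ‖Complex.exp (x * Complex.I) - (1 + x * Complex.I - x ^ 2 / 2)‖ ≤
      2 * η * x ^ 2 + 2 / η * x ^ 4 := by
  refine (norm_exp_I_sub_taylor_le x).trans ?_
  have h : 2 * η * x ^ 2 + 2 / η * x ^ 4 - 4 * |x| ^ 3 = 2 / η * (x ^ 2 * (η - |x|) ^ 2) := by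
    have h2 : x ^ 2 = |x| ^ 2 := (sq_abs x).symm
    have h4 : x ^ 4 = |x| ^ 4 := by rw [show 4 = 2 * 2 from rfl, pow_mul, pow_mul, h2]
    rw [h4, h2]
    field_simp
    ring
  have : 0 ≤ 2 / η * (x ^ 2 * (η - |x|) ^ 2) := by positivity
  linarith

lemma abs_one_sub_sub_exp_neg_le {x : ℝ} (hx : 0 ≤ x) : |1 - x - Real.exp (-x)| ≤ x ^ 2 := by
  rcases le_or_gt x 1 with h | h
  · have := Real.abs_exp_sub_one_sub_id_le (x := -x) (by rwa [abs_neg, abs_of_nonneg hx])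
    rw [abs_sub_comm]
    calc _ = |Real.exp (-x) - 1 - -x| := by congr 1; ring
      _ ≤ (-x) ^ 2 := this
      _ = x ^ 2 := by ring
  · have h1 : Real.exp (-x) ≤ 1 := Real.exp_le_one_iff.2 (by linarith)
    have h2 := Real.exp_pos (-x)
    rw [abs_le]
    constructor <;> nlinarith

variable {E κ : Type*} [MeasurableSpace E] {ν : Measure E} [IsProbabilityMeasure ν]
  [DecidableEq κ] {J : Finset κ} {l : κ → E → ℝ} {v : ℝ}

/-- The functions `l_j`, `j ∈ J`, are centered and uncorrelated with common variance `v`. -/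
structure IsIsotropic (J : Finset κ) (l : κ → E → ℝ) (v : ℝ) (ν : Measure E) : Prop where
  hasAllMoments : ∀ j, HasAllMoments (l j) ν
  integral_eq_zero : ∀ j ∈ J, ∫ x, l j x ∂ν = 0
  integral_mul : ∀ i ∈ J, ∀ j ∈ J, ∫ x, l i x * l j x ∂ν = if i = j then v else 0

namespace IsIsotropic

omit [IsProbabilityMeasure ν] in
-- Contracting with the covariance, which is `v` times the identity, leaves `v` times a trace.
lemma sum_sum (hI : IsIsotropic J l v ν) (w : κ → κ → ℝ) :
    ∑ i ∈ J, ∑ j ∈ J, (∫ x, l i x * l j x ∂ν) * w i j = v * ∑ i ∈ J, w i i := by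
  rw [Finset.mul_sum]
  refine Finset.sum_congr rfl fun i hi => ?_
  rw [Finset.sum_congr rfl fun j hj => by rw [hI.integral_mul i hi j hj]]
  simp [hi]

lemma hasAllMoments_normSq (hI : IsIsotropic J l v ν) :
    HasAllMoments (fun x => ∑ j ∈ J, l j x ^ 2) ν :=
  HasAllMoments.sum fun j _ => (hI.hasAllMoments j).pow 2

lemma hasAllMoments_colSumSq (hI : IsIsotropic J l v ν) (k : ℕ) :
    HasAllMoments (fun Y : Fin k → E => ∑ j ∈ J, colSum l j Y ^ 2) (Measure.pi fun _ => ν) :=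
  HasAllMoments.sum fun j _ => (hasAllMoments_colSum hI.hasAllMoments j k).pow 2

lemma integral_normSq (hI : IsIsotropic J l v ν) :
    ∫ x, ∑ j ∈ J, l j x ^ 2 ∂ν = J.card * v := by
  rw [integral_finsetSum _ fun j _ => ((hI.hasAllMoments j).pow 2).integrable,
    Finset.sum_congr rfl fun j hj => by
      simpa only [← sq, if_true] using hI.integral_mul j hj j hj]
  simp

lemma integral_colSumSq (hI : IsIsotropic J l v ν) (k : ℕ) :
    ∫ Y, ∑ j ∈ J, colSum l j Y ^ 2 ∂(Measure.pi fun _ : Fin k => ν) = k * J.card * v := by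
  rw [integral_finsetSum _ fun j _ =>
    ((hasAllMoments_colSum hI.hasAllMoments j k).pow 2).integrable]
  have h : ∀ j ∈ J, ∫ Y, colSum l j Y ^ 2 ∂(Measure.pi fun _ : Fin k => ν) = k * v := by
    intro j hj
    have := integral_colSum_mul_colSum hI.hasAllMoments (hI.integral_eq_zero j hj)
      (hI.integral_eq_zero j hj) k
    rw [hI.integral_mul j hj j hj, if_pos rfl] at this
    simpa only [← sq] using this
  rw [Finset.sum_congr rfl h]
  simp
  ring

/-- Second moment of the bilinear form of a new observation and the sample sums. -/
lemma integral_bilin_sq (hI : IsIsotropic J l v ν) (k : ℕ) :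
    ∫ z : E × (Fin k → E), (∑ j ∈ J, l j z.1 * colSum l j z.2) ^ 2
      ∂(ν.prod (Measure.pi fun _ => ν)) = k * J.card * v ^ 2 := by
  have hA := fun j => hasAllMoments_colSum hI.hasAllMoments j k
  have h := hI.integral_colSumSq k
  rw [integral_finsetSum _ fun j _ => ((hA j).pow 2).integrable] at h
  rw [integral_sum_mul_sq hI.hasAllMoments hA,
    hI.sum_sum fun i j => ∫ Y, colSum l i Y * colSum l j Y ∂(Measure.pi fun _ : Fin k => ν)]
  simp_rw [← sq]
  rw [h]
  ring

omit [IsProbabilityMeasure ν] in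
lemma integral_linear (hI : IsIsotropic J l v ν) (u : κ → ℝ) :
    ∫ x, ∑ j ∈ J, u j * l j x ∂ν = 0 := by
  rw [integral_finsetSum _ fun j _ => ((hI.hasAllMoments j).const_mul _).integrable]
  exact Finset.sum_eq_zero fun j hj => by rw [integral_const_mul, hI.integral_eq_zero j hj, mul_zero]

lemma integral_linear_sq (hI : IsIsotropic J l v ν) (u : κ → ℝ) :
    ∫ x, (∑ j ∈ J, u j * l j x) ^ 2 ∂ν = v * ∑ j ∈ J, u j ^ 2 := by
  -- A fixed vector `u` is a random one on a one-point space, so the formula for bilinear forms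
  -- applies.
  have h := integral_sum_mul_sq (J := J) (ν := ν) (ρ := Measure.dirac ())
    (g := fun j (_ : Unit) => u j) hI.hasAllMoments fun j => HasAllMoments.const _
  simp only [integral_const, probReal_univ, one_smul] at h
  rw [hI.sum_sum fun i j => u i * u j, integral_fun_fst
    (fun x => (∑ j ∈ J, l j x * u j) ^ 2)] at h
  simp only [probReal_univ, one_smul] at h
  simpa only [mul_comm, sq] using h

/-- Fourth moment of the bilinear form of a new observation and the sample sums. -/
lemma integral_bilin_pow_four_le (hI : IsIsotropic J l v ν) (k : ℕ) :
    ∫ z : E × (Fin k → E), (∑ j ∈ J, l j z.1 * colSum l j z.2) ^ 4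
      ∂(ν.prod (Measure.pi fun _ => ν)) ≤
      k * (∫ z : E × E, (∑ j ∈ J, l j z.1 * l j z.2) ^ 4 ∂(ν.prod ν)) +
        3 * (k : ℝ) ^ 2 * v ^ 2 * ∫ x, (∑ j ∈ J, l j x ^ 2) ^ 2 ∂ν := by
  have hA := fun j => hasAllMoments_colSum hI.hasAllMoments j k
  have hB := (hasAllMoments_sum_mul (J := J) hI.hasAllMoments hA).pow 4
  have hH := (hasAllMoments_sum_mul (J := J) hI.hasAllMoments hI.hasAllMoments).pow 4
  rw [integral_prod _ hB.integrable, integral_prod _ hH.integrable, ← integral_const_mul,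
    ← integral_const_mul, ← integral_add (hH.integrable.integral_prod_left.const_mul _)
      ((hI.hasAllMoments_normSq.pow 2).const_mul _).integrable]
  refine integral_mono hB.integrable.integral_prod_left
    ((hH.integrable.integral_prod_left.const_mul _).add
      ((hI.hasAllMoments_normSq.pow 2).const_mul _).integrable) fun y => ?_
  -- For a fixed new observation `y` the bilinear form is a sum of `k` i.i.d. centered variables of
  -- variance `v ∑_j l_j(y)²`.
  have hg : HasAllMoments (fun x => ∑ j ∈ J, l j y * l j x) ν :=
    HasAllMoments.sum fun j _ => (hI.hasAllMoments j).const_mul _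
  have h := (integral_sum_pow_four_le hg (hI.integral_linear fun j => l j y) k).2
  rw [hI.integral_linear_sq fun j => l j y] at h
  have e : ∀ Y : Fin k → E, ∑ i, ∑ j ∈ J, l j y * l j (Y i) = ∑ j ∈ J, l j y * colSum l j Y := by
    intro Y
    rw [Finset.sum_comm]
    exact Finset.sum_congr rfl fun j _ => by rw [colSum, Finset.mul_sum]
  simp_rw [e] at h
  refine h.trans (le_of_eq ?_)
  ring

/-- Concentration of the squared norm of the sample sums. -/
lemma integral_colSumSq_sub_sq_le (hI : IsIsotropic J l v ν) (k : ℕ) :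
    ∫ Y : Fin k → E, (∑ j ∈ J, colSum l j Y ^ 2 - k * J.card * v) ^ 2 ∂(Measure.pi fun _ => ν) ≤
      k * (∫ x, (∑ j ∈ J, l j x ^ 2) ^ 2 ∂ν) + 2 * (k : ℝ) ^ 2 * J.card * v ^ 2 := by
  induction k with
  | zero => simp [colSum_zero]
  | succ k ih =>
    have hl := hI.hasAllMoments
    have hA := fun j => hasAllMoments_colSum hl j k
    set N : E → ℝ := fun x => ∑ j ∈ J, l j x ^ 2 - J.card * v with hN
    set Q : (Fin k → E) → ℝ := fun Y => ∑ j ∈ J, colSum l j Y ^ 2 - k * J.card * v with hQ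
    have hNm : HasAllMoments N ν := hI.hasAllMoments_normSq.sub (HasAllMoments.const _)
    have hQm : HasAllMoments Q (Measure.pi fun _ => ν) :=
      (hI.hasAllMoments_colSumSq k).sub (HasAllMoments.const _)
    have hN0 : ∫ x, N x ∂ν = 0 := by
      rw [integral_sub hI.hasAllMoments_normSq.integrable (integrable_const _), hI.integral_normSq]
      simp
    have hNsq : ∫ x, N x ^ 2 ∂ν ≤ ∫ x, (∑ j ∈ J, l j x ^ 2) ^ 2 ∂ν := by
      have := variance_le_expectation_sq (μ := ν)
        hI.hasAllMoments_normSq.integrable.aestronglyMeasurable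
      rwa [variance_eq_integral hI.hasAllMoments_normSq.integrable.aemeasurable,
        hI.integral_normSq] at this
    have hB := hasAllMoments_sum_mul (J := J) hl hA
    rw [integral_pi_succ]
    -- With `X` the bilinear form, the centered squared norm passes from `Q` to `Q + N + 2X`. All
    -- three cross terms integrate to zero; `4 E X² = 4 k |J| v²`, summed over `k`, stays below `2
    -- k² |J| v²`.
    have e : ∀ z : E × (Fin k → E),
        (∑ j ∈ J, colSum l j (Fin.cons z.1 z.2 : Fin (k + 1) → E) ^ 2 -
          ((k + 1 : ℕ) : ℝ) * J.card * v) ^ 2 =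
        Q z.2 ^ 2 + N z.1 ^ 2 + 4 * (∑ j ∈ J, l j z.1 * colSum l j z.2) ^ 2 +
          2 * (N z.1 * Q z.2) + 4 * (Q z.2 * ∑ j ∈ J, l j z.1 * colSum l j z.2) +
          4 * ∑ j ∈ J, (N z.1 * l j z.1) * colSum l j z.2 := by
      intro z
      have h1 : ∑ j ∈ J, colSum l j (Fin.cons z.1 z.2 : Fin (k + 1) → E) ^ 2 =
          ∑ j ∈ J, l j z.1 ^ 2 + 2 * (∑ j ∈ J, l j z.1 * colSum l j z.2) +
            ∑ j ∈ J, colSum l j z.2 ^ 2 := by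
        rw [Finset.mul_sum, ← Finset.sum_add_distrib, ← Finset.sum_add_distrib]
        exact Finset.sum_congr rfl fun j _ => by rw [colSum_cons]; ring
      have h2 : ∑ j ∈ J, (N z.1 * l j z.1) * colSum l j z.2 =
          N z.1 * ∑ j ∈ J, l j z.1 * colSum l j z.2 := by
        rw [Finset.mul_sum]
        exact Finset.sum_congr rfl fun j _ => by ring
      rw [h1, h2]
      simp only [hN, hQ]
      push_cast
      ring
    simp_rw [e]
    have m1 := (hQm.pow 2).snd (μ := ν)
    have m2 := (hNm.pow 2).fst (μ' := Measure.pi fun _ : Fin k => ν)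
    have m3 := (hB.pow 2).const_mul 4
    have m4 := (hNm.fst.mul hQm.snd).const_mul 2
    have m5 := ((hQm.snd (μ := ν)).mul hB).const_mul 4
    have m6 := (hasAllMoments_sum_mul (J := J) (fun j => hNm.mul (hl j)) hA).const_mul 4
    rw [integral_add ((((m1.add m2).add m3).add m4).add m5).integrable m6.integrable,
      integral_add (((m1.add m2).add m3).add m4).integrable m5.integrable,
      integral_add ((m1.add m2).add m3).integrable m4.integrable,
      integral_add (m1.add m2).integrable m3.integrable,
      integral_add m1.integrable m2.integrable,
      integral_const_mul, integral_const_mul, integral_const_mul, integral_const_mul,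
      hI.integral_bilin_sq, integral_prod_mul N Q, integral_mul_sum_mul hl hA hQm,
      integral_sum_mul (fun j => hNm.mul (hl j)) hA, hN0,
      integral_fun_snd (fun Y : Fin k → E => Q Y ^ 2), integral_fun_fst (fun x : E => N x ^ 2),
      Finset.sum_eq_zero (f := fun j => (∫ x, l j x ∂ν) *
        ∫ Y, Q Y * colSum l j Y ∂(Measure.pi fun _ : Fin k => ν))
        fun j hj => by rw [hI.integral_eq_zero j hj, zero_mul],
      Finset.sum_eq_zero (f := fun j => (∫ x, N x * l j x ∂ν) *
        ∫ Y, colSum l j Y ∂(Measure.pi fun _ : Fin k => ν))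
        fun j hj => by rw [integral_colSum hl, hI.integral_eq_zero j hj, mul_zero, mul_zero]]
    simp only [probReal_univ, one_smul]
    push_cast
    have : 0 ≤ (J.card : ℝ) * v ^ 2 := by positivity
    nlinarith

end IsIsotropic

end clt

/-! ### The characteristic function of a degenerate U-statistic -/

section cf
variable {E κ : Type*} [MeasurableSpace E] {ν : Measure E} [IsProbabilityMeasure ν]
  [DecidableEq κ] {J : Finset κ} {l : κ → E → ℝ} {v : ℝ}

/-- The characteristic function of the U-statistic of a sample of size `k`. -/
noncomputable def ustatCF (ν : Measure E) (J : Finset κ) (l : κ → E → ℝ) (s : ℝ) (k : ℕ) : ℂ :=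
  ∫ Y, Complex.exp ((s * ustat J l Y : ℝ) * Complex.I) ∂(Measure.pi fun _ : Fin k => ν)

namespace IsIsotropic

lemma integrable_exp_mul {F : Type*} [MeasurableSpace F] {ρ : Measure F} [IsProbabilityMeasure ρ]
    {U f : F → ℝ} (hU : HasAllMoments U ρ) (hf : HasAllMoments f ρ) :
    Integrable (fun y => Complex.exp ((U y : ℝ) * Complex.I) * (f y : ℂ)) ρ := by
  refine (hf.integrable.ofReal (𝕜 := ℂ)).bdd_mul (c := 1) ?_
    (.of_forall fun y => (Complex.norm_exp_ofReal_mul_I _).le)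
  exact Complex.continuous_exp.comp_aestronglyMeasurable
    ((Complex.continuous_ofReal.comp_aestronglyMeasurable
      hU.integrable.aestronglyMeasurable).mul_const _)

omit [DecidableEq κ] in
lemma norm_ustatCF_le (s : ℝ) (k : ℕ) : ‖ustatCF ν J l s k‖ ≤ 1 := by
  refine (norm_integral_le_integral_norm _).trans ?_
  simp_rw [Complex.norm_exp_ofReal_mul_I]
  simp

/-- The exponential depends on the past only, and the new observation is centered. -/
lemma integral_exp_mul_bilin (hI : IsIsotropic J l v ν) (s : ℝ) (k : ℕ) :
    ∫ z : E × (Fin k → E), Complex.exp ((s * ustat J l z.2 : ℝ) * Complex.I) *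
      ((∑ j ∈ J, l j z.1 * colSum l j z.2 : ℝ) : ℂ) ∂(ν.prod (Measure.pi fun _ => ν)) = 0 := by
  have hA := fun j => hasAllMoments_colSum hI.hasAllMoments j k
  have hU := (hasAllMoments_ustat (J := J) hI.hasAllMoments k).const_mul s
  have e : ∀ z : E × (Fin k → E), Complex.exp ((s * ustat J l z.2 : ℝ) * Complex.I) *
      ((∑ j ∈ J, l j z.1 * colSum l j z.2 : ℝ) : ℂ) = ∑ j ∈ J, (l j z.1 : ℂ) *
        (Complex.exp ((s * ustat J l z.2 : ℝ) * Complex.I) * (colSum l j z.2 : ℝ)) := by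
    intro z
    push_cast
    rw [Finset.mul_sum]
    exact Finset.sum_congr rfl fun j _ => by ring
  have hint : ∀ j ∈ J, Integrable (fun z : E × (Fin k → E) => (l j z.1 : ℂ) *
      (Complex.exp ((s * ustat J l z.2 : ℝ) * Complex.I) * (colSum l j z.2 : ℝ)))
      (ν.prod (Measure.pi fun _ => ν)) := fun j _ =>
    ((hI.hasAllMoments j).integrable.ofReal (𝕜 := ℂ)).mul_prod (integrable_exp_mul hU (hA j))
  simp_rw [e]
  rw [integral_finsetSum _ hint]
  refine Finset.sum_eq_zero fun j hj => ?_
  rw [integral_prod_mul (fun x => (l j x : ℂ)) (fun Y : Fin k → E =>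
    Complex.exp ((s * ustat J l Y : ℝ) * Complex.I) * (colSum l j Y : ℝ)), integral_complex_ofReal,
    hI.integral_eq_zero j hj]
  simp

/-- By isotropy, the conditional second moment of the bilinear form given the past is `v` times the
squared norm of the column sums. -/
lemma integral_exp_mul_bilin_sq (hI : IsIsotropic J l v ν) (s : ℝ) (k : ℕ) :
    ∫ z : E × (Fin k → E), Complex.exp ((s * ustat J l z.2 : ℝ) * Complex.I) *
      (((∑ j ∈ J, l j z.1 * colSum l j z.2) ^ 2 : ℝ) : ℂ) ∂(ν.prod (Measure.pi fun _ => ν)) =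
    v * ∫ Y : Fin k → E, Complex.exp ((s * ustat J l Y : ℝ) * Complex.I) *
      ((∑ j ∈ J, colSum l j Y ^ 2 : ℝ) : ℂ) ∂(Measure.pi fun _ => ν) := by
  have hl := hI.hasAllMoments
  have hA := fun j => hasAllMoments_colSum hl j k
  have hU := (hasAllMoments_ustat (J := J) hl k).const_mul s
  have e : ∀ z : E × (Fin k → E), Complex.exp ((s * ustat J l z.2 : ℝ) * Complex.I) *
      (((∑ j ∈ J, l j z.1 * colSum l j z.2) ^ 2 : ℝ) : ℂ) = ∑ q ∈ J ×ˢ J,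
        ((l q.1 z.1 * l q.2 z.1 : ℝ) : ℂ) *
        (Complex.exp ((s * ustat J l z.2 : ℝ) * Complex.I) *
          ((colSum l q.1 z.2 * colSum l q.2 z.2 : ℝ) : ℂ)) := by
    intro z
    rw [sq, Finset.sum_mul_sum, Finset.sum_product]
    push_cast
    rw [Finset.mul_sum]
    refine Finset.sum_congr rfl fun i _ => ?_
    rw [Finset.mul_sum]
    exact Finset.sum_congr rfl fun j _ => by ring
  simp_rw [e]
  have hint : ∀ q : κ × κ, Integrable (fun Y : Fin k → E =>
      Complex.exp ((s * ustat J l Y : ℝ) * Complex.I) *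
        ((colSum l q.1 Y * colSum l q.2 Y : ℝ) : ℂ)) (Measure.pi fun _ => ν) :=
    fun q => integrable_exp_mul hU ((hA q.1).mul (hA q.2))
  have hint' : ∀ q ∈ J ×ˢ J, Integrable (fun z : E × (Fin k → E) =>
      ((l q.1 z.1 * l q.2 z.1 : ℝ) : ℂ) *
        (Complex.exp ((s * ustat J l z.2 : ℝ) * Complex.I) *
          ((colSum l q.1 z.2 * colSum l q.2 z.2 : ℝ) : ℂ))) (ν.prod (Measure.pi fun _ => ν)) :=
    fun q _ => (((hl q.1).mul (hl q.2)).integrable.ofReal (𝕜 := ℂ)).mul_prod (hint q)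
  rw [integral_finsetSum _ hint', Finset.sum_product]
  have e2 : ∀ Y : Fin k → E, Complex.exp ((s * ustat J l Y : ℝ) * Complex.I) *
      ((∑ j ∈ J, colSum l j Y ^ 2 : ℝ) : ℂ) = ∑ j ∈ J,
      Complex.exp ((s * ustat J l Y : ℝ) * Complex.I) *
        ((colSum l j Y * colSum l j Y : ℝ) : ℂ) := by
    intro Y
    push_cast
    rw [Finset.mul_sum]
    exact Finset.sum_congr rfl fun j _ => by ring
  simp_rw [e2]
  rw [integral_finsetSum _ fun j _ => hint (j, j), Finset.mul_sum]
  refine Finset.sum_congr rfl fun i hi => ?_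
  rw [Finset.sum_eq_single i]
  · rw [integral_prod_mul (fun x => ((l i x * l i x : ℝ) : ℂ)) (fun Y : Fin k → E =>
      Complex.exp ((s * ustat J l Y : ℝ) * Complex.I) * ((colSum l i Y * colSum l i Y : ℝ) : ℂ)),
      integral_complex_ofReal, hI.integral_mul i hi i hi, if_pos rfl]
  · intro j hj hji
    rw [integral_prod_mul (fun x => ((l i x * l j x : ℝ) : ℂ)) (fun Y : Fin k → E =>
      Complex.exp ((s * ustat J l Y : ℝ) * Complex.I) * ((colSum l i Y * colSum l j Y : ℝ) : ℂ)),
      integral_complex_ofReal, hI.integral_mul i hi j hj, if_neg (Ne.symm hji)]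
    simp
  · exact fun h => absurd hi h

/-- One step of the recursion for the characteristic function of the U-statistic. -/
lemma norm_ustatCF_succ_sub_le (hI : IsIsotropic J l v ν) (hv : 0 ≤ v) (s : ℝ) {η : ℝ}
    (hη : 0 < η) (k : ℕ) :
    ‖ustatCF ν J l s (k + 1) - ustatCF ν J l s k * (1 - s ^ 2 * v ^ 2 * J.card * k / 2 : ℝ)‖ ≤
      2 * η * (s ^ 2 * (k * J.card * v ^ 2)) +
      2 / η * (s ^ 4 * (k * (∫ z : E × E, (∑ j ∈ J, l j z.1 * l j z.2) ^ 4 ∂(ν.prod ν)) +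
        3 * (k : ℝ) ^ 2 * v ^ 2 * ∫ x, (∑ j ∈ J, l j x ^ 2) ^ 2 ∂ν)) +
      s ^ 2 * v / 2 * √(k * (∫ x, (∑ j ∈ J, l j x ^ 2) ^ 2 ∂ν) +
        2 * (k : ℝ) ^ 2 * J.card * v ^ 2) := by
  have hl := hI.hasAllMoments
  have hA := fun j => hasAllMoments_colSum hl j k
  have hU := (hasAllMoments_ustat (J := J) hl k).const_mul s
  set P := ν.prod (Measure.pi fun _ : Fin k => ν) with hP
  set X : E × (Fin k → E) → ℝ := fun z => ∑ j ∈ J, l j z.1 * colSum l j z.2 with hX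
  have hXm : HasAllMoments X P := hasAllMoments_sum_mul hl hA
  set ex : (Fin k → E) → ℂ := fun Y => Complex.exp ((s * ustat J l Y : ℝ) * Complex.I) with hex
  have hexn : ∀ Y, ‖ex Y‖ = 1 := fun Y => Complex.norm_exp_ofReal_mul_I _
  set R : E × (Fin k → E) → ℂ := fun z =>
    Complex.exp (((s * X z : ℝ) : ℂ) * Complex.I) -
      (1 + ((s * X z : ℝ) : ℂ) * Complex.I - ((s * X z : ℝ) : ℂ) ^ 2 / 2) with hR
  have i0 : Integrable (fun z : E × (Fin k → E) => ex z.2) P := by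
    simpa only [Complex.ofReal_one, mul_one] using
      integrable_exp_mul (hU.snd (μ := ν)) (HasAllMoments.const (μ := P) 1)
  have i1 : Integrable (fun z : E × (Fin k → E) => ex z.2 * (X z : ℂ)) P :=
    integrable_exp_mul (hU.snd (μ := ν)) hXm
  have i2 : Integrable (fun z : E × (Fin k → E) => ex z.2 * ((X z ^ 2 : ℝ) : ℂ)) P :=
    integrable_exp_mul (hU.snd (μ := ν)) (hXm.pow 2)
  have i3 : Integrable (fun z : E × (Fin k → E) =>
      Complex.exp ((s * (ustat J l z.2 + X z) : ℝ) * Complex.I)) P := by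
    simpa only [Complex.ofReal_one, mul_one] using
      integrable_exp_mul (((hasAllMoments_ustat (J := J) hl k).snd.add hXm).const_mul s)
      (HasAllMoments.const (μ := P) 1)
  -- Factor `e^{is(U + X)} = e^{isU} e^{isX}` and expand only the second exponential, to second
  -- order.
  have dec : ∀ z : E × (Fin k → E), Complex.exp ((s * (ustat J l z.2 + X z) : ℝ) * Complex.I) -
      (ex z.2 + (s * Complex.I) * (ex z.2 * (X z : ℂ)) -
        (s ^ 2 / 2 : ℂ) * (ex z.2 * ((X z ^ 2 : ℝ) : ℂ))) = ex z.2 * R z := by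
    intro z
    simp only [hex, hR]
    rw [mul_add, Complex.ofReal_add, add_mul, Complex.exp_add]
    push_cast
    ring
  have hrem : ‖∫ z, ex z.2 * R z ∂P‖ ≤ 2 * η * (s ^ 2 * (k * J.card * v ^ 2)) +
      2 / η * (s ^ 4 * (k * (∫ z : E × E, (∑ j ∈ J, l j z.1 * l j z.2) ^ 4 ∂(ν.prod ν)) +
        3 * (k : ℝ) ^ 2 * v ^ 2 * ∫ x, (∑ j ∈ J, l j x ^ 2) ^ 2 ∂ν)) := by
    have b1 := ((hXm.const_mul s).pow 2).const_mul (2 * η)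
    have b2 := ((hXm.const_mul s).pow 4).const_mul (2 / η)
    refine (norm_integral_le_of_norm_le (b1.add b2).integrable (.of_forall fun z => ?_)).trans ?_
    · rw [norm_mul, hexn, one_mul]
      exact norm_exp_I_sub_taylor_le' (s * X z) hη
    · rw [integral_add b1.integrable b2.integrable, integral_const_mul, integral_const_mul]
      simp_rw [mul_pow]
      rw [integral_const_mul, integral_const_mul, hX, hP, hI.integral_bilin_sq]
      gcongr
      exact hI.integral_bilin_pow_four_le k
  have hS := hI.hasAllMoments_colSumSq k
  -- Replacing the squared norm of the column sums by its mean costs at most its standard deviation,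
  -- as the exponential has modulus one.
  have hcond : ‖(∫ Y : Fin k → E, ex Y * ((∑ j ∈ J, colSum l j Y ^ 2 : ℝ) : ℂ)
      ∂(Measure.pi fun _ => ν)) - ustatCF ν J l s k * (k * J.card * v : ℝ)‖ ≤
      √(k * (∫ x, (∑ j ∈ J, l j x ^ 2) ^ 2 ∂ν) + 2 * (k : ℝ) ^ 2 * J.card * v ^ 2) := by
    rw [ustatCF, ← integral_mul_const, ← integral_sub (integrable_exp_mul hU hS)
      (integrable_exp_mul hU (HasAllMoments.const _))]
    have hD := hS.sub (HasAllMoments.const (μ := Measure.pi fun _ : Fin k => ν) (k * J.card * v))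
    refine (norm_integral_le_of_norm_le (hD.integrable.abs) (.of_forall fun Y => ?_)).trans
      ((sq_integral_le hD).trans (Real.sqrt_le_sqrt (hI.integral_colSumSq_sub_sq_le k)))
    rw [← mul_sub, norm_mul, hexn, one_mul, ← Complex.ofReal_sub, Complex.norm_real,
      Real.norm_eq_abs]
  -- The first-order term vanishes, and the mean part of the second-order term produces the factor
  -- `1 - s² v² |J| k / 2`.
  have main : ustatCF ν J l s (k + 1) -
      ustatCF ν J l s k * (1 - s ^ 2 * v ^ 2 * J.card * k / 2 : ℝ) =
      (∫ z, ex z.2 * R z ∂P) - (s ^ 2 * v / 2 : ℝ) *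
        ((∫ Y : Fin k → E, ex Y * ((∑ j ∈ J, colSum l j Y ^ 2 : ℝ) : ℂ)
          ∂(Measure.pi fun _ => ν)) - ustatCF ν J l s k * (k * J.card * v : ℝ)) := by
    have h0 : ∫ z, ex z.2 ∂P = ustatCF ν J l s k := by
      rw [hP, integral_fun_snd]
      simp [ustatCF, hex]
    have h1 : ∫ z, ex z.2 * (X z : ℂ) ∂P = 0 := hI.integral_exp_mul_bilin s k
    have h2 : ∫ z, ex z.2 * ((X z ^ 2 : ℝ) : ℂ) ∂P = v * ∫ Y : Fin k → E,
        ex Y * ((∑ j ∈ J, colSum l j Y ^ 2 : ℝ) : ℂ) ∂(Measure.pi fun _ => ν) :=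
      hI.integral_exp_mul_bilin_sq s k
    have h3 : ustatCF ν J l s (k + 1) =
        ∫ z, Complex.exp ((s * (ustat J l z.2 + X z) : ℝ) * Complex.I) ∂P := by
      rw [ustatCF, integral_pi_succ]
      simp_rw [ustat_cons]
      rfl
    have i1' : Integrable (fun z : E × (Fin k → E) =>
      (s * Complex.I) * (ex z.2 * (X z : ℂ))) P := i1.const_mul _
    have i2' : Integrable (fun z : E × (Fin k → E) =>
      (s ^ 2 / 2 : ℂ) * (ex z.2 * ((X z ^ 2 : ℝ) : ℂ))) P := i2.const_mul _
    have i01 : Integrable (fun z : E × (Fin k → E) =>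
      ex z.2 + (s * Complex.I) * (ex z.2 * (X z : ℂ))) P := i0.add i1'
    have i012 : Integrable (fun z : E × (Fin k → E) =>
      ex z.2 + (s * Complex.I) * (ex z.2 * (X z : ℂ)) -
        (s ^ 2 / 2 : ℂ) * (ex z.2 * ((X z ^ 2 : ℝ) : ℂ))) P := i01.sub i2'
    simp_rw [← dec]
    rw [integral_sub i3 i012, integral_sub i01 i2', integral_add i0 i1', integral_const_mul, integral_const_mul, h0, h1, ← h3, h2]
    generalize ∫ Y : Fin k → E, ex Y * ((∑ j ∈ J, colSum l j Y ^ 2 : ℝ) : ℂ)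
      ∂(Measure.pi fun _ => ν) = Z
    push_cast
    ring
  rw [main]
  refine (norm_sub_le _ _).trans (add_le_add hrem ?_)
  rw [norm_mul, Complex.norm_real, Real.norm_of_nonneg (by positivity)]
  gcongr

/-- Distance of the characteristic function of the U-statistic to a Gaussian one. -/
lemma norm_ustatCF_sub_exp_le (hI : IsIsotropic J l v ν) (hv : 0 ≤ v) (s : ℝ) {η : ℝ}
    (hη : 0 < η) (n : ℕ) :
    ‖ustatCF ν J l s n -
        (Real.exp (-(s ^ 2 * v ^ 2 * J.card * (n * (n - 1)) / 4)) : ℝ)‖ ≤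
      n * (2 * η * (s ^ 2 * (n * J.card * v ^ 2)) +
      2 / η * (s ^ 4 * (n * (∫ z : E × E, (∑ j ∈ J, l j z.1 * l j z.2) ^ 4 ∂(ν.prod ν)) +
        3 * (n : ℝ) ^ 2 * v ^ 2 * ∫ x, (∑ j ∈ J, l j x ^ 2) ^ 2 ∂ν)) +
      s ^ 2 * v / 2 * √(n * (∫ x, (∑ j ∈ J, l j x ^ 2) ^ 2 ∂ν) +
        2 * (n : ℝ) ^ 2 * J.card * v ^ 2) + (s ^ 2 * v ^ 2 * J.card * n / 2) ^ 2) := by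
  set K4 := ∫ z : E × E, (∑ j ∈ J, l j z.1 * l j z.2) ^ 4 ∂(ν.prod ν)
  set K2 := ∫ x, (∑ j ∈ J, l j x ^ 2) ^ 2 ∂ν
  have hK4 : 0 ≤ K4 := integral_nonneg fun z => by positivity
  have hK2 : 0 ≤ K2 := integral_nonneg fun z => by positivity
  set B : ℝ → ℝ := fun x => 2 * η * (s ^ 2 * (x * J.card * v ^ 2)) +
      2 / η * (s ^ 4 * (x * K4 + 3 * x ^ 2 * v ^ 2 * K2)) +
      s ^ 2 * v / 2 * √(x * K2 + 2 * x ^ 2 * J.card * v ^ 2) +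
      (s ^ 2 * v ^ 2 * J.card * x / 2) ^ 2 with hB
  have hBmono : ∀ k : ℕ, k ≤ n → B k ≤ B n := by
    intro k hk
    have : (k : ℝ) ≤ n := by exact_mod_cast hk
    simp only [hB]
    gcongr
  -- The errors of the single steps do not amplify, since `|φ_k| ≤ 1` and `e^{-x} ≤ 1`. Each is
  -- bounded by the last one, `B n`, by monotonicity.
  suffices H : ∀ k : ℕ, k ≤ n → ‖ustatCF ν J l s k -
      (Real.exp (-(s ^ 2 * v ^ 2 * J.card * (k * (k - 1)) / 4)) : ℝ)‖ ≤ k * B n from H n le_rfl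
  intro k
  induction k with
  | zero =>
    intro _
    simp [ustatCF, ustat_zero]
  | succ k ih =>
    intro hk
    have ih' := ih (by omega)
    set x := s ^ 2 * v ^ 2 * J.card * k / 2 with hx
    have hx0 : 0 ≤ x := by positivity
    set G := Real.exp (-(s ^ 2 * v ^ 2 * J.card * (k * (k - 1)) / 4)) with hG
    -- The exponents `s² v² |J| k / 2` add up to `s² v² |J| k (k - 1) / 4`.
    have hG' : Real.exp (-(s ^ 2 * v ^ 2 * J.card * (((k + 1 : ℕ) : ℝ) *
        (((k + 1 : ℕ) : ℝ) - 1)) / 4)) = G * Real.exp (-x) := by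
      rw [hG, ← Real.exp_add]
      congr 1
      push_cast
      rw [hx]
      ring
    rw [hG']
    have d : ustatCF ν J l s (k + 1) - ((G * Real.exp (-x) : ℝ) : ℂ) =
        (ustatCF ν J l s (k + 1) - ustatCF ν J l s k * (1 - x : ℝ)) +
        ustatCF ν J l s k * ((1 - x - Real.exp (-x) : ℝ) : ℂ) +
        (ustatCF ν J l s k - (G : ℝ)) * (Real.exp (-x) : ℝ) := by
      push_cast
      ring
    have h1 := hI.norm_ustatCF_succ_sub_le hv s hη k
    have h2 : ‖ustatCF ν J l s k * ((1 - x - Real.exp (-x) : ℝ) : ℂ)‖ ≤ x ^ 2 := by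
      rw [norm_mul, Complex.norm_real, Real.norm_eq_abs]
      exact (mul_le_of_le_one_left (abs_nonneg _) (norm_ustatCF_le s k)).trans
        (abs_one_sub_sub_exp_neg_le hx0)
    have h3 : ‖(ustatCF ν J l s k - (G : ℝ)) * (Real.exp (-x) : ℝ)‖ ≤ k * B n := by
      rw [norm_mul, Complex.norm_real, Real.norm_of_nonneg (Real.exp_pos _).le]
      exact (mul_le_of_le_one_right (norm_nonneg _)
        (Real.exp_le_one_iff.2 (by linarith))).trans ih'
    rw [d]
    refine (norm_add_le _ _).trans ((add_le_add ((norm_add_le _ _).trans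
      (add_le_add h1 h2)) h3).trans ?_)
    have h4 := hBmono k (by omega)
    have h5 : ((k + 1 : ℕ) : ℝ) * B n = k * B n + B n := by push_cast; ring
    rw [h5, add_comm]
    exact add_le_add le_rfl h4

end IsIsotropic

end cf

/-! ### Gaussian moments and Wick's formula -/

section gaussian

open scoped NNReal

/-- Differentiation sends `P(t) e^{vt²/2}` to `(P' + v t P) e^{vt²/2}`. The value at `t = 0` of the
derivatives of the moment generating function gives the moments. -/
lemma iteratedDeriv_exp_mul_sq (v : ℝ) :
    iteratedDeriv 3 (fun t : ℝ => Real.exp (v * t ^ 2 / 2)) =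
      (fun t => (3 * v ^ 2 * t + v ^ 3 * t ^ 3) * Real.exp (v * t ^ 2 / 2)) ∧
    iteratedDeriv 4 (fun t : ℝ => Real.exp (v * t ^ 2 / 2)) =
      (fun t => (3 * v ^ 2 + 6 * v ^ 3 * t ^ 2 + v ^ 4 * t ^ 4) * Real.exp (v * t ^ 2 / 2)) := by
  have he : ∀ t : ℝ, HasDerivAt (fun t : ℝ => Real.exp (v * t ^ 2 / 2))
      (Real.exp (v * t ^ 2 / 2) * (v * t)) t := by
    intro t
    convert (((hasDerivAt_pow 2 t).const_mul v).div_const 2).exp using 2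
    simp
    ring
  have step : ∀ (P P' : ℝ → ℝ), (∀ t, HasDerivAt P (P' t) t) →
      deriv (fun t => P t * Real.exp (v * t ^ 2 / 2)) =
        fun t => (P' t + P t * (v * t)) * Real.exp (v * t ^ 2 / 2) := by
    intro P P' hP
    ext t
    rw [((hP t).fun_mul (he t)).deriv]
    ring
  have mono : ∀ (c : ℝ) (n : ℕ) (t : ℝ), HasDerivAt (fun t : ℝ => c * t ^ n)
      (c * (n * t ^ (n - 1))) t := fun c n t => (hasDerivAt_pow n t).const_mul c
  have h1 : iteratedDeriv 1 (fun t : ℝ => Real.exp (v * t ^ 2 / 2)) =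
      fun t => (v * t ^ 1) * Real.exp (v * t ^ 2 / 2) := by
    rw [iteratedDeriv_one]
    ext t
    rw [(he t).deriv]
    ring
  have h2 : iteratedDeriv 2 (fun t : ℝ => Real.exp (v * t ^ 2 / 2)) =
      fun t => (v * t ^ 0 + v ^ 2 * t ^ 2) * Real.exp (v * t ^ 2 / 2) := by
    rw [iteratedDeriv_succ, h1, step _ _ (mono v 1)]
    ext t
    simp
    ring
  have h3 : iteratedDeriv 3 (fun t : ℝ => Real.exp (v * t ^ 2 / 2)) =
      fun t => (3 * v ^ 2 * t ^ 1 + v ^ 3 * t ^ 3) * Real.exp (v * t ^ 2 / 2) := by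
    rw [iteratedDeriv_succ, h2, step _ _ fun t => (mono v 0 t).fun_add (mono (v ^ 2) 2 t)]
    ext t
    simp
    ring
  refine ⟨by simpa using h3, ?_⟩
  rw [iteratedDeriv_succ, h3, step _ _ fun t => (mono (3 * v ^ 2) 1 t).fun_add (mono (v ^ 3) 3 t)]
  ext t
  simp
  ring

lemma integral_pow_three_four_gaussianReal (v : ℝ≥0) :
    ∫ x, x ^ 3 ∂(gaussianReal 0 v) = 0 ∧ ∫ x, x ^ 4 ∂(gaussianReal 0 v) = 3 * (v : ℝ) ^ 2 := by
  have h0 : (0 : ℝ) ∈ interior (integrableExpSet id (gaussianReal 0 v)) := by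
    simp [integrableExpSet_id_gaussianReal]
  have h := iteratedDeriv_mgf_zero h0
  have e : mgf id (gaussianReal 0 v) = fun t : ℝ => Real.exp (v * t ^ 2 / 2) := by
    rw [mgf_id_gaussianReal]
    simp
  rw [e] at h
  have h3 := h 3
  have h4 := h 4
  rw [(iteratedDeriv_exp_mul_sq v).1] at h3
  rw [(iteratedDeriv_exp_mul_sq v).2] at h4
  simp only [Pi.pow_apply, id_eq] at h3 h4
  rw [← h3, ← h4]
  simp

lemma integral_sq_gaussianReal (v : ℝ≥0) : ∫ x, x ^ 2 ∂(gaussianReal 0 v) = v := by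
  have h := variance_fun_id_gaussianReal (μ := 0) (v := v)
  rw [variance_eq_integral (by fun_prop), integral_id_gaussianReal] at h
  simpa using h

lemma hasAllMoments_id_gaussianReal (v : ℝ≥0) :
    HasAllMoments (fun x : ℝ => x) (gaussianReal 0 v) :=
  fun q => memLp_id_gaussianReal' q (by simp)

/-- The polarization identity behind Wick's formula for fourth moments. -/
lemma integral_mul_four_of_pow_four {Ω : Type*} [MeasurableSpace Ω] {μ : Measure Ω}
    {w x y z : Ω → ℝ} (hw : HasAllMoments w μ) (hx : HasAllMoments x μ)
    (hy : HasAllMoments y μ) (hz : HasAllMoments z μ)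
    (h : ∀ r s t : ℝ, ∫ ω, (w ω + r * x ω + s * y ω + t * z ω) ^ 4 ∂μ =
      3 * (∫ ω, (w ω + r * x ω + s * y ω + t * z ω) ^ 2 ∂μ) ^ 2) :
    ∫ ω, w ω * x ω * y ω * z ω ∂μ =
      (∫ ω, w ω * x ω ∂μ) * (∫ ω, y ω * z ω ∂μ) + (∫ ω, w ω * y ω ∂μ) * (∫ ω, x ω * z ω ∂μ) +
        (∫ ω, w ω * z ω ∂μ) * (∫ ω, x ω * y ω ∂μ) := by
  have hL : ∀ r s t : ℝ, HasAllMoments (fun ω => w ω + r * x ω + s * y ω + t * z ω) μ :=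
    fun r s t => ((hw.add (hx.const_mul r)).add (hy.const_mul s)).add (hz.const_mul t)
  have hL2 : ∀ r s t : ℝ, ∫ ω, (w ω + r * x ω + s * y ω + t * z ω) ^ 2 ∂μ =
      ∫ ω, w ω * w ω ∂μ + r ^ 2 * ∫ ω, x ω * x ω ∂μ + s ^ 2 * ∫ ω, y ω * y ω ∂μ +
      t ^ 2 * ∫ ω, z ω * z ω ∂μ + 2 * r * ∫ ω, w ω * x ω ∂μ + 2 * s * ∫ ω, w ω * y ω ∂μ +
      2 * t * ∫ ω, w ω * z ω ∂μ + 2 * r * s * ∫ ω, x ω * y ω ∂μ +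
      2 * r * t * ∫ ω, x ω * z ω ∂μ + 2 * s * t * ∫ ω, y ω * z ω ∂μ := by
    intro r s t
    have e : ∀ ω, (w ω + r * x ω + s * y ω + t * z ω) ^ 2 =
        w ω * w ω + r ^ 2 * (x ω * x ω) + s ^ 2 * (y ω * y ω) + t ^ 2 * (z ω * z ω) +
        2 * r * (w ω * x ω) + 2 * s * (w ω * y ω) + 2 * t * (w ω * z ω) +
        2 * r * s * (x ω * y ω) + 2 * r * t * (x ω * z ω) + 2 * s * t * (y ω * z ω) :=
      fun ω => by ring
    simp_rw [e]
    have m1 := (hw.mul hw).add ((hx.mul hx).const_mul (r ^ 2))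
    have m2 := m1.add ((hy.mul hy).const_mul (s ^ 2))
    have m3 := m2.add ((hz.mul hz).const_mul (t ^ 2))
    have m4 := m3.add ((hw.mul hx).const_mul (2 * r))
    have m5 := m4.add ((hw.mul hy).const_mul (2 * s))
    have m6 := m5.add ((hw.mul hz).const_mul (2 * t))
    have m7 := m6.add ((hx.mul hy).const_mul (2 * r * s))
    have m8 := m7.add ((hx.mul hz).const_mul (2 * r * t))
    rw [integral_add m8.integrable ((hy.mul hz).const_mul _).integrable,
      integral_add m7.integrable ((hx.mul hz).const_mul _).integrable,
      integral_add m6.integrable ((hx.mul hy).const_mul _).integrable,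
      integral_add m5.integrable ((hw.mul hz).const_mul _).integrable,
      integral_add m4.integrable ((hw.mul hy).const_mul _).integrable,
      integral_add m3.integrable ((hw.mul hx).const_mul _).integrable,
      integral_add m2.integrable ((hz.mul hz).const_mul _).integrable,
      integral_add m1.integrable ((hy.mul hy).const_mul _).integrable,
      integral_add (hw.mul hw).integrable ((hx.mul hx).const_mul _).integrable]
    simp only [integral_const_mul]
  -- Averaging over the three signs against their product keeps only monomials odd in each of `x, y,
  -- z`, that is, only `w x y z`. Its coefficient is `24` in each of `8` fourth powers, whence
  -- `192`.
  have e : ∀ ω, w ω * x ω * y ω * z ω = ∑ q : Fin 2 × Fin 2 × Fin 2,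
      ((1 / 192 : ℝ) * ((-1) ^ (q.1 : ℕ) * (-1) ^ (q.2.1 : ℕ) * (-1) ^ (q.2.2 : ℕ))) *
        (w ω + (-1) ^ (q.1 : ℕ) * x ω + (-1) ^ (q.2.1 : ℕ) * y ω +
          (-1) ^ (q.2.2 : ℕ) * z ω) ^ 4 := by
    intro ω
    simp only [Fintype.sum_prod_type, Fin.sum_univ_two, Fin.val_zero, Fin.val_one, pow_zero,
      pow_one]
    ring
  have : ∀ q : Fin 2 × Fin 2 × Fin 2, Integrable (fun ω =>
      ((1 / 192 : ℝ) * ((-1) ^ (q.1 : ℕ) * (-1) ^ (q.2.1 : ℕ) * (-1) ^ (q.2.2 : ℕ))) *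
        (w ω + (-1) ^ (q.1 : ℕ) * x ω + (-1) ^ (q.2.1 : ℕ) * y ω +
          (-1) ^ (q.2.2 : ℕ) * z ω) ^ 4) μ := by
    intro q
    have h4 := ((hL ((-1) ^ (q.1 : ℕ)) ((-1) ^ (q.2.1 : ℕ)) ((-1) ^ (q.2.2 : ℕ))).mul
      (hL ((-1) ^ (q.1 : ℕ)) ((-1) ^ (q.2.1 : ℕ)) ((-1) ^ (q.2.2 : ℕ))))
    refine ((h4.mul h4).integrable.congr (.of_forall fun ω => ?_)).const_mul _
    ring
  simp_rw [e]
  rw [integral_finsetSum _ fun q _ => this q]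
  simp only [integral_const_mul, h, hL2, Fintype.sum_prod_type, Fin.sum_univ_two, Fin.val_zero,
    Fin.val_one, pow_zero, pow_one]
  ring

variable {p : ℕ} {S : Matrix (Fin p) (Fin p) ℝ}

lemma hasAllMoments_eval_multivariateGaussian (i : Fin p) :
    HasAllMoments (fun x : EuclideanSpace ℝ (Fin p) => x i) (multivariateGaussian 0 S) := by
  intro q
  have h := IsGaussian.memLp_id (multivariateGaussian (0 : EuclideanSpace ℝ (Fin p)) S) q (by simp)
  exact (EuclideanSpace.proj (𝕜 := ℝ) i).comp_memLp' h

lemma integral_eval_mul_eval_multivariateGaussian (hS : S.PosSemidef) (i k : Fin p) :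
    ∫ x, x i * x k ∂(multivariateGaussian (0 : EuclideanSpace ℝ (Fin p)) S) = S i k := by
  have h0 : ∀ i : Fin p, ∫ x, x i ∂(multivariateGaussian (0 : EuclideanSpace ℝ (Fin p)) S) = 0 := by
    intro i
    have := (measurePreserving_eval_multivariateGaussian
      (μ := (0 : EuclideanSpace ℝ (Fin p))) hS (i := i))
    have h1 := integral_map (μ := multivariateGaussian (0 : EuclideanSpace ℝ (Fin p)) S)
      this.measurable.aemeasurable (f := fun x : ℝ => x) (by fun_prop)
    rw [this.map_eq, integral_id_gaussianReal] at h1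
    simpa using h1.symm
  rw [← covariance_eval_multivariateGaussian (μ := 0) hS i k, covariance, h0, h0]
  simp

lemma integral_dual_pow_four_multivariateGaussian
    (L : EuclideanSpace ℝ (Fin p) →L[ℝ] ℝ) :
    ∫ x, L x ^ 4 ∂(multivariateGaussian 0 S) = 3 * (∫ x, L x ^ 2 ∂(multivariateGaussian 0 S)) ^ 2 := by
  have h := IsGaussian.map_eq_gaussianReal (μ := multivariateGaussian 0 S) L
  have h0 : ∫ x, L x ∂(multivariateGaussian 0 S) = 0 := by
    rw [IsGaussian.integral_dual]
    simp
  rw [h0] at h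
  have h4 := integral_map (μ := multivariateGaussian 0 S)
      L.continuous.measurable.aemeasurable (f := fun x : ℝ => x ^ 4) (by fun_prop)
  have h2 := integral_map (μ := multivariateGaussian 0 S)
      L.continuous.measurable.aemeasurable (f := fun x : ℝ => x ^ 2) (by fun_prop)
  rw [← h4, ← h2, h, (integral_pow_three_four_gaussianReal _).2, integral_sq_gaussianReal]

/-- Wick's formula for fourth moments. -/
lemma integral_mul_four_multivariateGaussian (hS : S.PosSemidef) (i j k l : Fin p) :
    ∫ x, x i * x j * x k * x l ∂(multivariateGaussian (0 : EuclideanSpace ℝ (Fin p)) S) =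
      S i j * S k l + S i k * S j l + S i l * S j k := by
  have hm := fun i => hasAllMoments_eval_multivariateGaussian (S := S) i
  rw [integral_mul_four_of_pow_four (hm i) (hm j) (hm k) (hm l)]
  · simp only [integral_eval_mul_eval_multivariateGaussian hS]
  · intro r s t
    have := integral_dual_pow_four_multivariateGaussian (S := S)
      (EuclideanSpace.proj (𝕜 := ℝ) i + r • EuclideanSpace.proj (𝕜 := ℝ) j +
        s • EuclideanSpace.proj (𝕜 := ℝ) k + t • EuclideanSpace.proj (𝕜 := ℝ) l)
    simpa using this

end gaussian

/-! ### Moments of the mask -/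

section bernoulli

variable {p : ℕ}

/-- The law of the indicators of observation. -/
noncomputable def maskLaw (p : ℕ) (a : unitInterval) : Measure (Fin p → ℝ) :=
  Measure.pi fun _ : Fin p => bernoulliMeasure (1 : ℝ) 0 a

instance (a : unitInterval) : IsProbabilityMeasure (maskLaw p a) := by
  unfold maskLaw; infer_instance

lemma hasAllMoments_eval_maskLaw (a : unitInterval) (i : Fin p) :
    HasAllMoments (fun e : Fin p → ℝ => e i) (maskLaw p a) := by
  refine HasAllMoments.eval (ρ := fun _ : Fin p => bernoulliMeasure (1 : ℝ) 0 a)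
    (h := fun x : ℝ => x) i fun q => ?_
  refine MemLp.of_bound (by fun_prop) 1 ?_
  rw [bernoulliMeasure_def]
  refine ae_add_measure_iff.2 ⟨?_, ?_⟩ <;>
  · refine Measure.ae_smul_measure ?_ _
    simp [ae_dirac_eq]

/-- The coordinates take values in `{0, 1}`, so positive exponents are immaterial and only the set
of indices that occur counts. -/
lemma integral_prod_pow_maskLaw (a : unitInterval) (r : Fin p → ℕ) :
    ∫ e, ∏ i, e i ^ r i ∂(maskLaw p a) =
      (a : ℝ) ^ (Finset.univ.filter fun i => r i ≠ 0).card := by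
  rw [maskLaw, integral_fintype_prod_eq_prod (fun i (x : ℝ) => x ^ r i)]
  rw [← Finset.prod_const, Finset.prod_filter]
  refine Finset.prod_congr rfl fun i _ => ?_
  rw [integral_bernoulliMeasure]
  by_cases h : r i = 0
  · simp [h]
  · simp [h]

lemma prod_pow_single (e : Fin p → ℝ) (i : Fin p) (c : ℕ) :
    ∏ t, e t ^ (if t = i then c else 0) = e i ^ c := by
  simp [Finset.prod_ite_eq', pow_ite]

/-- The case `c = 1` serves the moments of observations, `c = 2` those of the conditional variances
of the lag sums. -/
lemma integral_mul_four_maskLaw (a : unitInterval) (i j k l : Fin p) {c : ℕ} (hc : c ≠ 0) :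
    ∫ e, e i ^ c * e j ^ c * e k ^ c * e l ^ c ∂(maskLaw p a) =
      (a : ℝ) ^ ({i, j, k, l} : Finset (Fin p)).card := by
  have h : ∀ e : Fin p → ℝ, e i ^ c * e j ^ c * e k ^ c * e l ^ c =
      ∏ t, e t ^ ((if t = i then c else 0) + (if t = j then c else 0) +
        (if t = k then c else 0) + (if t = l then c else 0)) := by
    intro e
    simp only [pow_add, Finset.prod_mul_distrib, prod_pow_single]
  simp_rw [h]
  rw [integral_prod_pow_maskLaw]
  congr 2
  ext t
  simp only [Finset.mem_filter, Finset.mem_univ, true_and, Finset.mem_insert,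
    Finset.mem_singleton]
  split_ifs <;> simp_all

lemma integral_mul_two_maskLaw (a : unitInterval) {i j : Fin p} (hij : i ≠ j) :
    ∫ e, e i * e j ∂(maskLaw p a) = (a : ℝ) ^ 2 := by
  have h : ∀ e : Fin p → ℝ, e i * e j =
      ∏ t, e t ^ ((if t = i then 1 else 0) + (if t = j then 1 else 0)) := by
    intro e
    simp only [pow_add, Finset.prod_mul_distrib, prod_pow_single, pow_one]
  simp_rw [h]
  rw [integral_prod_pow_maskLaw, ← Finset.card_pair hij]
  congr 2
  ext t
  simp only [Finset.mem_filter, Finset.mem_univ, true_and, Finset.mem_insert,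
    Finset.mem_singleton]
  split_ifs <;> simp_all

end bernoulli

/-! ### Moments of one observation -/

section obs

variable {p : ℕ} {S : Matrix (Fin p) (Fin p) ℝ} {a : unitInterval}

lemma integral_obsLaw {f : (Fin p → ℝ) → ℝ} (hf : Measurable f) :
    ∫ y, f y ∂(obsLaw a S) = ∫ z, f (fun i => z.1 i * z.2 i)
      ∂((maskLaw p a).prod (multivariateGaussian (0 : EuclideanSpace ℝ (Fin p)) S)) := by
  rw [obsLaw, integral_map (by fun_prop) hf.aestronglyMeasurable]
  rfl

lemma hasAllMoments_eval_obsLaw (i : Fin p) :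
    HasAllMoments (fun y : Fin p → ℝ => y i) (obsLaw a S) := by
  intro q
  have hm : Measurable fun y : Fin p → ℝ => y i := measurable_pi_apply i
  rw [obsLaw, memLp_map_measure_iff hm.aestronglyMeasurable (by fun_prop)]
  exact ((hasAllMoments_eval_maskLaw a i).fst.mul
    (hasAllMoments_eval_multivariateGaussian (S := S) i).snd) q

/-- Mask and Gaussian vector are independent, so the moment splits into a count of distinct indices
and Wick's formula. -/
lemma integral_mul_four_obsLaw (hS : S.PosSemidef) (i j k l : Fin p) :
    ∫ y, y i * y j * y k * y l ∂(obsLaw a S) =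
      (a : ℝ) ^ ({i, j, k, l} : Finset (Fin p)).card *
        (S i j * S k l + S i k * S j l + S i l * S j k) := by
  rw [integral_obsLaw (by fun_prop), ← integral_mul_four_multivariateGaussian hS,
    ← integral_mul_four_maskLaw a i j k l one_ne_zero,
    ← integral_prod_mul (fun e : Fin p → ℝ => e i ^ 1 * e j ^ 1 * e k ^ 1 * e l ^ 1)
      (fun x : EuclideanSpace ℝ (Fin p) => x i * x j * x k * x l)]
  congr 1 with z
  ring

lemma integral_mul_two_obsLaw (hS : S.PosSemidef) {i j : Fin p} (hij : i ≠ j) :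
    ∫ y, y i * y j ∂(obsLaw a S) = (a : ℝ) ^ 2 * S i j := by
  rw [integral_obsLaw (by fun_prop), ← integral_eval_mul_eval_multivariateGaussian hS,
    ← integral_mul_two_maskLaw a hij,
    ← integral_prod_mul (fun e : Fin p → ℝ => e i * e j)
      (fun x : EuclideanSpace ℝ (Fin p) => x i * x j)]
  congr 1 with z
  ring

end obs

/-! ### Covariances of lag sums, term by term -/

section lag

variable {p : ℕ} {S : Matrix (Fin p) (Fin p) ℝ} {a : unitInterval}

/-- The index `i - j`, truncated at `0`. -/
def lagIndex (i : Fin p) (j : ℕ) : Fin p := ⟨(i : ℕ) - j, by omega⟩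

/-- The indices `m, …, p - 1` over which lag sums extend. -/
def window (m p : ℕ) : Finset (Fin p) := Finset.univ.filter fun i => m ≤ (i : ℕ)

lemma mem_window {m : ℕ} {i : Fin p} : i ∈ window m p ↔ m ≤ (i : ℕ) := by
  simp [window]

lemma card_window {m : ℕ} (hm : m < p) : ((window m p).card : ℝ) = (p : ℝ) - m := by
  have h : window m p = Finset.Ici (⟨m, hm⟩ : Fin p) := by
    ext i
    simp [mem_window, Fin.le_def]
  rw [h, Fin.card_Ici]
  push_cast [hm.le]
  rfl

lemma lagSum_eq (m j : ℕ) (y : Fin p → ℝ) :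
    lagSum m j y = ∑ i ∈ window m p, y i * y (lagIndex i j) := rfl

lemma hasAllMoments_lagSum (m j : ℕ) :
    HasAllMoments (fun y : Fin p → ℝ => lagSum m j y) (obsLaw a S) :=
  HasAllMoments.sum fun i _ => (hasAllMoments_eval_obsLaw i).mul (hasAllMoments_eval_obsLaw _)

lemma lagIndex_ne {m j : ℕ} (hj : j ∈ Finset.Icc 1 m) {i : Fin p} (hi : i ∈ window m p) :
    i ≠ lagIndex i j := by
  rw [Finset.mem_Icc] at hj
  rw [mem_window] at hi
  intro h
  have := congrArg Fin.val h
  simp only [lagIndex] at this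
  omega

/-- Entries of a symmetric Toeplitz matrix in terms of its diagonal coefficients. -/
lemma IsToeplitz.apply_eq (hT : IsToeplitz S) (hs : S.IsHermitian) (i k : Fin p) :
    S i k = diagCoeff S ((i : ℤ) - (k : ℤ)).natAbs := by
  have key : ∀ i k : Fin p, k ≤ i → S i k = diagCoeff S ((i : ℤ) - (k : ℤ)).natAbs := by
    intro i k hki
    have hki' : (k : ℕ) ≤ i := hki
    have hlt : ((i : ℤ) - (k : ℤ)).natAbs < p := by omega
    rw [diagCoeff, dif_pos hlt]
    apply hT
    simp only
    omega
  rcases le_total k i with h | h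
  · exact key i k h
  · have h1 := key k i h
    have h2 : S i k = S k i := by
      have := hs.apply i k
      simpa using this.symm
    rw [h2, h1]
    congr 1
    omega

/-- The coefficient `σ_{|u|}`, with the diagonal removed. -/
def offCoeff (S : Matrix (Fin p) (Fin p) ℝ) (u : ℤ) : ℝ :=
  if u = 0 then 0 else diagCoeff S u.natAbs

lemma integral_lagSum (hS : S.PosSemidef) (hT : IsToeplitz S) {m j : ℕ} (hm : m < p)
    (hj : j ∈ Finset.Icc 1 m) :
    ∫ y, lagSum m j y ∂(obsLaw a S) = ((p : ℝ) - m) * ((a : ℝ) ^ 2 * diagCoeff S j) := by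
  simp_rw [lagSum_eq]
  rw [integral_finsetSum _ fun i _ =>
    ((hasAllMoments_eval_obsLaw i).mul (hasAllMoments_eval_obsLaw _)).integrable]
  rw [Finset.sum_congr rfl fun i hi => integral_mul_two_obsLaw hS (lagIndex_ne hj hi),
    ← card_window hm, ← nsmul_eq_mul, ← Finset.sum_const]
  refine Finset.sum_congr rfl fun i hi => ?_
  rw [mem_window] at hi
  rw [Finset.mem_Icc] at hj
  rw [hT.apply_eq hS.isHermitian]
  congr 2
  simp only [lagIndex]
  omega

/-- The covariance of two products of observations entering the lag sums. -/
def lagTerm (a : ℝ) (S : Matrix (Fin p) (Fin p) ℝ) (j j' : ℕ) (i k : Fin p) : ℝ :=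
  a ^ ({i, lagIndex i j, k, lagIndex k j'} : Finset (Fin p)).card *
    (diagCoeff S j * diagCoeff S j' + S i k * S (lagIndex i j) (lagIndex k j') +
      S i (lagIndex k j') * S (lagIndex i j) k) - a ^ 4 * (diagCoeff S j * diagCoeff S j')

/-- The product of the two means is spread evenly over the `(p - m)²` pairs of indices, so that each
pair carries its own covariance. -/
lemma lagCov_eq_sum (hS : S.PosSemidef) (hT : IsToeplitz S) {m j j' : ℕ} (hm : m < p)
    (hj : j ∈ Finset.Icc 1 m) (hj' : j' ∈ Finset.Icc 1 m) :
    lagCov m a S j j' = ∑ i ∈ window m p, ∑ k ∈ window m p, lagTerm a S j j' i k := by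
  have hL := fun j => hasAllMoments_lagSum (a := a) (S := S) m j
  have he := fun i : Fin p => hasAllMoments_eval_obsLaw (a := a) (S := S) i
  have hd : ∀ j ∈ Finset.Icc 1 m, ∀ i ∈ window m p, S i (lagIndex i j) = diagCoeff S j := by
    intro j hj i hi
    rw [mem_window] at hi
    rw [Finset.mem_Icc] at hj
    rw [hT.apply_eq hS.isHermitian]
    congr 1
    simp only [lagIndex]
    omega
  rw [lagCov, covariance_eq_sub (hL j).memLp_two (hL j').memLp_two, integral_lagSum hS hT hm hj,
    integral_lagSum hS hT hm hj']
  have e : (lagSum m j * lagSum m j' : (Fin p → ℝ) → ℝ) = fun y =>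
      ∑ i ∈ window m p, ∑ k ∈ window m p, y i * y (lagIndex i j) * y k * y (lagIndex k j') := by
    funext y
    rw [Pi.mul_apply, lagSum_eq, lagSum_eq, Finset.sum_mul_sum]
    exact Finset.sum_congr rfl fun i _ => Finset.sum_congr rfl fun k _ => by ring
  rw [e]
  have hi4 : ∀ i k, HasAllMoments (fun y : Fin p → ℝ =>
      y i * y (lagIndex i j) * y k * y (lagIndex k j')) (obsLaw a S) := fun i k =>
    (((he i).mul (he _)).mul (he k)).mul (he _)
  rw [integral_finsetSum _ fun i _ => (HasAllMoments.sum fun k _ => hi4 i k).integrable]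
  have hsplit : ((p : ℝ) - m) * ((a : ℝ) ^ 2 * diagCoeff S j) *
      (((p : ℝ) - m) * ((a : ℝ) ^ 2 * diagCoeff S j')) =
      ∑ i ∈ window m p, ∑ k ∈ window m p, (a : ℝ) ^ 4 * (diagCoeff S j * diagCoeff S j') := by
    simp only [Finset.sum_const, nsmul_eq_mul, card_window hm]
    ring
  rw [hsplit, ← Finset.sum_sub_distrib]
  refine Finset.sum_congr rfl fun i hi => ?_
  rw [integral_finsetSum _ fun k _ => (hi4 i k).integrable, ← Finset.sum_sub_distrib]
  refine Finset.sum_congr rfl fun k hk => ?_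
  rw [integral_mul_four_obsLaw hS, lagTerm, hd j hj i hi, hd j' hj' k hk]

/-- Bound for the individual terms of the covariance of lag sums. -/
lemma abs_lagTerm_sub_le (hS : S.IsHermitian) (hT : IsToeplitz S) (h1 : ∀ i, S i i = 1) {b : ℝ}
    (hb0 : 0 ≤ b) (hb1 : b ≤ 1) {m j j' : ℕ} (hj : j ∈ Finset.Icc 1 m)
    (hj' : j' ∈ Finset.Icc 1 m) {i k : Fin p} (hi : i ∈ window m p) (hk : k ∈ window m p) :
    |lagTerm b S j j' i k - (if i = k then (if j = j' then b ^ 2 else 0) else 0)| ≤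
      (if i = k then (if j = j' then 2 * b ^ 2 * diagCoeff S j ^ 2 else 0) +
        b ^ 3 * (|offCoeff S ((j : ℤ) - j')| + 2 * |diagCoeff S j * diagCoeff S j'|) else 0) +
      (if (k : ℕ) + j = i + j' then
        b ^ 3 * (|offCoeff S ((j : ℤ) - j')| + 2 * |diagCoeff S j * diagCoeff S j'|) else 0) +
      (if (k : ℕ) = i + j' then
        b ^ 3 * (|diagCoeff S (j + j')| + 2 * |diagCoeff S j * diagCoeff S j'|) else 0) +
      (if (k : ℕ) + j = i then
        b ^ 3 * (|diagCoeff S (j + j')| + 2 * |diagCoeff S j * diagCoeff S j'|) else 0) +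
      b ^ 4 * (|offCoeff S ((i : ℤ) - k) * offCoeff S ((i - j : ℤ) + j' - k)| +
        |offCoeff S ((i : ℤ) + j' - k) * offCoeff S ((i : ℤ) - j - k)|) := by
  rw [Finset.mem_Icc] at hj hj'
  rw [mem_window] at hi hk
  have hs := hT.apply_eq hS
  set x := diagCoeff S j with hx
  set x' := diagCoeff S j' with hx'
  set g := b ^ 4 * (|offCoeff S ((i : ℤ) - k) * offCoeff S ((i - j : ℤ) + j' - k)| +
        |offCoeff S ((i : ℤ) + j' - k) * offCoeff S ((i : ℤ) - j - k)|) with hg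
  have hg0 : 0 ≤ g := by positivity
  have b2 : 0 ≤ b ^ 2 := by positivity
  have b3 : 0 ≤ b ^ 3 := by positivity
  have b43 : b ^ 4 ≤ b ^ 3 := pow_le_pow_of_le_one hb0 hb1 (by norm_num)
  have b4 : 0 ≤ b ^ 4 := by positivity
  have b42 : b ^ 4 ≤ b ^ 2 := pow_le_pow_of_le_one hb0 hb1 (by norm_num)
  -- the bound when exactly three indices are distinct
  have three : ∀ y : ℝ, |b ^ 3 * (x * x' + y + x * x') - b ^ 4 * (x * x')| ≤
      b ^ 3 * (|y| + 2 * |x * x'|) := by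
    intro y
    have e : b ^ 3 * (x * x' + y + x * x') - b ^ 4 * (x * x') =
        b ^ 3 * y + (2 * b ^ 3 - b ^ 4) * (x * x') := by ring
    rw [e]
    refine (abs_add_le _ _).trans ?_
    rw [abs_mul, abs_mul, abs_of_nonneg b3, abs_of_nonneg (by linarith : 0 ≤ 2 * b ^ 3 - b ^ 4)]
    nlinarith [abs_nonneg (x * x')]
  have n3 : ∀ y : ℝ, 0 ≤ b ^ 3 * (|y| + 2 * |x * x'|) := fun y => by positivity
  have vi : ((lagIndex i j : Fin p) : ℕ) = i - j := rfl
  have vk : ((lagIndex k j' : Fin p) : ℕ) = k - j' := rfl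
  -- Among `i, i - j, k, k - j'` only the coincidences `i = k`, `i - j = k - j'`, `i = k - j'` and
  -- `i - j = k` are possible. Two of them occur together only for `i = k`, `j = j'`, which leaves
  -- two distinct indices; a single one leaves three.
  by_cases c1 : i = k
  · subst c1
    have k2 : ¬ ((i : ℕ) = i + j') := by omega
    have k3 : ¬ ((i : ℕ) + j = i) := by omega
    by_cases c2 : j = j'
    · subst c2
      have hne : i ≠ lagIndex i j := by
        intro h
        have := congrArg Fin.val h
        omega
      have hcard : ({i, lagIndex i j, i, lagIndex i j} : Finset (Fin p)).card = 2 := by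
        rw [show ({i, lagIndex i j, i, lagIndex i j} : Finset (Fin p)) = {i, lagIndex i j} by
          ext t; simp, Finset.card_pair hne]
      have e1 : S i (lagIndex i j) = x := by
        rw [hs, hx]; congr 1; omega
      have e2 : S (lagIndex i j) i = x := by
        rw [hs, hx]; congr 1; omega
      rw [lagTerm, hcard, h1, h1, e1, e2]
      simp only [if_true, if_neg k2, if_neg k3]
      have e : b ^ 2 * (x * x + 1 * 1 + x * x) - b ^ 4 * (x * x) - b ^ 2 =
        (2 * b ^ 2 - b ^ 4) * x ^ 2 := by ring
      rw [e, abs_mul, abs_of_nonneg (by linarith : 0 ≤ 2 * b ^ 2 - b ^ 4), abs_of_nonneg (sq_nonneg x)]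
      have := n3 (offCoeff S ((j : ℤ) - j))
      nlinarith [sq_nonneg x]
    · have hcard : ({i, lagIndex i j, i, lagIndex i j'} : Finset (Fin p)).card = 3 := by
        rw [show ({i, lagIndex i j, i, lagIndex i j'} : Finset (Fin p)) =
          {i, lagIndex i j, lagIndex i j'} by ext t; simp; tauto]
        refine Finset.card_eq_three.2 ⟨_, _, _, ?_, ?_, ?_, rfl⟩ <;>
        · intro h
          have := congrArg Fin.val h
          omega
      have e1 : S i (lagIndex i j') = x' := by
        rw [hs, hx']; congr 1; omega
      have e2 : S (lagIndex i j) i = x := by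
        rw [hs, hx]; congr 1; omega
      have e3 : S (lagIndex i j) (lagIndex i j') = offCoeff S ((j : ℤ) - j') := by
        rw [hs, offCoeff, if_neg (by omega)]; congr 1; omega
      rw [lagTerm, hcard, h1, e1, e2, e3, one_mul]
      simp only [if_true, if_neg c2, if_neg k2, if_neg k3, sub_zero]
      have t := three (offCoeff S ((j : ℤ) - j'))
      rw [mul_comm x' x]
      have hif : ¬ ((i : ℕ) + j = i + j') := by omega
      rw [if_neg hif]
      linarith
  · have c1v : (i : ℕ) ≠ k := fun h => c1 (Fin.ext h)
    rw [if_neg c1, if_neg c1, sub_zero, zero_add]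
    by_cases c2 : (k : ℕ) + j = i + j'
    · have k2 : ¬ ((k : ℕ) = i + j') := by omega
      have k3 : ¬ ((k : ℕ) + j = i) := by omega
      have hE : lagIndex i j = lagIndex k j' := by
        apply Fin.ext
        omega
      have hcard : ({i, lagIndex i j, k, lagIndex k j'} : Finset (Fin p)).card = 3 := by
        rw [show ({i, lagIndex i j, k, lagIndex k j'} : Finset (Fin p)) =
          {i, lagIndex i j, k} by rw [hE]; ext t; simp; tauto]
        refine Finset.card_eq_three.2 ⟨_, _, _, ?_, ?_, ?_, rfl⟩ <;>
        · intro h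
          have := congrArg Fin.val h
          omega
      have e1 : S i (lagIndex k j') = x := by
        rw [hs, hx]; congr 1; omega
      have e2 : S (lagIndex i j) k = x' := by
        rw [hs, hx']; congr 1; omega
      have e3 : S i k = offCoeff S ((j : ℤ) - j') := by
        rw [hs, offCoeff, if_neg (by omega)]; congr 1; omega
      rw [lagTerm, hcard, e1, e2, e3, ← hE, h1, mul_one, if_pos c2, if_neg k2, if_neg k3]
      have t := three (offCoeff S ((j : ℤ) - j'))
      linarith
    · rw [if_neg c2]
      by_cases c3 : (k : ℕ) = i + j'
      · have k3 : ¬ ((k : ℕ) + j = i) := by omega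
        have hE : lagIndex k j' = i := by
          apply Fin.ext
          omega
        have hcard : ({i, lagIndex i j, k, lagIndex k j'} : Finset (Fin p)).card = 3 := by
          rw [show ({i, lagIndex i j, k, lagIndex k j'} : Finset (Fin p)) =
            {i, lagIndex i j, k} by rw [hE]; ext t; simp; tauto]
          refine Finset.card_eq_three.2 ⟨_, _, _, ?_, ?_, ?_, rfl⟩ <;>
          · intro h
            have := congrArg Fin.val h
            omega
        have e1 : S i k = x' := by
          rw [hs, hx']; congr 1; omega
        have e2 : S (lagIndex i j) i = x := by
          rw [hs, hx]; congr 1; omega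
        have e3 : S (lagIndex i j) k = diagCoeff S (j + j') := by
          rw [hs]; congr 1; omega
        rw [lagTerm, hcard, hE, e1, e2, e3, h1, one_mul, if_pos c3, if_neg k3, mul_comm x' x]
        have t := three (diagCoeff S (j + j'))
        rw [show x * x' + x * x' + diagCoeff S (j + j') =
          x * x' + diagCoeff S (j + j') + x * x' by ring]
        linarith
      · rw [if_neg c3]
        by_cases c4 : (k : ℕ) + j = i
        · have hE : lagIndex i j = k := by
            apply Fin.ext
            omega
          have hcard : ({i, lagIndex i j, k, lagIndex k j'} : Finset (Fin p)).card = 3 := by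
            rw [show ({i, lagIndex i j, k, lagIndex k j'} : Finset (Fin p)) =
              {i, k, lagIndex k j'} by rw [hE]; ext t; simp]
            refine Finset.card_eq_three.2 ⟨_, _, _, ?_, ?_, ?_, rfl⟩ <;>
            · intro h
              have := congrArg Fin.val h
              omega
          have e1 : S i k = x := by
            rw [hs, hx]; congr 1; omega
          have e2 : S k (lagIndex k j') = x' := by
            rw [hs, hx']; congr 1; omega
          have e3 : S i (lagIndex k j') = diagCoeff S (j + j') := by
            rw [hs]; congr 1; omega
          rw [lagTerm, hcard, hE, e1, e2, e3, h1, mul_one, if_pos c4]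
          have t := three (diagCoeff S (j + j'))
          rw [show x * x' + x * x' + diagCoeff S (j + j') =
            x * x' + diagCoeff S (j + j') + x * x' by ring]
          linarith
        · have hcard : ({i, lagIndex i j, k, lagIndex k j'} : Finset (Fin p)).card = 4 := by
            have hne : ∀ t u : Fin p, (t : ℕ) ≠ u → t ≠ u := fun t u h h' => h (congrArg _ h')
            rw [Finset.card_insert_of_notMem, Finset.card_eq_three.2 ⟨_, _, _, ?_, ?_, ?_, rfl⟩]
            · exact hne _ _ (by omega)
            · exact hne _ _ (by omega)
            · exact hne _ _ (by omega)
            · simp only [Finset.mem_insert, Finset.mem_singleton, not_or]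
              exact ⟨hne _ _ (by omega), hne _ _ (by omega), hne _ _ (by omega)⟩
          -- With four distinct indices the weight is that of the product of means, so `σ_j σ_{j'}`
          -- cancels and two products of off-diagonal coefficients remain.
          have e1 : S i k = offCoeff S ((i : ℤ) - k) := by
            rw [hs, offCoeff, if_neg (by omega)]
          have e2 : S (lagIndex i j) (lagIndex k j') = offCoeff S ((i - j : ℤ) + j' - k) := by
            rw [hs, offCoeff, if_neg (by omega)]; congr 1; omega
          have e3 : S i (lagIndex k j') = offCoeff S ((i : ℤ) + j' - k) := by
            rw [hs, offCoeff, if_neg (by omega)]; congr 1; omega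
          have e4 : S (lagIndex i j) k = offCoeff S ((i : ℤ) - j - k) := by
            rw [hs, offCoeff, if_neg (by omega)]; congr 1; omega
          rw [lagTerm, hcard, e1, e2, e3, e4, if_neg c4, hg]
          set y1 := offCoeff S ((i : ℤ) - k) * offCoeff S ((i - j : ℤ) + j' - k)
          set y2 := offCoeff S ((i : ℤ) + j' - k) * offCoeff S ((i : ℤ) - j - k)
          rw [show b ^ 4 * (x * x' + y1 + y2) - b ^ 4 * (x * x') = b ^ 4 * (y1 + y2) by ring,
            abs_mul, abs_of_nonneg b4]
          have := abs_add_le y1 y2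
          nlinarith

end lag

/-! ### Summed bounds for the covariances of lag sums -/

section lagBounds

variable {p : ℕ} {S : Matrix (Fin p) (Fin p) ℝ} {a : unitInterval}

/-- Once `i` is fixed, each coincidence of indices determines `k`, so it contributes at most one
term. -/
lemma sum_ite_le_of_subsingleton {ι : Type*} (s : Finset ι) (P : ι → Prop) [DecidablePred P]
    (hP : ∀ i ∈ s, ∀ k ∈ s, P i → P k → i = k) {c : ℝ} (hc : 0 ≤ c) :
    ∑ i ∈ s, (if P i then c else 0) ≤ c := by
  rw [← Finset.sum_filter, Finset.sum_const, nsmul_eq_mul]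
  have : (s.filter P).card ≤ 1 := Finset.card_le_one.2 fun i hi k hk => by
    rw [Finset.mem_filter] at hi hk
    exact hP i hi.1 k hk.1 hi.2 hk.2
  have h : ((s.filter P).card : ℝ) ≤ 1 := by exact_mod_cast this
  exact mul_le_of_le_one_left hc h

lemma diagCoeff_eq_zero {k : ℕ} (hk : p ≤ k) : diagCoeff S k = 0 := by
  rw [diagCoeff, dif_neg (by omega)]

lemma sum_sq_comp_le {ι : Type*} (σ : ℕ → ℝ) (s : Finset ι) (φ : ι → ℕ) (t : Finset ℕ)
    (hinj : Set.InjOn φ s) (ht : ∀ i ∈ s, σ (φ i) ≠ 0 → φ i ∈ t) :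
    ∑ i ∈ s, σ (φ i) ^ 2 ≤ ∑ k ∈ t, σ k ^ 2 := by
  classical
  rw [← Finset.sum_image (f := fun k => σ k ^ 2) hinj]
  rw [← Finset.sum_filter_ne_zero]
  refine Finset.sum_le_sum_of_subset_of_nonneg (fun k hk => ?_) fun k _ _ => sq_nonneg _
  obtain ⟨hk, hne⟩ := Finset.mem_filter.1 hk
  obtain ⟨i, hi, rfl⟩ := Finset.mem_image.1 hk
  exact ht i hi fun h => hne (by rw [h]; ring)

/-- The absolute value is injective on each of the positive and the negative half-lines, whence the
factor `2`. -/
lemma sum_offCoeff_sq_comp_le {ι : Type*} (s : Finset ι) (φ : ι → ℤ) (t : Finset ℕ)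
    (hinj : Set.InjOn φ s)
    (ht : ∀ i ∈ s, φ i ≠ 0 → diagCoeff S (φ i).natAbs ≠ 0 → (φ i).natAbs ∈ t) :
    ∑ i ∈ s, offCoeff S (φ i) ^ 2 ≤ 2 * ∑ k ∈ t, diagCoeff S k ^ 2 := by
  have h1 : ∀ i, offCoeff S (φ i) ^ 2 =
      (if 0 < φ i then diagCoeff S (φ i).natAbs ^ 2 else 0) +
      (if φ i < 0 then diagCoeff S (φ i).natAbs ^ 2 else 0) := by
    intro i
    rcases lt_trichotomy (φ i) 0 with h | h | h
    · simp [offCoeff, h.ne, h, h.le]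
    · simp [offCoeff, h]
    · simp [offCoeff, h.ne', h, h.le]
  simp_rw [h1]
  rw [Finset.sum_add_distrib, ← Finset.sum_filter, ← Finset.sum_filter, two_mul]
  refine add_le_add ?_ ?_ <;>
  · refine sum_sq_comp_le (diagCoeff S) _ (fun i => (φ i).natAbs) t ?_ ?_
    · intro i hi k hk hik
      simp only [Finset.coe_filter, Set.mem_ofPred_eq] at hi hk
      apply hinj hi.1 hk.1
      simp only at hik
      omega
    · intro i hi hne
      rw [Finset.mem_filter] at hi
      exact ht i hi.1 (by omega) hne

lemma sum_abs_mul_offCoeff_le (s : Finset (Fin p)) (c d : ℤ) :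
    ∑ k ∈ s, |offCoeff S (c - (k : ℕ)) * offCoeff S (d - (k : ℕ))| ≤
      2 * ∑ k ∈ Finset.Ico 1 p, diagCoeff S k ^ 2 := by
  have h : ∀ c : ℤ, ∑ k ∈ s, offCoeff S (c - (k : ℕ)) ^ 2 ≤
      2 * ∑ k ∈ Finset.Ico 1 p, diagCoeff S k ^ 2 := by
    intro c
    refine sum_offCoeff_sq_comp_le s (fun k => c - (k : ℕ)) _ ?_ ?_
    · intro i _ k _ hik
      apply Fin.ext
      simp only at hik
      omega
    · intro i _ h0 hne
      rw [Finset.mem_Ico]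
      refine ⟨by omega, ?_⟩
      by_contra hp
      exact hne (diagCoeff_eq_zero (by omega))
  have h2 : ∀ k ∈ s, |offCoeff S (c - (k : ℕ)) * offCoeff S (d - (k : ℕ))| ≤
      (offCoeff S (c - (k : ℕ)) ^ 2 + offCoeff S (d - (k : ℕ)) ^ 2) / 2 := by
    intro k _
    rw [abs_le]
    constructor <;> nlinarith [sq_nonneg (offCoeff S (c - (k : ℕ)) - offCoeff S (d - (k : ℕ))),
      sq_nonneg (offCoeff S (c - (k : ℕ)) + offCoeff S (d - (k : ℕ)))]
  refine (Finset.sum_le_sum h2).trans ?_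
  rw [← Finset.sum_div, Finset.sum_add_distrib]
  linarith [h c, h d]

/-- The bound for the normalized covariance of lag sums, off its leading term. -/
def lagBound (b : ℝ) (S : Matrix (Fin p) (Fin p) ℝ) (j j' : ℕ) : ℝ :=
  (if j = j' then 2 * b ^ 2 * diagCoeff S j ^ 2 else 0) +
    2 * b ^ 3 * |offCoeff S ((j : ℤ) - j')| + 2 * b ^ 3 * |diagCoeff S (j + j')| +
    8 * b ^ 3 * |diagCoeff S j * diagCoeff S j'| +
    4 * b ^ 4 * ∑ k ∈ Finset.Ico 1 p, diagCoeff S k ^ 2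

/-- Sum the bound for single terms over `k`, uniformly in `i`. Two coincidences carry `σ_{j-j'}` and
two carry `σ_{j+j'}`; all four carry `2 |σ_j σ_{j'}|`, which makes `8`. The generic pairs give two
shifted products, each of total at most twice the energy. Summing over `i` gives the factor `p - m`.
-/
lemma abs_lagCov_sub_le (hS : S.PosSemidef) (hT : IsToeplitz S) (h1 : ∀ i, S i i = 1)
    {m j j' : ℕ} (hm : m < p) (hj : j ∈ Finset.Icc 1 m) (hj' : j' ∈ Finset.Icc 1 m) :
    |lagCov m a S j j' - ((p : ℝ) - m) * (if j = j' then (a : ℝ) ^ 2 else 0)| ≤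
      ((p : ℝ) - m) * lagBound a S j j' := by
  have ha0 : (0 : ℝ) ≤ a := a.2.1
  have ha1 : (a : ℝ) ≤ 1 := a.2.2
  have hmain : ((p : ℝ) - m) * (if j = j' then (a : ℝ) ^ 2 else 0) = ∑ i ∈ window m p,
      ∑ k ∈ window m p, (if i = k then (if j = j' then (a : ℝ) ^ 2 else 0) else 0) := by
    rw [← card_window hm, ← nsmul_eq_mul, ← Finset.sum_const]
    refine Finset.sum_congr rfl fun i hi => ?_
    rw [Finset.sum_ite_eq, if_pos hi]
  rw [lagCov_eq_sum hS hT hm hj hj', hmain, ← Finset.sum_sub_distrib, ← card_window hm,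
    ← nsmul_eq_mul, ← Finset.sum_const]
  refine (Finset.abs_sum_le_sum_abs _ _).trans (Finset.sum_le_sum fun i hi => ?_)
  rw [← Finset.sum_sub_distrib]
  refine (Finset.abs_sum_le_sum_abs _ _).trans
    ((Finset.sum_le_sum fun k hk => abs_lagTerm_sub_le hS.isHermitian hT h1 ha0 ha1 hj hj' hi hk).trans ?_)
  simp only [Finset.sum_add_distrib]
  have s1 := sum_ite_le_of_subsingleton (window m p) (fun k => i = k)
    (fun k _ k' _ h h' => h.symm.trans h')
    (c := (if j = j' then 2 * (a : ℝ) ^ 2 * diagCoeff S j ^ 2 else 0) +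
        (a : ℝ) ^ 3 * (|offCoeff S ((j : ℤ) - j')| + 2 * |diagCoeff S j * diagCoeff S j'|))
    (by positivity)
  have s2 := sum_ite_le_of_subsingleton (window m p) (fun k => (k : ℕ) + j = i + j')
    (fun k _ k' _ h h' => Fin.ext (by omega))
    (c := (a : ℝ) ^ 3 * (|offCoeff S ((j : ℤ) - j')| + 2 * |diagCoeff S j * diagCoeff S j'|))
    (by positivity)
  have s3 := sum_ite_le_of_subsingleton (window m p) (fun k => (k : ℕ) = i + j')
    (fun k _ k' _ h h' => Fin.ext (by omega))
    (c := (a : ℝ) ^ 3 * (|diagCoeff S (j + j')| + 2 * |diagCoeff S j * diagCoeff S j'|))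
    (by positivity)
  have s4 := sum_ite_le_of_subsingleton (window m p) (fun k => (k : ℕ) + j = i)
    (fun k _ k' _ h h' => Fin.ext (by omega))
    (c := (a : ℝ) ^ 3 * (|diagCoeff S (j + j')| + 2 * |diagCoeff S j * diagCoeff S j'|))
    (by positivity)
  have s5 := sum_abs_mul_offCoeff_le (S := S) (window m p) (i : ℤ) ((i - j : ℤ) + j')
  have s6 := sum_abs_mul_offCoeff_le (S := S) (window m p) ((i : ℤ) + j') ((i : ℤ) - j)
  have s7 : ∑ k ∈ window m p, (a : ℝ) ^ 4 *
      (|offCoeff S ((i : ℤ) - k) * offCoeff S ((i - j : ℤ) + j' - k)| +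
        |offCoeff S ((i : ℤ) + j' - k) * offCoeff S ((i : ℤ) - j - k)|) ≤
      4 * (a : ℝ) ^ 4 * ∑ k ∈ Finset.Ico 1 p, diagCoeff S k ^ 2 := by
    rw [← Finset.mul_sum, Finset.sum_add_distrib, mul_comm (4 : ℝ), mul_assoc]
    gcongr
    linarith
  rw [lagBound]
  linarith

lemma diagCoeff_one {k : ℕ} (hk : k ≠ 0) : diagCoeff (1 : Matrix (Fin p) (Fin p) ℝ) k = 0 := by
  rw [diagCoeff]
  split_ifs with h
  · rw [Matrix.one_apply_ne]
    intro h'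
    exact hk (congrArg Fin.val h')
  · rfl

lemma isToeplitz_one : IsToeplitz (1 : Matrix (Fin p) (Fin p) ℝ) := by
  intro i j k l h
  rw [Matrix.one_apply, Matrix.one_apply]
  congr 1
  rw [Fin.ext_iff, Fin.ext_iff]
  apply propext
  omega

/-- Under the null hypothesis, the lag sums are uncorrelated. -/
lemma lagCov_one {m j j' : ℕ} (hm : m < p) (hj : j ∈ Finset.Icc 1 m) (hj' : j' ∈ Finset.Icc 1 m) :
    lagCov m a (1 : Matrix (Fin p) (Fin p) ℝ) j j' =
      if j = j' then ((p : ℝ) - m) * (a : ℝ) ^ 2 else 0 := by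
  have ho : ∀ u, offCoeff (1 : Matrix (Fin p) (Fin p) ℝ) u = 0 := by
    intro u
    rw [offCoeff]
    split_ifs with h
    · rfl
    · exact diagCoeff_one (by omega)
  have h := abs_lagCov_sub_le (a := a) Matrix.PosSemidef.one isToeplitz_one (fun i => Matrix.one_apply_eq i)
    hm hj hj'
  -- For the identity matrix the error bound is zero, so the estimate becomes an equality.
  have hb : lagBound (a : ℝ) (1 : Matrix (Fin p) (Fin p) ℝ) j j' = 0 := by
    rw [Finset.mem_Icc] at hj
    rw [lagBound, ho, diagCoeff_one (k := j) (by omega), diagCoeff_one (k := j + j') (by omega), Finset.sum_eq_zero fun k hk => by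
      rw [Finset.mem_Ico] at hk
      rw [diagCoeff_one (by omega)]
      ring]
    simp
  rw [hb, mul_zero] at h
  have := sub_eq_zero.1 (abs_eq_zero.1 (le_antisymm h (abs_nonneg _)))
  rw [this]
  split_ifs <;> simp

/-- The contribution of the high lags to the squared norm of the coefficients. -/
lemma sum_Ico_sq_le {α : ℝ} (hα : 0 < α) {m : ℕ} (hm1 : 1 ≤ m) (hm : m < p)
    (h : ∑ j ∈ Finset.Ico 1 p, diagCoeff S j ^ 2 * (j : ℝ) ^ (2 * α) ≤ 1) :
    ∑ k ∈ Finset.Ico 1 p, diagCoeff S k ^ 2 ≤ 1 ∧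
    ∑ k ∈ Finset.Ico 1 p, diagCoeff S k ^ 2 ≤
      ∑ k ∈ Finset.Icc 1 m, diagCoeff S k ^ 2 + ((m : ℝ) ^ (-α)) ^ 2 := by
  constructor
  · refine (Finset.sum_le_sum fun k hk => ?_).trans h
    rw [Finset.mem_Ico] at hk
    have : (1 : ℝ) ≤ (k : ℝ) ^ (2 * α) :=
      Real.one_le_rpow (by exact_mod_cast hk.1) (by linarith)
    nlinarith [sq_nonneg (diagCoeff S k)]
  · have hU : Finset.Ico 1 p = Finset.Icc 1 m ∪ Finset.Ico (m + 1) p := by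
      ext k
      simp only [Finset.mem_Ico, Finset.mem_union, Finset.mem_Icc]
      omega
    have hD : Disjoint (Finset.Icc 1 m) (Finset.Ico (m + 1) p) := by
      rw [Finset.disjoint_left]
      intro k h1 h2
      rw [Finset.mem_Icc] at h1
      rw [Finset.mem_Ico] at h2
      omega
    have hm0 : (0 : ℝ) < m := by exact_mod_cast hm1
    set q := (m : ℝ) ^ (-α) with hq
    have hq0 : 0 < q := Real.rpow_pos_of_pos hm0 _
    have hqm : q ^ 2 * (m : ℝ) ^ (2 * α) = 1 := by
      rw [hq, ← Real.rpow_natCast, ← Real.rpow_mul hm0.le, ← Real.rpow_add hm0]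
      rw [show -α * ((2 : ℕ) : ℝ) + 2 * α = 0 by push_cast; ring, Real.rpow_zero]
    have htail : ∑ k ∈ Finset.Ico (m + 1) p, diagCoeff S k ^ 2 ≤ q ^ 2 := by
      calc ∑ k ∈ Finset.Ico (m + 1) p, diagCoeff S k ^ 2
          ≤ ∑ k ∈ Finset.Ico (m + 1) p, q ^ 2 * (diagCoeff S k ^ 2 * (k : ℝ) ^ (2 * α)) := by
            refine Finset.sum_le_sum fun k hk => ?_
            rw [Finset.mem_Ico] at hk
            have hk' : (m : ℝ) ^ (2 * α) ≤ (k : ℝ) ^ (2 * α) := by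
              apply Real.rpow_le_rpow hm0.le _ (by linarith)
              exact_mod_cast (by omega : m ≤ k)
            have : 1 ≤ q ^ 2 * (k : ℝ) ^ (2 * α) := by
              rw [← hqm]
              gcongr
            nlinarith [sq_nonneg (diagCoeff S k)]
        _ = q ^ 2 * ∑ k ∈ Finset.Ico (m + 1) p, diagCoeff S k ^ 2 * (k : ℝ) ^ (2 * α) := by
            rw [Finset.mul_sum]
        _ ≤ q ^ 2 * 1 := by
            gcongr
            refine (Finset.sum_le_sum_of_subset_of_nonneg ?_ fun k _ _ => by positivity).trans h
            rw [hU]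
            exact Finset.subset_union_right
        _ = q ^ 2 := mul_one _
    rw [hU, Finset.sum_union hD]
    linarith

end lagBounds

/-! ### Bounds for the two variance terms by energies -/

section remainders

variable {p : ℕ} {S : Matrix (Fin p) (Fin p) ℝ} {a : unitInterval} {m : ℕ}

/-- The squared norm of the first `m` coefficients. -/
def lowEnergy (m : ℕ) (S : Matrix (Fin p) (Fin p) ℝ) : ℝ :=
  ∑ j ∈ Finset.Icc 1 m, diagCoeff S j ^ 2

/-- The squared norm of all the coefficients off the diagonal. -/
def energy (S : Matrix (Fin p) (Fin p) ℝ) : ℝ := ∑ k ∈ Finset.Ico 1 p, diagCoeff S k ^ 2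

lemma lowEnergy_nonneg : 0 ≤ lowEnergy m S := Finset.sum_nonneg fun _ _ => sq_nonneg _

lemma energy_nonneg : 0 ≤ energy S := Finset.sum_nonneg fun _ _ => sq_nonneg _

lemma lowEnergy_le_energy (hm : m < p) : lowEnergy m S ≤ energy S := by
  refine Finset.sum_le_sum_of_subset_of_nonneg (fun k hk => ?_) fun _ _ _ => sq_nonneg _
  rw [Finset.mem_Icc] at hk
  rw [Finset.mem_Ico]
  omega

/-- For fixed `j` the differences `j - j'` are distinct and smaller than `m` in absolute value, so
the low lags suffice. The sums `j + j'` can exceed `m`, and the analogous bound below needs the full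
energy. -/
lemma sum_sum_offCoeff_sq_le :
    ∑ j ∈ Finset.Icc 1 m, ∑ j' ∈ Finset.Icc 1 m, offCoeff S ((j : ℤ) - j') ^ 2 ≤
      2 * m * lowEnergy m S := by
  have h : ∀ j ∈ Finset.Icc 1 m, ∑ j' ∈ Finset.Icc 1 m, offCoeff S ((j : ℤ) - j') ^ 2 ≤
      2 * lowEnergy m S := by
    intro j hj
    rw [Finset.mem_Icc] at hj
    refine sum_offCoeff_sq_comp_le _ (fun j' : ℕ => (j : ℤ) - j') _ ?_ ?_
    · intro i _ k _ hik
      simp only at hik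
      omega
    · intro i hi h0 _
      rw [Finset.mem_Icc] at hi ⊢
      omega
  refine (Finset.sum_le_sum h).trans (le_of_eq ?_)
  simp
  ring

lemma sum_diagCoeff_add_sq_le (j : ℕ) :
    ∑ j' ∈ Finset.Icc 1 m, diagCoeff S (j + j') ^ 2 ≤ energy S := by
  refine sum_sq_comp_le (diagCoeff S) _ (fun j' => j + j') _ ?_ ?_
  · intro i _ k _ hik
    simp only at hik
    omega
  · intro i hi hne
    rw [Finset.mem_Icc] at hi
    rw [Finset.mem_Ico]
    refine ⟨by omega, ?_⟩
    by_contra hp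
    exact hne (diagCoeff_eq_zero (by omega))

lemma sum_sum_diagCoeff_add_sq_le :
    ∑ j ∈ Finset.Icc 1 m, ∑ j' ∈ Finset.Icc 1 m, diagCoeff S (j + j') ^ 2 ≤ m * energy S := by
  refine (Finset.sum_le_sum fun j _ => sum_diagCoeff_add_sq_le j).trans (le_of_eq ?_)
  simp

/-- On the diagonal `σ_{j+j'}` becomes `σ_{2j}` and enters linearly, through the cross term with the
main part of the covariance. Cauchy–Schwarz costs `√m`, which after division by `m` still vanishes.
-/
lemma sum_abs_diagCoeff_two_mul_le :
    ∑ j ∈ Finset.Icc 1 m, |diagCoeff S (j + j)| ≤ √m * √(energy S) := by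
  have h := Real.sum_mul_le_sqrt_mul_sqrt (Finset.Icc 1 m) (fun _ => (1 : ℝ))
    fun j => |diagCoeff S (j + j)|
  simp only [one_mul, one_pow, Finset.sum_const, Nat.card_Icc, sq_abs, nsmul_eq_mul, mul_one,
    add_tsub_cancel_right] at h
  refine h.trans ?_
  gcongr
  refine sum_sq_comp_le (diagCoeff S) _ (fun j => j + j) _ ?_ ?_
  · intro i _ k _ hik
    simp only at hik
    omega
  · intro i hi hne
    rw [Finset.mem_Icc] at hi
    rw [Finset.mem_Ico]
    refine ⟨by omega, ?_⟩
    by_contra hp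
    exact hne (diagCoeff_eq_zero (by omega))

lemma sum_abs_diagCoeff_sq_le :
    (∑ j ∈ Finset.Icc 1 m, |diagCoeff S j|) ^ 2 ≤ m * lowEnergy m S := by
  have h := Finset.sum_mul_sq_le_sq_mul_sq (Finset.Icc 1 m) (fun _ => (1 : ℝ))
    fun j => |diagCoeff S j|
  simpa [lowEnergy] using h

lemma sum_sum_abs_mul_eq : ∑ j ∈ Finset.Icc 1 m, ∑ j' ∈ Finset.Icc 1 m,
    |diagCoeff S j * diagCoeff S j'| = (∑ j ∈ Finset.Icc 1 m, |diagCoeff S j|) ^ 2 := by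
  rw [sq, Finset.sum_mul_sum]
  exact Finset.sum_congr rfl fun j _ => Finset.sum_congr rfl fun j' _ => abs_mul _ _

lemma sum_sum_mul_sq_eq : ∑ j ∈ Finset.Icc 1 m, ∑ j' ∈ Finset.Icc 1 m,
    (diagCoeff S j * diagCoeff S j') ^ 2 = lowEnergy m S ^ 2 := by
  rw [sq (lowEnergy m S), lowEnergy, Finset.sum_mul_sum]
  exact Finset.sum_congr rfl fun j _ => Finset.sum_congr rfl fun j' _ => mul_pow _ _ _

lemma sum_diagCoeff_pow_four_le (hA : lowEnergy m S ≤ 1) :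
    ∑ j ∈ Finset.Icc 1 m, diagCoeff S j ^ 4 ≤ lowEnergy m S := by
  refine Finset.sum_le_sum fun j hj => ?_
  have h : diagCoeff S j ^ 2 ≤ 1 := (Finset.single_le_sum
    (f := fun j => diagCoeff S j ^ 2) (fun _ _ => sq_nonneg _) hj).trans hA
  nlinarith [sq_nonneg (diagCoeff S j)]

/-- Cauchy–Schwarz for double sums weighted by `|σ_j σ_{j'}|`. -/
lemma sum_sum_abs_mul_mul_abs_le (w : ℕ → ℕ → ℝ) : ∑ j ∈ Finset.Icc 1 m, ∑ j' ∈ Finset.Icc 1 m,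
    |diagCoeff S j * diagCoeff S j'| * |w j j'| ≤
    lowEnergy m S * √(∑ j ∈ Finset.Icc 1 m, ∑ j' ∈ Finset.Icc 1 m, w j j' ^ 2) := by
  have h := Real.sum_mul_le_sqrt_mul_sqrt (Finset.Icc 1 m ×ˢ Finset.Icc 1 m)
    (fun q => |diagCoeff S q.1 * diagCoeff S q.2|) fun q => |w q.1 q.2|
  simp only [sq_abs, Finset.sum_product, sum_sum_mul_sq_eq] at h
  rwa [Real.sqrt_sq lowEnergy_nonneg] at h

/-- Bound for the degenerate part of the variance in terms of the energies. -/
lemma R₁_le (hS : S.PosSemidef) (hT : IsToeplitz S) (h1 : ∀ i, S i i = 1) (hm1 : 1 ≤ m)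
    (hm : m < p) (hB1 : energy S ≤ 1) :
    R₁ m a S ≤ ((p : ℝ) - m) ^ 2 * ((a : ℝ) ^ 4 * (1 + 40 / m + 4 / √m) +
      28 * (a : ℝ) ^ 6 * energy S + 360 * (a : ℝ) ^ 6 * lowEnergy m S +
      80 * (a : ℝ) ^ 8 * m * energy S ^ 2) := by
  have ha0 : (0 : ℝ) ≤ a := a.2.1
  have ha1 : (a : ℝ) ≤ 1 := a.2.2
  set b : ℝ := (a : ℝ) with hb
  have hm0 : (0 : ℝ) < m := by exact_mod_cast hm1
  have hT0 : (0 : ℝ) < (p : ℝ) - m := sub_pos.2 (by exact_mod_cast hm)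
  have hA0 := lowEnergy_nonneg (m := m) (S := S)
  have hB0 := energy_nonneg (S := S)
  have hAB := lowEnergy_le_energy (S := S) hm
  have hA1 := hAB.trans hB1
  set A := lowEnergy m S with hA
  set B := energy S with hB
  set D := lagBound b S with hD
  set J := Finset.Icc 1 m with hJ
  have hcard : (J.card : ℝ) = m := by simp [hJ]
  have hΓ : ∀ j ∈ J, ∀ j' ∈ J, lagCov m a S j j' ^ 2 ≤
      ((p : ℝ) - m) ^ 2 * ((if j = j' then b ^ 2 else 0) + D j j') ^ 2 := by
    intro j hj j' hj'
    have h := abs_lagCov_sub_le (a := a) hS hT h1 hm hj hj'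
    rw [← mul_pow, mul_add]
    refine sq_le_sq' ?_ ?_
    · have h2 := (abs_le.1 h).1
      have h3 : 0 ≤ ((p : ℝ) - m) * (if j = j' then b ^ 2 else 0) := by positivity
      linarith
    · have h2 := (abs_le.1 h).2
      linarith
  have hdiag : ∑ j ∈ J, D j j ≤ 10 * b ^ 2 + 2 * b ^ 3 * √m + 4 * b ^ 4 * m * B := by
    have e : ∀ j ∈ J, D j j = 2 * b ^ 2 * diagCoeff S j ^ 2 + 2 * b ^ 3 * |diagCoeff S (j + j)| +
        8 * b ^ 3 * diagCoeff S j ^ 2 + 4 * b ^ 4 * B := by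
      intro j _
      rw [hD, lagBound, if_pos rfl, sub_self, offCoeff, if_pos rfl, abs_zero, mul_zero, add_zero,
        (by rw [← sq, abs_of_nonneg (sq_nonneg _)] :
          |diagCoeff S j * diagCoeff S j| = diagCoeff S j ^ 2)]
      rfl
    rw [Finset.sum_congr rfl e]
    simp only [Finset.sum_add_distrib, ← Finset.mul_sum, Finset.sum_const, nsmul_eq_mul, hcard]
    have h2 : ∑ j ∈ J, |diagCoeff S (j + j)| ≤ √m :=
      sum_abs_diagCoeff_two_mul_le.trans
        (mul_le_of_le_one_right (Real.sqrt_nonneg _) (Real.sqrt_le_one.2 hB1))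
    have hs : ∑ j ∈ J, diagCoeff S j ^ 2 = A := rfl
    rw [hs]
    have b32 : b ^ 3 ≤ b ^ 2 := pow_le_pow_of_le_one ha0 ha1 (by norm_num)
    have b2 : 0 ≤ b ^ 2 := by positivity
    have t1 : 2 * b ^ 2 * A ≤ 2 * b ^ 2 * 1 := by gcongr
    have t2 : 8 * b ^ 3 * A ≤ 8 * b ^ 2 * 1 := by gcongr
    have t3 : 2 * b ^ 3 * ∑ j ∈ J, |diagCoeff S (j + j)| ≤ 2 * b ^ 3 * √m := by gcongr
    linarith
  -- Cauchy–Schwarz for the five summands of `lagBound`, each square being matched with one of the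
  -- energy estimates above.
  have hsq : ∑ j ∈ J, ∑ j' ∈ J, D j j' ^ 2 ≤ 5 * (4 * b ^ 4 + 8 * b ^ 6 * m * A +
      4 * b ^ 6 * m * B + 64 * b ^ 6 * A + 16 * b ^ 8 * m ^ 2 * B ^ 2) := by
    have e : ∀ j ∈ J, ∀ j' ∈ J, D j j' ^ 2 ≤ 5 * ((if j = j' then 4 * b ^ 4 * diagCoeff S j ^ 4 else 0) +
        4 * b ^ 6 * offCoeff S ((j : ℤ) - j') ^ 2 + 4 * b ^ 6 * diagCoeff S (j + j') ^ 2 +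
        64 * b ^ 6 * (diagCoeff S j * diagCoeff S j') ^ 2 + 16 * b ^ 8 * B ^ 2) := by
      intro j _ j' _
      have five : ∀ x y z u v : ℝ, (x + y + z + u + v) ^ 2 ≤
          5 * (x ^ 2 + y ^ 2 + z ^ 2 + u ^ 2 + v ^ 2) := by
        intro x y z u v
        nlinarith [sq_nonneg (x - y), sq_nonneg (x - z), sq_nonneg (x - u), sq_nonneg (x - v),
          sq_nonneg (y - z), sq_nonneg (y - u), sq_nonneg (y - v), sq_nonneg (z - u),
          sq_nonneg (z - v), sq_nonneg (u - v)]
      refine (five _ _ _ _ _).trans (le_of_eq ?_)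
      simp only [mul_pow, sq_abs]
      split_ifs <;> simp only [hB, energy] <;> ring
    refine (Finset.sum_le_sum fun j hj => Finset.sum_le_sum fun j' hj' => e j hj j' hj').trans ?_
    simp only [← Finset.mul_sum, Finset.sum_add_distrib, Finset.sum_const, nsmul_eq_mul, hcard]
    have t1 : ∑ j ∈ J, ∑ j' ∈ J, (if j = j' then 4 * b ^ 4 * diagCoeff S j ^ 4 else 0) ≤
        4 * b ^ 4 := by
      have : ∀ j ∈ J, ∑ j' ∈ J, (if j = j' then 4 * b ^ 4 * diagCoeff S j ^ 4 else 0) =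
          4 * b ^ 4 * diagCoeff S j ^ 4 := fun j hj => by rw [Finset.sum_ite_eq, if_pos hj]
      rw [Finset.sum_congr rfl this, ← Finset.mul_sum]
      exact mul_le_of_le_one_right (by positivity) ((sum_diagCoeff_pow_four_le hA1).trans hA1)
    have t2 : 4 * b ^ 6 * ∑ j ∈ J, ∑ j' ∈ J, offCoeff S ((j : ℤ) - j') ^ 2 ≤
        4 * b ^ 6 * (2 * m * A) := by
      gcongr
      exact sum_sum_offCoeff_sq_le
    have t3 : 4 * b ^ 6 * ∑ j ∈ J, ∑ j' ∈ J, diagCoeff S (j + j') ^ 2 ≤ 4 * b ^ 6 * (m * B) := by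
      gcongr
      exact sum_sum_diagCoeff_add_sq_le
    have t4 : 64 * b ^ 6 * ∑ j ∈ J, ∑ j' ∈ J, (diagCoeff S j * diagCoeff S j') ^ 2 ≤
        64 * b ^ 6 * A := by
      rw [sum_sum_mul_sq_eq]
      gcongr
      nlinarith
    linarith
  -- The main part of the covariance lives on the diagonal, so the cross term involves `D j j` only.
  have htot : ∑ j ∈ J, ∑ j' ∈ J, ((if j = j' then b ^ 2 else 0) + D j j') ^ 2 =
      m * b ^ 4 + 2 * b ^ 2 * ∑ j ∈ J, D j j + ∑ j ∈ J, ∑ j' ∈ J, D j j' ^ 2 := by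
    have e : ∀ j ∈ J, ∑ j' ∈ J, ((if j = j' then b ^ 2 else 0) + D j j') ^ 2 =
        b ^ 4 + 2 * b ^ 2 * D j j + ∑ j' ∈ J, D j j' ^ 2 := by
      intro j hj
      have e1 : ∀ j' ∈ J, ((if j = j' then b ^ 2 else 0) + D j j') ^ 2 =
          (if j = j' then b ^ 4 + 2 * b ^ 2 * D j j' else 0) + D j j' ^ 2 := by
        intro j' _
        split_ifs <;> ring
      rw [Finset.sum_congr rfl e1, Finset.sum_add_distrib, Finset.sum_ite_eq, if_pos hj]
    rw [Finset.sum_congr rfl e]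
    simp only [Finset.sum_add_distrib, ← Finset.mul_sum, Finset.sum_const, nsmul_eq_mul, hcard]
  have hR : R₁ m a S ≤ 1 / m * (((p : ℝ) - m) ^ 2 *
      ∑ j ∈ J, ∑ j' ∈ J, ((if j = j' then b ^ 2 else 0) + D j j') ^ 2) := by
    rw [R₁]
    refine mul_le_mul_of_nonneg_left ?_ (by positivity)
    rw [Finset.mul_sum]
    refine Finset.sum_le_sum fun j hj => ?_
    rw [Finset.mul_sum]
    exact Finset.sum_le_sum fun j' hj' => hΓ j hj j' hj'
  refine hR.trans ?_
  rw [htot, mul_left_comm]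
  gcongr
  rw [one_div, inv_mul_le_iff₀ hm0]
  have hw : (m : ℝ) * (4 / √m) = 4 * √m := by
    rw [mul_div_assoc', div_eq_iff (Real.sqrt_pos.2 hm0).ne', mul_assoc,
      Real.mul_self_sqrt hm0.le]
    ring
  -- The constants collect the diagonal cross term and five times the sum of squares: `40 = 20 +
  -- 20`, `28 = 8 + 20`, `360 = 40 + 320`, `80 = 5 · 16`.
  have hrhs : (m : ℝ) * (b ^ 4 * (1 + 40 / m + 4 / √m) + 28 * b ^ 6 * B + 360 * b ^ 6 * A +
      80 * b ^ 8 * m * B ^ 2) = b ^ 4 * m + 40 * b ^ 4 + b ^ 4 * (4 * √m) + 28 * b ^ 6 * m * B +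
      360 * b ^ 6 * m * A + 80 * b ^ 8 * m ^ 2 * B ^ 2 := by
    rw [← hw]
    field_simp
  rw [hrhs]
  have m1 : (1 : ℝ) ≤ m := by exact_mod_cast hm1
  have hb54 : b ^ 5 ≤ b ^ 4 := pow_le_pow_of_le_one ha0 ha1 (by norm_num)
  have hA6 : b ^ 6 * A ≤ b ^ 6 * m * A := by
    have : b ^ 6 * A * 1 ≤ b ^ 6 * A * m := by gcongr
    linarith
  have h2 : 2 * b ^ 2 * ∑ j ∈ J, D j j ≤
      2 * b ^ 2 * (10 * b ^ 2 + 2 * b ^ 3 * √m + 4 * b ^ 4 * m * B) := by gcongr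
  have h5 : b ^ 5 * √m ≤ b ^ 4 * √m := by gcongr
  have e2 : 2 * b ^ 2 * (10 * b ^ 2 + 2 * b ^ 3 * √m + 4 * b ^ 4 * m * B) =
    20 * b ^ 4 + 4 * (b ^ 5 * √m) + 8 * b ^ 6 * m * B := by ring
  have h6 : 0 ≤ b ^ 6 * m * A := by positivity
  linarith

/-- Bound for the linear part of the variance in terms of the energies. -/
lemma R₂_le (hS : S.PosSemidef) (hT : IsToeplitz S) (h1 : ∀ i, S i i = 1) (hm1 : 1 ≤ m)
    (hm : m < p) (hA1 : lowEnergy m S ≤ 1) :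
    R₂ m a S ≤ ((p : ℝ) - m) * (2 * (a : ℝ) ^ 4 / m * (3 * (a : ℝ) ^ 2 * lowEnergy m S +
      2 * (a : ℝ) ^ 3 * (lowEnergy m S * √(2 * m * lowEnergy m S)) +
      2 * (a : ℝ) ^ 3 * (lowEnergy m S * √(m * energy S)) + 8 * (a : ℝ) ^ 3 * lowEnergy m S ^ 2 +
      4 * (a : ℝ) ^ 4 * energy S * (m * lowEnergy m S))) := by
  have ha0 : (0 : ℝ) ≤ a := a.2.1
  have hm0 : (0 : ℝ) < m := by exact_mod_cast hm1
  have hT0 : (0 : ℝ) < (p : ℝ) - m := sub_pos.2 (by exact_mod_cast hm)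
  set b : ℝ := (a : ℝ) with hb
  set D := lagBound b S with hD
  set J := Finset.Icc 1 m with hJ
  set s := diagCoeff S with hs
  have hterm : ∀ j ∈ J, ∀ j' ∈ J, s j * s j' * lagCov m a S j j' ≤
      ((p : ℝ) - m) * ((if j = j' then b ^ 2 * s j ^ 2 + 2 * b ^ 2 * s j ^ 4 else 0) +
        2 * b ^ 3 * (|s j * s j'| * |offCoeff S ((j : ℤ) - j')|) +
        2 * b ^ 3 * (|s j * s j'| * |s (j + j')|) + 8 * b ^ 3 * (s j * s j') ^ 2 +
        4 * b ^ 4 * energy S * |s j * s j'|) := by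
    intro j hj j' hj'
    have h := abs_lagCov_sub_le (a := a) hS hT h1 hm hj hj'
    have h2 : s j * s j' * (lagCov m a S j j' - ((p : ℝ) - m) * (if j = j' then b ^ 2 else 0)) ≤
        |s j * s j'| * (((p : ℝ) - m) * D j j') := by
      refine (le_abs_self _).trans ?_
      rw [abs_mul]
      gcongr
    have h3 : s j * s j' * lagCov m a S j j' ≤ ((p : ℝ) - m) *
        (s j * s j' * (if j = j' then b ^ 2 else 0) + |s j * s j'| * D j j') := by
      nlinarith
    refine h3.trans (mul_le_mul_of_nonneg_left (le_of_eq ?_) hT0.le)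
    rw [hD, lagBound, energy, ← sq_abs (s j * s j')]
    split_ifs with hjj
    · subst hjj
      have e : |s j * s j| = s j ^ 2 := by rw [← sq, abs_of_nonneg (sq_nonneg _)]
      rw [e]
      ring
    · ring
  have hsum := Finset.sum_le_sum fun j hj => Finset.sum_le_sum fun j' hj' => hterm j hj j' hj'
  have hR : R₂ m a S = 2 * b ^ 4 / m * ∑ j ∈ J, ∑ j' ∈ J, s j * s j' * lagCov m a S j j' := rfl
  rw [hR, mul_left_comm ((p : ℝ) - m)]
  refine mul_le_mul_of_nonneg_left (hsum.trans ?_) (by positivity)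
  simp only [← Finset.mul_sum, Finset.sum_add_distrib]
  -- The five summands are compared separately: fourth powers against squares on the diagonal,
  -- weighted Cauchy–Schwarz for differences and for sums of lags, an exact product, and `(∑ |σ_j|)²
  -- ≤ m ∑ σ_j²`.
  gcongr
  · have : ∀ j ∈ J, ∑ j' ∈ J, (if j = j' then b ^ 2 * s j ^ 2 + 2 * b ^ 2 * s j ^ 4 else 0) =
        b ^ 2 * s j ^ 2 + 2 * b ^ 2 * s j ^ 4 := fun j hj => by
      rw [Finset.sum_ite_eq, if_pos hj]
    rw [Finset.sum_congr rfl this, Finset.sum_add_distrib, ← Finset.mul_sum, ← Finset.mul_sum]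
    have h4 := sum_diagCoeff_pow_four_le hA1
    have h5 : 2 * b ^ 2 * ∑ j ∈ J, s j ^ 4 ≤ 2 * b ^ 2 * lowEnergy m S := by gcongr
    have h6 : ∑ j ∈ J, s j ^ 2 = lowEnergy m S := rfl
    rw [h6]
    linarith
  · refine (sum_sum_abs_mul_mul_abs_le fun j j' => offCoeff S ((j : ℤ) - j')).trans ?_
    gcongr
    · exact lowEnergy_nonneg
    · exact sum_sum_offCoeff_sq_le
  · refine (sum_sum_abs_mul_mul_abs_le fun j j' => s (j + j')).trans ?_
    gcongr
    · exact lowEnergy_nonneg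
    · exact sum_sum_diagCoeff_add_sq_le
  · exact sum_sum_mul_sq_eq.le
  · exact mul_nonneg (by positivity) energy_nonneg
  · rw [sum_sum_abs_mul_eq]
    exact sum_abs_diagCoeff_sq_le

end remainders

/-! ### Mean and variance of the statistic -/

section moments

variable {n p m : ℕ} {S : Matrix (Fin p) (Fin p) ℝ} {a : unitInterval}

lemma sum_filter_ne_mul {n : ℕ} (x : Fin n → ℝ) :
    ∑ kl : Fin n × Fin n with kl.1 ≠ kl.2, x kl.1 * x kl.2 = (∑ k, x k) ^ 2 - ∑ k, x k ^ 2 := by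
  have h := Finset.sum_filter_add_sum_filter_not (Finset.univ : Finset (Fin n × Fin n))
    (fun kl => kl.1 = kl.2) fun kl => x kl.1 * x kl.2
  have h1 : ∑ kl : Fin n × Fin n with kl.1 = kl.2, x kl.1 * x kl.2 = ∑ k, x k ^ 2 := by
    rw [Finset.sum_filter, Fintype.sum_prod_type]
    refine Finset.sum_congr rfl fun k _ => ?_
    rw [Finset.sum_ite_eq, if_pos (Finset.mem_univ _), sq]
  have h2 : ∑ kl : Fin n × Fin n, x kl.1 * x kl.2 = (∑ k, x k) ^ 2 := by
    rw [sq, Finset.sum_mul_sum, Fintype.sum_prod_type]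
  rw [h1, h2] at h
  rw [← h]
  ring

/-- The statistic as a U-statistic of the lag sums. -/
lemma Ahat_eq_ustat (Y : Fin n → Fin p → ℝ) :
    Ahat n p m Y = 1 / ((n : ℝ) * ((n : ℝ) - 1) * ((p : ℝ) - m) ^ 2) * (1 / √(2 * (m : ℝ))) * 2 *
      ustat (Finset.Icc 1 m) (fun j y => lagSum m j y) Y := by
  rw [Ahat, mul_assoc _ (2 : ℝ)]
  congr 1
  -- The statistic runs over ordered pairs of observations and `ustat` over unordered ones; this is
  -- the factor `2`.
  rw [Finset.sum_comm, ustat, mul_div_cancel₀ _ two_ne_zero]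
  refine Finset.sum_congr rfl fun j _ => ?_
  rw [colSum, ← sum_filter_ne_mul fun k => lagSum m j (Y k)]
  refine Finset.sum_congr rfl fun kl _ => ?_
  rw [lagSum, lagSum, Finset.sum_mul_sum]

lemma hasAllMoments_Ahat : HasAllMoments (Ahat n p m) (sampleLaw n a S) := by
  have h := (hasAllMoments_ustat (J := Finset.Icc 1 m) (l := fun j y => lagSum m j y)
    (ν := obsLaw a S) (fun j => hasAllMoments_lagSum m j) n).const_mul
    (1 / ((n : ℝ) * ((n : ℝ) - 1) * ((p : ℝ) - m) ^ 2) * (1 / √(2 * (m : ℝ))) * 2)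
  have e : Ahat n p m = fun Y => 1 / ((n : ℝ) * ((n : ℝ) - 1) * ((p : ℝ) - m) ^ 2) *
      (1 / √(2 * (m : ℝ))) * 2 * ustat (Finset.Icc 1 m) (fun j y => lagSum m j y) Y :=
    funext Ahat_eq_ustat
  rw [e]
  exact h

lemma meanA_eq (hS : S.PosSemidef) (hT : IsToeplitz S) (hn : 2 ≤ n) (hm : m < p) :
    meanA n p m a S = (a : ℝ) ^ 4 / √(2 * (m : ℝ)) * lowEnergy m S := by
  have h := (integral_ustat_eq_and_variance_ustat (J := Finset.Icc 1 m)
    (l := fun j y => lagSum m j y) (ν := obsLaw a S) (fun j => hasAllMoments_lagSum m j) n).1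
  have hT0 : (0 : ℝ) < (p : ℝ) - m := sub_pos.2 (by exact_mod_cast hm)
  have hn1 : (0 : ℝ) < (n : ℝ) - 1 := sub_pos.2 (by exact_mod_cast hn)
  have hn0 : (0 : ℝ) < (n : ℝ) := by linarith
  rw [meanA]
  simp_rw [Ahat_eq_ustat]
  rw [integral_const_mul, sampleLaw, h]
  have e : ∑ j ∈ Finset.Icc 1 m, (∫ y, lagSum m j y ∂(obsLaw a S)) ^ 2 =
      (((p : ℝ) - m) * (a : ℝ) ^ 2) ^ 2 * lowEnergy m S := by
    rw [lowEnergy, Finset.mul_sum]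
    refine Finset.sum_congr rfl fun j hj => ?_
    rw [integral_lagSum hS hT hm hj]
    ring
  rw [e]
  field_simp

/-- The variance formula for U-statistics times the squared normalization `2 / (n² (n-1)² (p-m)⁴
m)`. In the linear part the two means contribute a further `(p - m)² a⁴ σ_j σ_{j'}`. -/
lemma varA_eq (hS : S.PosSemidef) (hT : IsToeplitz S) (hn : 2 ≤ n) (hm1 : 1 ≤ m) (hm : m < p) :
    varA n p m a S = R₁ m a S / ((n : ℝ) * ((n : ℝ) - 1) * ((p : ℝ) - m) ^ 4) +
      R₂ m a S / ((n : ℝ) * ((p : ℝ) - m) ^ 2) := by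
  have h := (integral_ustat_eq_and_variance_ustat (J := Finset.Icc 1 m)
    (l := fun j y => lagSum m j y) (ν := obsLaw a S) (fun j => hasAllMoments_lagSum m j) n).2
  have hT0 : (0 : ℝ) < (p : ℝ) - m := sub_pos.2 (by exact_mod_cast hm)
  have hn1 : (0 : ℝ) < (n : ℝ) - 1 := sub_pos.2 (by exact_mod_cast hn)
  have hn0 : (0 : ℝ) < (n : ℝ) := by linarith
  have hm0 : (0 : ℝ) < m := by exact_mod_cast hm1
  have e : Ahat n p m = fun Y => 1 / ((n : ℝ) * ((n : ℝ) - 1) * ((p : ℝ) - m) ^ 2) *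
      (1 / √(2 * (m : ℝ))) * 2 * ustat (Finset.Icc 1 m) (fun j y => lagSum m j y) Y :=
    funext Ahat_eq_ustat
  rw [varA, e, variance_const_mul, sampleLaw, h]
  have e1 : ∑ i ∈ Finset.Icc 1 m, ∑ j ∈ Finset.Icc 1 m,
      covariance (fun y => lagSum m i y) (fun y => lagSum m j y) (obsLaw a S) ^ 2 =
      m * R₁ m a S := by
    rw [R₁, ← mul_assoc, mul_one_div, div_self hm0.ne', one_mul]
    rfl
  have e2 : ∑ i ∈ Finset.Icc 1 m, ∑ j ∈ Finset.Icc 1 m,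
      (∫ y, lagSum m i y ∂(obsLaw a S)) * (∫ y, lagSum m j y ∂(obsLaw a S)) *
        covariance (fun y => lagSum m i y) (fun y => lagSum m j y) (obsLaw a S) =
      m * ((p : ℝ) - m) ^ 2 / 2 * R₂ m a S := by
    have e3 : (m : ℝ) * ((p : ℝ) - m) ^ 2 / 2 * R₂ m a S = ((p : ℝ) - m) ^ 2 * (a : ℝ) ^ 4 *
        ∑ j ∈ Finset.Icc 1 m, ∑ j' ∈ Finset.Icc 1 m,
          diagCoeff S j * diagCoeff S j' * lagCov m a S j j' := by
      rw [R₂]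
      field_simp
    rw [e3, Finset.mul_sum]
    refine Finset.sum_congr rfl fun i hi => ?_
    rw [Finset.mul_sum]
    refine Finset.sum_congr rfl fun j hj => ?_
    rw [integral_lagSum hS hT hm hi, integral_lagSum hS hT hm hj, lagCov]
    ring
  rw [e1, e2, mul_pow, mul_pow, div_pow, div_pow, Real.sq_sqrt (by positivity)]
  field_simp

end moments

/-! ### From energies to powers of the mean -/

section bounds

/-- Here `b = a`, `A` and `B` are the low and the full energy, `M = m`, `s = √(2m)`, `w = √m`, `q =
m^{-α}`, `E` is the mean and `x = m^{3/2-2α}`. Replace `B` by `A + q²`; then `b⁴ A = E s` turns `A`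
into `E`, and what contains `q` goes into the vanishing term. -/
lemma remainder_one_bound {b A B E M s w q x : ℝ} (hb0 : 0 ≤ b) (hb1 : b ≤ 1) (hA0 : 0 ≤ A)
    (hB0 : 0 ≤ B) (hBA : B ≤ A + q ^ 2) (hw1 : 1 ≤ w) (hwM : w ^ 2 = M) (hsM : s ^ 2 = 2 * M)
    (hs : 0 < s) (hq : 0 ≤ q) (hE : b ^ 4 * A = E * s) (hE0 : 0 ≤ E) (hx : 0 ≤ x) :
    b ^ 4 * (1 + 40 / M + 4 / w) + 28 * b ^ 6 * B + 360 * b ^ 6 * A + 80 * b ^ 8 * M * B ^ 2 ≤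
      b ^ 4 * (1 + 1000 * (1 / M + 1 / w + q + q ^ 2 + w * q ^ 2 + M * q ^ 4)) +
        E * (1000 * b ^ 2 * M + 1000 * b ^ 3 * x) + E ^ 2 * (1000 * M ^ 2) := by
  have hM1 : 1 ≤ M := by nlinarith
  have hsM' : s ≤ 2 * M := by nlinarith
  have b4 : 0 ≤ b ^ 4 := by positivity
  have b64 : b ^ 6 ≤ b ^ 4 := pow_le_pow_of_le_one hb0 hb1 (by norm_num)
  have b84 : b ^ 8 ≤ b ^ 4 := pow_le_pow_of_le_one hb0 hb1 (by norm_num)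
  have t1 : b ^ 6 * B ≤ b ^ 6 * A + b ^ 4 * q ^ 2 := by
    have : b ^ 6 * B ≤ b ^ 6 * (A + q ^ 2) := by gcongr
    have : b ^ 6 * q ^ 2 ≤ b ^ 4 * q ^ 2 := by gcongr
    linarith
  have t2 : b ^ 6 * A ≤ 2 * (E * (b ^ 2 * M)) := by
    have e : b ^ 6 * A = b ^ 2 * (E * s) := by rw [← hE]; ring
    rw [e]
    have : b ^ 2 * (E * s) ≤ b ^ 2 * (E * (2 * M)) := by gcongr
    linarith
  have t3 : b ^ 8 * M * B ^ 2 ≤ 4 * (E ^ 2 * M ^ 2) + 2 * (b ^ 4 * (M * q ^ 4)) := by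
    have h1 : B ^ 2 ≤ 2 * A ^ 2 + 2 * q ^ 4 := by nlinarith [sq_nonneg (A - q ^ 2), sq_nonneg q]
    have h2 : b ^ 8 * M * B ^ 2 ≤ b ^ 8 * M * (2 * A ^ 2 + 2 * q ^ 4) := by gcongr
    have e : b ^ 8 * M * A ^ 2 = 2 * (E ^ 2 * M ^ 2) := by
      have : b ^ 8 * M * A ^ 2 = (b ^ 4 * A) ^ 2 * M := by ring
      rw [this, hE, mul_pow, hsM]
      ring
    have h3 : b ^ 8 * (M * q ^ 4) ≤ b ^ 4 * (M * q ^ 4) := by gcongr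
    linarith
  have p1 : 0 ≤ b ^ 4 * (1 / M) := by positivity
  have p2 : 0 ≤ b ^ 4 * (1 / w) := by positivity
  have p3 : 0 ≤ b ^ 4 * q := by positivity
  have p4 : 0 ≤ b ^ 4 * (w * q ^ 2) := by positivity
  have p5 : 0 ≤ b ^ 4 * q ^ 2 := by positivity
  have p6 : 0 ≤ b ^ 4 * (M * q ^ 4) := by positivity
  have p7 : 0 ≤ E * (b ^ 2 * M) := by positivity
  have p8 : 0 ≤ E * (b ^ 3 * x) := by positivity
  have p9 : 0 ≤ E ^ 2 * M ^ 2 := by positivity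
  have e1 : 40 / M = 40 * (1 / M) := by ring
  have e2 : 4 / w = 4 * (1 / w) := by ring
  rw [e1, e2]
  nlinarith

set_option maxHeartbeats 800000 in
-- Notation as in `remainder_one_bound`, now with `x = m^{3/4-α}` and `g = m^{1/4}`. Half-integer
-- powers of `A` come from the Cauchy–Schwarz bounds and are traded for `E^{3/2}` through `b² √A ≤ 2
-- √E g`.
lemma remainder_two_bound {b A B E M s w q x g : ℝ} (hb0 : 0 ≤ b) (hb1 : b ≤ 1) (hA0 : 0 ≤ A)
    (hA1 : A ≤ 1) (hBA : B ≤ A + q ^ 2) (hw1 : 1 ≤ w) (hwM : w ^ 2 = M)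
    (hsM : s ^ 2 = 2 * M) (hs : 0 < s) (hq : 0 ≤ q) (hE : b ^ 4 * A = E * s) (hE0 : 0 ≤ E)
    (hx : 0 ≤ x) (hg0 : 0 ≤ g) (hgw : g ^ 2 = w) :
    2 * b ^ 4 / M * (3 * b ^ 2 * A + 2 * b ^ 3 * (A * √(2 * M * A)) +
      2 * b ^ 3 * (A * √(M * B)) + 8 * b ^ 3 * A ^ 2 + 4 * b ^ 4 * B * (M * A)) ≤
      b ^ 2 * E * (1000 * (1 / M + 1 / w + q + q ^ 2 + w * q ^ 2 + M * q ^ 4)) +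
        E * √E * (1000 * b * g + 1000 * b ^ 2 * x) + E ^ 2 * (1000 * M) := by
  have hM1 : 1 ≤ M := by nlinarith
  have hw0 : 0 < w := by linarith
  have hM0 : 0 < M := by linarith
  have hsw : s ≤ 2 * w := by nlinarith
  set c := √A with hc
  have hc0 : 0 ≤ c := Real.sqrt_nonneg _
  have hc2 : c ^ 2 = A := Real.sq_sqrt hA0
  have hc1 : c ≤ 1 := Real.sqrt_le_one.2 hA1
  set f := √E with hf
  have hf0 : 0 ≤ f := Real.sqrt_nonneg _
  have hf2 : f ^ 2 = E := Real.sq_sqrt hE0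
  have r1 : √(2 * M * A) = s * c := by
    rw [← hsM, Real.sqrt_mul (sq_nonneg s), Real.sqrt_sq hs.le]
  have r2 : √(M * B) ≤ w * (c + q) := by
    rw [← hwM, Real.sqrt_mul (sq_nonneg w), Real.sqrt_sq hw0.le]
    gcongr
    rw [Real.sqrt_le_iff]
    exact ⟨by positivity, by nlinarith [mul_nonneg hc0 hq]⟩
  -- Square both sides: `b⁴ A = E s` and `s ≤ 2w = 2g²`.
  have key : b ^ 2 * c ≤ 2 * (f * g) := by
    have h : (b ^ 2 * c) ^ 2 ≤ (2 * (f * g)) ^ 2 := by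
      have e1 : (b ^ 2 * c) ^ 2 = E * s := by rw [mul_pow, hc2, ← hE]; ring
      have e2 : (2 * (f * g)) ^ 2 = 4 * (E * w) := by
        rw [mul_pow, mul_pow, hf2, hgw]; ring
      rw [e1, e2]
      nlinarith [mul_nonneg hE0 hw0.le]
    exact (sq_le_sq₀ (by positivity) (by positivity)).1 h
  have hZ : b ^ 3 * (E * c) ≤ 2 * (E * f * (b * g)) := by
    have : b * E * (b ^ 2 * c) ≤ b * E * (2 * (f * g)) := by gcongr
    linarith
  have hsM1 : s / M ≤ 2 * (1 / w) := by
    rw [div_le_iff₀ hM0, ← hwM]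
    field_simp
    linarith
  have hw11 : 1 / w ≤ 1 := by rw [div_le_one hw0]; exact hw1
  have hswM : s * w / M ≤ 2 := by
    rw [div_le_iff₀ hM0, ← hwM]
    nlinarith
  have b32 : b ^ 3 ≤ b ^ 2 := pow_le_pow_of_le_one hb0 hb1 (by norm_num)
  have b42 : b ^ 4 ≤ b ^ 2 := pow_le_pow_of_le_one hb0 hb1 (by norm_num)
  have t1 : 2 * b ^ 4 / M * (3 * b ^ 2 * A) ≤ 12 * (b ^ 2 * E * (1 / w)) := by
    have e : 2 * b ^ 4 / M * (3 * b ^ 2 * A) = 6 * (b ^ 2 * E) * (s / M) := by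
      have : 2 * b ^ 4 / M * (3 * b ^ 2 * A) = 6 * b ^ 2 * (b ^ 4 * A) / M := by ring
      rw [this, hE]; ring
    rw [e]
    have : 6 * (b ^ 2 * E) * (s / M) ≤ 6 * (b ^ 2 * E) * (2 * (1 / w)) := by gcongr
    linarith
  have t2 : 2 * b ^ 4 / M * (2 * b ^ 3 * (A * √(2 * M * A))) ≤ 16 * (E * f * (b * g)) := by
    have e : 2 * b ^ 4 / M * (2 * b ^ 3 * (A * √(2 * M * A))) = 8 * (b ^ 3 * (E * c)) := by
      have : 2 * b ^ 4 / M * (2 * b ^ 3 * (A * (s * c))) =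
          4 * b ^ 3 * (b ^ 4 * A) * s * c / M := by ring
      rw [r1, this, hE, show 4 * b ^ 3 * (E * s) * s * c / M = 4 * b ^ 3 * E * c * s ^ 2 / M by ring,
        hsM, div_eq_iff hM0.ne']
      ring
    rw [e]
    linarith
  have t3 : 2 * b ^ 4 / M * (2 * b ^ 3 * (A * √(M * B))) ≤
      16 * (E * f * (b * g)) + 8 * (b ^ 2 * E * q) := by
    have h1 : 2 * b ^ 4 / M * (2 * b ^ 3 * (A * √(M * B))) ≤
        2 * b ^ 4 / M * (2 * b ^ 3 * (A * (w * (c + q)))) := by gcongr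
    have e : 2 * b ^ 4 / M * (2 * b ^ 3 * (A * (w * (c + q)))) =
        4 * (b ^ 3 * (E * (c + q))) * (s * w / M) := by
      have : 2 * b ^ 4 / M * (2 * b ^ 3 * (A * (w * (c + q)))) =
          4 * b ^ 3 * (b ^ 4 * A) * w * (c + q) / M := by ring
      rw [this, hE]; ring
    have h2 : 4 * (b ^ 3 * (E * (c + q))) * (s * w / M) ≤ 4 * (b ^ 3 * (E * (c + q))) * 2 := by
      gcongr
    have h3 : b ^ 3 * (E * q) ≤ b ^ 2 * (E * q) := by gcongr
    rw [e] at h1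
    linarith
  have t4 : 2 * b ^ 4 / M * (8 * b ^ 3 * A ^ 2) ≤ 64 * (E * f * (b * g)) := by
    have e : 2 * b ^ 4 / M * (8 * b ^ 3 * A ^ 2) = 16 * (b ^ 3 * (E * A)) * (s / M) := by
      have : 2 * b ^ 4 / M * (8 * b ^ 3 * A ^ 2) = 16 * b ^ 3 * (b ^ 4 * A) * A / M := by ring
      rw [this, hE]; ring
    rw [e]
    have h1 : 16 * (b ^ 3 * (E * A)) * (s / M) ≤ 16 * (b ^ 3 * (E * A)) * 2 := by
      gcongr
      linarith
    have h2 : b ^ 3 * (E * A) ≤ b ^ 3 * (E * c) := by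
      gcongr
      nlinarith
    linarith
  have t5 : 2 * b ^ 4 / M * (4 * b ^ 4 * B * (M * A)) ≤
      16 * (E ^ 2 * M) + 16 * (b ^ 2 * E * (w * q ^ 2)) := by
    have e : 2 * b ^ 4 / M * (4 * b ^ 4 * B * (M * A)) = 8 * b ^ 4 * (E * s) * B := by
      rw [← hE, div_mul_eq_mul_div, div_eq_iff hM0.ne']
      ring
    rw [e]
    have h1 : 8 * b ^ 4 * (E * s) * B ≤ 8 * b ^ 4 * (E * s) * (A + q ^ 2) := by gcongr
    have e2 : 8 * b ^ 4 * (E * s) * A = 16 * (E ^ 2 * M) := by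
      rw [show 8 * b ^ 4 * (E * s) * A = 8 * (b ^ 4 * A) * (E * s) by ring, hE,
        show 8 * (E * s) * (E * s) = 8 * E ^ 2 * s ^ 2 by ring, hsM]
      ring
    have h2 : b ^ 4 * (E * s) * q ^ 2 ≤ b ^ 2 * (E * (2 * w)) * q ^ 2 := by gcongr
    linarith
  have p1 : 0 ≤ b ^ 2 * E * (1 / M) := by positivity
  have p2 : 0 ≤ b ^ 2 * E * (1 / w) := by positivity
  have p3 : 0 ≤ b ^ 2 * E * q := by positivity
  have p4 : 0 ≤ b ^ 2 * E * (w * q ^ 2) := by positivity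
  have p5 : 0 ≤ b ^ 2 * E * q ^ 2 := by positivity
  have p6 : 0 ≤ b ^ 2 * E * (M * q ^ 4) := by positivity
  have p7 : 0 ≤ E * f * (b * g) := by positivity
  have p8 : 0 ≤ E * f * (b ^ 2 * x) := by positivity
  have p9 : 0 ≤ E ^ 2 * M := by positivity
  linarith

/-- The vanishing term in the bounds for the two parts of the variance. -/
noncomputable def vanishingRate (α : ℝ) (m : ℕ) : ℝ :=
  1000 * (1 / m + 1 / √m + (m : ℝ) ^ (-α) + ((m : ℝ) ^ (-α)) ^ 2 + √m * ((m : ℝ) ^ (-α)) ^ 2 +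
    m * ((m : ℝ) ^ (-α)) ^ 4)

/-- The condition `α > 1/4` is what the last two summands need: they are `m^{-(2α - 1/2)}` and
`m^{-(4α - 1)}`. -/
lemma tendsto_vanishingRate {α : ℝ} (hα : 1 / 4 < α) :
    Tendsto (vanishingRate α) atTop (𝓝 0) := by
  have hneg : ∀ {e : ℝ}, 0 < e → Tendsto (fun m : ℕ => (m : ℝ) ^ (-e)) atTop (𝓝 0) :=
    fun he => (tendsto_rpow_neg_atTop he).comp tendsto_natCast_atTop_atTop
  have h1 := hneg (e := 1) one_pos
  have h2 := hneg (e := 1 / 2) (by norm_num)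
  have h3 := hneg (e := α) (by linarith)
  have h5 := hneg (e := 2 * α - 1 / 2) (by linarith)
  have h6 := hneg (e := 4 * α - 1) (by linarith)
  have h := (((((h1.add h2).add h3).add (h3.pow 2)).add h5).add h6).const_mul 1000
  simp only [add_zero, mul_zero, ne_eq, OfNat.ofNat_ne_zero, not_false_eq_true, zero_pow] at h
  refine h.congr' ?_
  filter_upwards [eventually_ge_atTop 1] with m hm
  have hm0 : (0 : ℝ) < m := by exact_mod_cast hm
  have e1 : (m : ℝ) ^ (-1 : ℝ) = 1 / m := by rw [Real.rpow_neg_one, one_div]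
  have e2 : (m : ℝ) ^ (-(1 / 2) : ℝ) = 1 / √m := by
    rw [Real.rpow_neg hm0.le, ← Real.sqrt_eq_rpow, one_div]
  have e5 : (m : ℝ) ^ (-(2 * α - 1 / 2)) = √m * ((m : ℝ) ^ (-α)) ^ 2 := by
    rw [Real.sqrt_eq_rpow, ← Real.rpow_natCast ((m : ℝ) ^ (-α)), ← Real.rpow_mul hm0.le,
      ← Real.rpow_add hm0]
    congr 1
    push_cast
    ring
  have e6 : (m : ℝ) ^ (-(4 * α - 1)) = m * ((m : ℝ) ^ (-α)) ^ 4 := by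
    rw [← Real.rpow_natCast ((m : ℝ) ^ (-α)), ← Real.rpow_mul hm0.le]
    nth_rewrite 2 [← Real.rpow_one (m : ℝ)]
    rw [← Real.rpow_add hm0]
    congr 1
    push_cast
    ring
  rw [vanishingRate, e1, e2, e5, e6]

/-- The inequalities hold for every `α > 0`; only the decay of `vanishingRate` requires `α > 1/4`.
-/
lemma R₁_le_and_R₂_le {α : ℝ} (hα : 0 < α) {n p m : ℕ} {a : unitInterval}
    {S : Matrix (Fin p) (Fin p) ℝ} (hn : 2 ≤ n) (hm1 : 1 ≤ m) (hm : m < p)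
    (hS : S ∈ toeplitzClass α p) :
    R₁ m a S ≤ ((p : ℝ) - m) ^ 2 * ((a : ℝ) ^ 4 * (1 + vanishingRate α m) +
        meanA n p m a S *
          (1000 * (a : ℝ) ^ 2 * (m : ℝ) + 1000 * (a : ℝ) ^ 3 * (m : ℝ) ^ (3 / 2 - 2 * α)) +
        meanA n p m a S ^ 2 * (1000 * (m : ℝ) ^ 2)) ∧
      R₂ m a S ≤ ((p : ℝ) - m) * ((a : ℝ) ^ 2 * meanA n p m a S * vanishingRate α m +
        meanA n p m a S ^ (3 / 2 : ℝ) *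
          (1000 * (a : ℝ) * (m : ℝ) ^ (1 / 4 : ℝ) + 1000 * (a : ℝ) ^ 2 * (m : ℝ) ^ (3 / 4 - α)) +
        meanA n p m a S ^ 2 * (1000 * (m : ℝ))) := by
  obtain ⟨hpd, hT, h1, hsum⟩ := hS
  have hps := hpd.posSemidef
  have ha0 : (0 : ℝ) ≤ a := a.2.1
  have ha1 : (a : ℝ) ≤ 1 := a.2.2
  have hM1 : (1 : ℝ) ≤ m := by exact_mod_cast hm1
  have hM0 : (0 : ℝ) < m := by linarith
  have hT0 : (0 : ℝ) ≤ (p : ℝ) - m := sub_nonneg.2 (by exact_mod_cast hm.le)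
  obtain ⟨hB1, hBA⟩ := sum_Ico_sq_le hα hm1 hm hsum
  have hA0 := lowEnergy_nonneg (m := m) (S := S)
  have hB0 := energy_nonneg (S := S)
  have hA1 : lowEnergy m S ≤ 1 := (lowEnergy_le_energy hm).trans hB1
  have hE := meanA_eq (a := a) hps hT hn hm
  set E := meanA n p m a S
  have hs : 0 < √(2 * (m : ℝ)) := Real.sqrt_pos.2 (by positivity)
  have hE0 : 0 ≤ E := by rw [hE]; positivity
  have hEs : (a : ℝ) ^ 4 * lowEnergy m S = E * √(2 * (m : ℝ)) := by
    rw [hE]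
    field_simp
  have hq : 0 ≤ (m : ℝ) ^ (-α) := by positivity
  have hw : 1 ≤ √(m : ℝ) := Real.one_le_sqrt.2 hM1
  have hw2 : √(m : ℝ) ^ 2 = m := Real.sq_sqrt hM0.le
  have hs2 : √(2 * (m : ℝ)) ^ 2 = 2 * m := Real.sq_sqrt (by positivity)
  constructor
  · refine (R₁_le hps hT h1 hm1 hm hB1).trans (mul_le_mul_of_nonneg_left ?_ (sq_nonneg _))
    exact remainder_one_bound ha0 ha1 hA0 hB0 hBA hw hw2 hs2 hs hq hEs hE0 (by positivity)
  · refine (R₂_le hps hT h1 hm1 hm hA1).trans (mul_le_mul_of_nonneg_left ?_ hT0)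
    have e1 : E ^ (3 / 2 : ℝ) = E * √E := by
      rw [show (3 / 2 : ℝ) = 1 + 1 / 2 by norm_num, Real.rpow_add_of_nonneg hE0 zero_le_one
        (by norm_num), Real.rpow_one, Real.sqrt_eq_rpow]
    have e2 : ((m : ℝ) ^ (1 / 4 : ℝ)) ^ 2 = √m := by
      rw [← Real.rpow_natCast, ← Real.rpow_mul hM0.le, Real.sqrt_eq_rpow]
      norm_num
    rw [e1]
    exact remainder_two_bound ha0 ha1 hA0 hA1 hBA hw hw2 hs2 hs hq hEs hE0 (by positivity)
      (by positivity) e2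

end bounds

/-! ### Fourth moments of Gaussian quadratic forms -/

section chaos

lemma hasAllMoments_eval_gaussian {p : ℕ} (i : Fin p) :
    HasAllMoments (fun x : Fin p → ℝ => x i) (Measure.pi fun _ : Fin p => gaussianReal 0 1) :=
  HasAllMoments.eval (ρ := fun _ : Fin p => gaussianReal 0 1) (h := fun x : ℝ => x) i
    (hasAllMoments_id_gaussianReal 1)

/-- Adding an independent standard Gaussian variable to a polynomial in Gaussian variables. -/
lemma integral_add_mul_gaussian {F : Type*} [MeasurableSpace F] {ρ : Measure F}
    [IsProbabilityMeasure ρ] {f g : F → ℝ} (hf : HasAllMoments f ρ) (hg : HasAllMoments g ρ) :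
    ∫ z : ℝ × F, (f z.2 + z.1 * g z.2) ^ 2 ∂((gaussianReal 0 1).prod ρ) =
        ∫ y, f y ^ 2 ∂ρ + ∫ y, g y ^ 2 ∂ρ ∧
      ∫ z : ℝ × F, (f z.2 + z.1 * g z.2) ^ 4 ∂((gaussianReal 0 1).prod ρ) =
        ∫ y, f y ^ 4 ∂ρ + 6 * ∫ y, f y ^ 2 * g y ^ 2 ∂ρ + 3 * ∫ y, g y ^ 4 ∂ρ := by
  have hx := hasAllMoments_id_gaussianReal 1
  have i1 : ∫ x : ℝ, x ∂(gaussianReal 0 1) = 0 := integral_id_gaussianReal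
  have i2 : ∫ x : ℝ, x ^ 2 ∂(gaussianReal 0 1) = 1 := by simpa using integral_sq_gaussianReal 1
  have i3 : ∫ x : ℝ, x ^ 3 ∂(gaussianReal 0 1) = 0 := (integral_pow_three_four_gaussianReal 1).1
  have i4 : ∫ x : ℝ, x ^ 4 ∂(gaussianReal 0 1) = 3 := by
    simpa using (integral_pow_three_four_gaussianReal 1).2
  constructor
  · have e : ∀ z : ℝ × F, (f z.2 + z.1 * g z.2) ^ 2 =
        f z.2 ^ 2 + 2 * (z.1 * (f z.2 * g z.2)) + z.1 ^ 2 * g z.2 ^ 2 := fun z => by ring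
    simp_rw [e]
    have m0 := (hf.pow 2).snd (μ := gaussianReal 0 1)
    have m1 := (hx.fst.mul (hf.mul hg).snd).const_mul 2
    have m2 := (hx.pow 2).fst.mul (hg.pow 2).snd
    rw [integral_add (m0.add m1).integrable m2.integrable,
      integral_add m0.integrable m1.integrable, integral_const_mul,
      integral_prod_mul (fun x : ℝ => x) (fun y => f y * g y),
      integral_prod_mul (fun x : ℝ => x ^ 2) (fun y => g y ^ 2),
      integral_fun_snd (fun y => f y ^ 2), i1, i2]
    simp
  · have e : ∀ z : ℝ × F, (f z.2 + z.1 * g z.2) ^ 4 =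
        f z.2 ^ 4 + 4 * (z.1 * (f z.2 ^ 3 * g z.2)) + 6 * (z.1 ^ 2 * (f z.2 ^ 2 * g z.2 ^ 2)) +
          4 * (z.1 ^ 3 * (f z.2 * g z.2 ^ 3)) + z.1 ^ 4 * g z.2 ^ 4 := fun z => by ring
    simp_rw [e]
    have m0 := (hf.pow 4).snd (μ := gaussianReal 0 1)
    have m1 := (hx.fst.mul ((hf.pow 3).mul hg).snd).const_mul 4
    have m2 := ((hx.pow 2).fst.mul ((hf.pow 2).mul (hg.pow 2)).snd).const_mul 6
    have m3 := ((hx.pow 3).fst.mul (hf.mul (hg.pow 3)).snd).const_mul 4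
    have m4 := (hx.pow 4).fst.mul (hg.pow 4).snd
    rw [integral_add (((m0.add m1).add m2).add m3).integrable m4.integrable,
      integral_add ((m0.add m1).add m2).integrable m3.integrable,
      integral_add (m0.add m1).integrable m2.integrable,
      integral_add m0.integrable m1.integrable,
      integral_const_mul, integral_const_mul, integral_const_mul,
      integral_prod_mul (fun x : ℝ => x) (fun y => f y ^ 3 * g y),
      integral_prod_mul (fun x : ℝ => x ^ 2) (fun y => f y ^ 2 * g y ^ 2),
      integral_prod_mul (fun x : ℝ => x ^ 3) (fun y => f y * g y ^ 3),
      integral_prod_mul (fun x : ℝ => x ^ 4) (fun y => g y ^ 4),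
      integral_fun_snd (fun y => f y ^ 4), i1, i2, i3, i4]
    simp

lemma integral_linear_gaussian {p : ℕ} (b : Fin p → ℝ) :
    ∫ x, (∑ i, b i * x i) ^ 2 ∂(Measure.pi fun _ : Fin p => gaussianReal 0 1) = ∑ i, b i ^ 2 ∧
    ∫ x, (∑ i, b i * x i) ^ 4 ∂(Measure.pi fun _ : Fin p => gaussianReal 0 1) =
      3 * (∑ i, b i ^ 2) ^ 2 := by
  induction p with
  | zero => simp
  | succ p ih =>
    obtain ⟨ih2, ih4⟩ := ih fun i => b i.succ
    have hf : HasAllMoments (fun x : Fin p → ℝ => ∑ i, b i.succ * x i)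
        (Measure.pi fun _ : Fin p => gaussianReal 0 1) :=
      HasAllMoments.sum fun i _ => (hasAllMoments_eval_gaussian i).const_mul _
    have h := integral_add_mul_gaussian hf
      (HasAllMoments.const (μ := Measure.pi fun _ : Fin p => gaussianReal 0 1) (b 0))
    have e : ∀ z : ℝ × (Fin p → ℝ), ∑ i, b i * (Fin.cons z.1 z.2 : Fin (p + 1) → ℝ) i =
        ∑ i, b (Fin.succ i) * z.2 i + z.1 * b 0 := by
      intro z
      simp only [Fin.sum_univ_succ, Fin.cons_zero, Fin.cons_succ]
      ring
    rw [integral_pi_succ, integral_pi_succ]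
    simp_rw [e]
    rw [h.1, h.2, ih2, ih4]
    simp only [integral_mul_const, ih2, integral_const, probReal_univ, one_smul]
    rw [Fin.sum_univ_succ]
    constructor <;> ring

/-- Hypercontractivity for off-diagonal quadratic forms in Gaussian variables. -/
lemma integral_quadratic_pow_four_le {p : ℕ} (M : Fin p → Fin p → ℝ)
    (hM : ∀ i k, i ≤ k → M i k = 0) :
    ∫ x, (∑ i, ∑ k, M i k * (x i * x k)) ^ 4 ∂(Measure.pi fun _ : Fin p => gaussianReal 0 1) ≤
      81 * (∑ i, ∑ k, M i k ^ 2) ^ 2 := by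
  induction p with
  | zero => simp
  | succ p ih =>
    have ih' := ih (fun i k => M i.succ k.succ) fun i k h => hM _ _ (Fin.succ_le_succ_iff.2 h)
    have hx := fun i : Fin p => hasAllMoments_eval_gaussian i
    have hf : HasAllMoments (fun x : Fin p → ℝ => ∑ i : Fin p, ∑ k : Fin p,
        M i.succ k.succ * (x i * x k)) (Measure.pi fun _ : Fin p => gaussianReal 0 1) :=
      HasAllMoments.sum fun i _ => HasAllMoments.sum fun k _ => ((hx i).mul (hx k)).const_mul _
    have hg : HasAllMoments (fun x : Fin p → ℝ => ∑ i : Fin p, M i.succ 0 * x i)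
        (Measure.pi fun _ : Fin p => gaussianReal 0 1) :=
      HasAllMoments.sum fun i _ => (hx i).const_mul _
    -- The matrix is strictly lower triangular, so the first coordinate enters linearly, with a
    -- coefficient that is a linear form in the others.
    have e : ∀ z : ℝ × (Fin p → ℝ), ∑ i, ∑ k, M i k *
        ((Fin.cons z.1 z.2 : Fin (p + 1) → ℝ) i * (Fin.cons z.1 z.2 : Fin (p + 1) → ℝ) k) =
        ∑ i : Fin p, ∑ k : Fin p, M i.succ k.succ * (z.2 i * z.2 k) +
          z.1 * ∑ i : Fin p, M i.succ 0 * z.2 i := by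
      intro z
      simp only [Fin.sum_univ_succ, Fin.cons_zero, Fin.cons_succ]
      rw [hM 0 0 le_rfl, Finset.sum_eq_zero fun k _ => by rw [hM 0 _ (Fin.zero_le _), zero_mul],
        Finset.sum_add_distrib, Finset.mul_sum, zero_mul, zero_add, zero_add, add_comm]
      congr 1
      exact Finset.sum_congr rfl fun i _ => by ring
    have hcs := integral_mul_le_sqrt_mul_sqrt (hf.pow 2) (hg.pow 2)
    rw [integral_pi_succ]
    simp_rw [e]
    rw [(integral_add_mul_gaussian hf hg).2]
    simp_rw [← pow_mul] at hcs
    norm_num only at hcs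
    rw [(integral_linear_gaussian fun i : Fin p => M i.succ 0).2] at hcs ⊢
    set q := ∑ i : Fin p, ∑ k : Fin p, M i.succ k.succ ^ 2 with hq
    set r := ∑ i : Fin p, M i.succ 0 ^ 2 with hr
    have hq0 : 0 ≤ q := Finset.sum_nonneg fun i _ => Finset.sum_nonneg fun k _ => sq_nonneg _
    have hr0 : 0 ≤ r := Finset.sum_nonneg fun i _ => sq_nonneg _
    have hsum : ∑ i, ∑ k, M i k ^ 2 = q + r := by
      simp only [Fin.sum_univ_succ]
      rw [hM 0 0 le_rfl, Finset.sum_eq_zero fun k _ => by rw [hM 0 _ (Fin.zero_le _)]; ring,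
        Finset.sum_add_distrib, hq, hr]
      ring
    rw [hsum]
    have s1 : √(∫ x : Fin p → ℝ, (∑ i : Fin p, ∑ k : Fin p, M i.succ k.succ * (x i * x k)) ^ 4
        ∂(Measure.pi fun _ => gaussianReal 0 1)) ≤ 9 * q := by
      rw [Real.sqrt_le_iff]
      exact ⟨by positivity, ih'.trans (le_of_eq (by ring))⟩
    have s2 : √(3 * r ^ 2) ≤ 2 * r := by
      rw [Real.sqrt_le_iff]
      exact ⟨by positivity, by nlinarith [sq_nonneg r]⟩
    have s3 := hcs.trans (mul_le_mul s1 s2 (Real.sqrt_nonneg _) (by positivity))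
    -- The three contributions are at most `81 q²`, `6 · 9q · 2r = 108 qr` and `9 r²`, within `81 (q
    -- + r)²`.
    nlinarith [mul_nonneg hq0 hr0, sq_nonneg r]

end chaos

/-! ### Lag sums under the null hypothesis -/

section null

variable {p m : ℕ} {a : unitInterval}

/-- A combination of lag sums as a quadratic form. -/
lemma sum_mul_sum_window_eq (c : ℕ → ℝ) (g : Fin p → Fin p → ℝ) :
    ∑ j ∈ Finset.Icc 1 m, c j * ∑ i ∈ window m p, g i (lagIndex i j) =
      ∑ i : Fin p, ∑ k : Fin p,
        if m ≤ (i : ℕ) ∧ k < i ∧ (i : ℕ) ≤ k + m then c (i - k) * g i k else 0 := by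
  simp_rw [Finset.mul_sum]
  rw [Finset.sum_comm, window, Finset.sum_filter]
  refine Finset.sum_congr rfl fun i _ => ?_
  split_ifs with hi
  · rw [← Finset.sum_filter]
    -- For fixed `i ≥ m`, lags `j` in `1, …, m` correspond to positions `k = i - j`.
    refine Finset.sum_bij' (fun j _ => lagIndex i j) (fun k _ => (i : ℕ) - k) ?_ ?_ ?_ ?_ ?_
    · intro j hj
      rw [Finset.mem_Icc] at hj
      simp only [Finset.mem_filter, Finset.mem_univ, true_and, lagIndex, Fin.lt_def]
      omega
    · intro k hk
      simp only [Finset.mem_filter, Finset.mem_univ, true_and, Fin.lt_def] at hk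
      rw [Finset.mem_Icc]
      omega
    · intro j hj
      rw [Finset.mem_Icc] at hj
      simp only [lagIndex]
      omega
    · intro k hk
      simp only [Finset.mem_filter, Finset.mem_univ, true_and, Fin.lt_def] at hk
      apply Fin.ext
      simp only [lagIndex]
      omega
    · intro j hj
      rw [Finset.mem_Icc] at hj
      congr 2
      simp only [lagIndex]
      omega
  · exact (Finset.sum_eq_zero fun k _ => if_neg fun h => hi h.1).symm

/-- The lag sum of the squares of the mask: the conditional variance of the lag sum. -/
def maskEnergy (m j : ℕ) (e : Fin p → ℝ) : ℝ := lagSum m j fun i => e i ^ 2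

lemma maskEnergy_nonneg (j : ℕ) (e : Fin p → ℝ) : 0 ≤ maskEnergy m j e := by
  rw [maskEnergy, lagSum_eq]
  exact Finset.sum_nonneg fun _ _ => mul_nonneg (sq_nonneg _) (sq_nonneg _)

lemma hasAllMoments_maskEnergy (j : ℕ) :
    HasAllMoments (fun e : Fin p → ℝ => maskEnergy m j e) (maskLaw p a) := by
  simp_rw [maskEnergy, lagSum_eq]
  exact HasAllMoments.sum fun i _ => ((hasAllMoments_eval_maskLaw a i).pow 2).mul
    ((hasAllMoments_eval_maskLaw a _).pow 2)

/-- Fourth moments of combinations of lag sums, given the mask. -/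
lemma integral_combination_pow_four_le (c : ℕ → ℝ) (e : Fin p → ℝ) :
    ∫ x, (∑ j ∈ Finset.Icc 1 m, c j * lagSum m j fun i => e i * x i) ^ 4
        ∂(Measure.pi fun _ : Fin p => gaussianReal 0 1) ≤
      81 * (∑ j ∈ Finset.Icc 1 m, c j ^ 2 * maskEnergy m j e) ^ 2 := by
  have h := integral_quadratic_pow_four_le (p := p) (fun i k =>
    if m ≤ (i : ℕ) ∧ k < i ∧ (i : ℕ) ≤ k + m then c (i - k) * (e i * e k) else 0)
    fun i k hik => if_neg fun h => absurd h.2.1 (not_lt.2 hik)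
  have e1 : ∀ x : Fin p → ℝ, ∑ j ∈ Finset.Icc 1 m, c j * lagSum m j (fun i => e i * x i) =
      ∑ i : Fin p, ∑ k : Fin p, (if m ≤ (i : ℕ) ∧ k < i ∧ (i : ℕ) ≤ k + m then
        c (i - k) * (e i * e k) else 0) * (x i * x k) := by
    intro x
    have := sum_mul_sum_window_eq (m := m) c fun i k : Fin p => (e i * x i) * (e k * x k)
    refine this.trans (Finset.sum_congr rfl fun i _ => Finset.sum_congr rfl fun k _ => ?_)
    split_ifs <;> ring
  have e2 : ∑ j ∈ Finset.Icc 1 m, c j ^ 2 * maskEnergy m j e =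
      ∑ i : Fin p, ∑ k : Fin p, (if m ≤ (i : ℕ) ∧ k < i ∧ (i : ℕ) ≤ k + m then
        c (i - k) * (e i * e k) else 0) ^ 2 := by
    have := sum_mul_sum_window_eq (m := m) (fun j => c j ^ 2) fun i k : Fin p => e i ^ 2 * e k ^ 2
    refine this.trans (Finset.sum_congr rfl fun i _ => Finset.sum_congr rfl fun k _ => ?_)
    split_ifs <;> ring
  simp_rw [e1]
  rw [e2]
  exact h

/-- For `Σ = I` the Gaussian vector has independent standard coordinates; the product form makes the
fourth-moment bounds above applicable given the mask. -/
lemma obsLaw_one_eq : obsLaw a (1 : Matrix (Fin p) (Fin p) ℝ) =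
    ((maskLaw p a).prod (Measure.pi fun _ : Fin p => gaussianReal 0 1)).map
      fun z i => z.1 i * z.2 i := by
  rw [obsLaw, multivariateGaussian_zero_one, ← map_pi_eq_stdGaussian, ← maskLaw]
  have h := Measure.map_prod_map (maskLaw p a) (Measure.pi fun _ : Fin p => gaussianReal 0 1)
    (f := id) (g := WithLp.toLp 2) measurable_id (by fun_prop)
  rw [Measure.map_id] at h
  rw [h, Measure.map_map (by fun_prop) (by fun_prop)]
  rfl

/-- Moments under the null hypothesis can be bounded conditionally on the mask. -/
lemma integral_obsLaw_one_le {f : (Fin p → ℝ) → ℝ} (hfm : Measurable f)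
    (hf : Integrable f (obsLaw a 1)) {g : (Fin p → ℝ) → ℝ} (hg : Integrable g (maskLaw p a))
    (h : ∀ e, ∫ x, f (fun i => e i * x i) ∂(Measure.pi fun _ : Fin p => gaussianReal 0 1) ≤ g e) :
    ∫ y, f y ∂(obsLaw a 1) ≤ ∫ e, g e ∂(maskLaw p a) := by
  have hmul : Measurable fun (z : (Fin p → ℝ) × (Fin p → ℝ)) (i : Fin p) => z.1 i * z.2 i := by
    fun_prop
  rw [obsLaw_one_eq] at hf ⊢
  rw [integrable_map_measure hfm.aestronglyMeasurable hmul.aemeasurable] at hf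
  have hf' : Integrable (fun z : (Fin p → ℝ) × (Fin p → ℝ) => f fun i => z.1 i * z.2 i)
      ((maskLaw p a).prod (Measure.pi fun _ : Fin p => gaussianReal 0 1)) := hf
  rw [integral_map hmul.aemeasurable hfm.aestronglyMeasurable, integral_prod _ hf']
  exact integral_mono hf'.integral_prod_left hg h

/-- The second moments of the conditional variances of the lag sums. -/
noncomputable def maskMoment (m p : ℕ) (a : unitInterval) (j j' : ℕ) : ℝ :=
  ∫ e : Fin p → ℝ, maskEnergy m j e * maskEnergy m j' e ∂(maskLaw p a)

lemma measurable_lagSum (j : ℕ) : Measurable fun y : Fin p → ℝ => lagSum m j y := by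
  simp_rw [lagSum_eq]
  fun_prop

lemma integral_combination_obsLaw_le (c : ℕ → ℝ) :
    ∫ y, (∑ j ∈ Finset.Icc 1 m, c j * lagSum m j y) ^ 4
        ∂(obsLaw a (1 : Matrix (Fin p) (Fin p) ℝ)) ≤
      81 * ∑ j ∈ Finset.Icc 1 m, ∑ j' ∈ Finset.Icc 1 m, c j ^ 2 * c j' ^ 2 *
        maskMoment m p a j j' := by
  have hE := fun j => hasAllMoments_maskEnergy (p := p) (m := m) (a := a) j
  have hs : HasAllMoments (fun e : Fin p → ℝ => ∑ j ∈ Finset.Icc 1 m, c j ^ 2 * maskEnergy m j e)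
      (maskLaw p a) := HasAllMoments.sum fun j _ => (hE j).const_mul _
  have hL : HasAllMoments (fun y : Fin p → ℝ => ∑ j ∈ Finset.Icc 1 m, c j * lagSum m j y)
      (obsLaw a 1) := HasAllMoments.sum fun j _ => (hasAllMoments_lagSum m j).const_mul _
  have hms := fun j => measurable_lagSum (p := p) (m := m) j
  refine (integral_obsLaw_one_le (by fun_prop) (hL.pow 4).integrable
    ((hs.pow 2).const_mul 81).integrable (integral_combination_pow_four_le c)).trans (le_of_eq ?_)
  rw [integral_const_mul]
  congr 1
  have h2 : ∀ e : Fin p → ℝ, (∑ j ∈ Finset.Icc 1 m, c j ^ 2 * maskEnergy m j e) ^ 2 =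
      ∑ j ∈ Finset.Icc 1 m, ∑ j' ∈ Finset.Icc 1 m, c j ^ 2 * c j' ^ 2 *
        (maskEnergy m j e * maskEnergy m j' e) := by
    intro e
    rw [sq, Finset.sum_mul_sum]
    exact Finset.sum_congr rfl fun j _ => Finset.sum_congr rfl fun j' _ => by ring
  simp_rw [h2]
  have hp : ∀ j j', HasAllMoments (fun e : Fin p → ℝ => c j ^ 2 * c j' ^ 2 *
      (maskEnergy m j e * maskEnergy m j' e)) (maskLaw p a) :=
    fun j j' => ((hE j).mul (hE j')).const_mul _
  rw [integral_finsetSum _ fun j _ => (HasAllMoments.sum fun j' _ => hp j j').integrable]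
  refine Finset.sum_congr rfl fun j _ => ?_
  rw [integral_finsetSum _ fun j' _ => (hp j j').integrable]
  exact Finset.sum_congr rfl fun j' _ => by rw [integral_const_mul]; rfl

lemma integral_lagSum_pow_four_le {j : ℕ} (hj : j ∈ Finset.Icc 1 m) (e : Fin p → ℝ) :
    ∫ x, (lagSum m j fun i => e i * x i) ^ 4 ∂(Measure.pi fun _ : Fin p => gaussianReal 0 1) ≤
      81 * maskEnergy m j e ^ 2 := by
  have h := integral_combination_pow_four_le (m := m) (fun i => if i = j then 1 else 0) e
  simpa [ite_pow, hj, Finset.mem_Icc.1 hj] using h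

/-- Cauchy–Schwarz is applied conditionally on the mask, so that the product of the two conditional
variances is what gets integrated. -/
lemma integral_lagSum_sq_mul_sq_le {j j' : ℕ} (hj : j ∈ Finset.Icc 1 m)
    (hj' : j' ∈ Finset.Icc 1 m) :
    ∫ y, lagSum m j y ^ 2 * lagSum m j' y ^ 2 ∂(obsLaw a (1 : Matrix (Fin p) (Fin p) ℝ)) ≤
      81 * maskMoment m p a j j' := by
  have hE := fun j => hasAllMoments_maskEnergy (p := p) (m := m) (a := a) j
  have hL := fun j => hasAllMoments_lagSum (a := a) (S := (1 : Matrix (Fin p) (Fin p) ℝ)) m j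
  have hms := fun j => measurable_lagSum (p := p) (m := m) j
  rw [maskMoment, ← integral_const_mul]
  refine integral_obsLaw_one_le (by fun_prop) (((hL j).pow 2).mul ((hL j').pow 2)).integrable
    (((hE j).mul (hE j')).const_mul 81).integrable fun e => ?_
  have hm : ∀ j, HasAllMoments (fun x : Fin p → ℝ => lagSum m j fun i => e i * x i)
      (Measure.pi fun _ : Fin p => gaussianReal 0 1) := fun j =>
    HasAllMoments.sum fun i _ => ((hasAllMoments_eval_gaussian i).const_mul _).mul
      ((hasAllMoments_eval_gaussian _).const_mul _)
  have hcs := integral_mul_le_sqrt_mul_sqrt ((hm j).pow 2) ((hm j').pow 2)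
  simp_rw [← pow_mul] at hcs
  norm_num only at hcs
  have hsq : ∀ j ∈ Finset.Icc 1 m, √(∫ x, (lagSum m j fun i => e i * x i) ^ 4
      ∂(Measure.pi fun _ : Fin p => gaussianReal 0 1)) ≤ 9 * maskEnergy m j e := by
    intro j hj
    rw [Real.sqrt_le_iff]
    exact ⟨mul_nonneg (by norm_num) (maskEnergy_nonneg _ _),
      (integral_lagSum_pow_four_le hj e).trans (le_of_eq (by ring))⟩
  refine hcs.trans ((mul_le_mul (hsq j hj) (hsq j' hj') (Real.sqrt_nonneg _)
    (mul_nonneg (by norm_num) (maskEnergy_nonneg _ _))).trans (le_of_eq (by ring)))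

lemma maskMoment_nonneg (j j' : ℕ) : 0 ≤ maskMoment m p a j j' :=
  integral_nonneg fun _ => mul_nonneg (maskEnergy_nonneg _ _) (maskEnergy_nonneg _ _)

/-- The case analysis of `abs_lagTerm_sub_le` is reused with the all-ones matrix, which is symmetric
and Toeplitz with unit diagonal. Then `lagTerm` equals `3 b^card - b⁴` and all coefficients are at
most `1`, so the claim comes out multiplied by `3`. -/
lemma pow_card_le {b : ℝ} (hb0 : 0 ≤ b) (hb1 : b ≤ 1) {j j' : ℕ} (hj : j ∈ Finset.Icc 1 m)
    (hj' : j' ∈ Finset.Icc 1 m) {i k : Fin p} (hi : i ∈ window m p) (hk : k ∈ window m p) :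
    b ^ ({i, lagIndex i j, k, lagIndex k j'} : Finset (Fin p)).card ≤ b ^ 4 +
      (if i = k then (if j = j' then b ^ 2 else 0) + b ^ 3 else 0) +
      (if (k : ℕ) + j = i + j' then b ^ 3 else 0) + (if (k : ℕ) = i + j' then b ^ 3 else 0) +
      (if (k : ℕ) + j = i then b ^ 3 else 0) := by
  set S : Matrix (Fin p) (Fin p) ℝ := Matrix.of fun _ _ => 1 with hSdef
  have hS : ∀ i k, S i k = 1 := fun i k => rfl
  have h := abs_lagTerm_sub_le (S := S) (by ext i k; simp [S]) (fun _ _ _ _ _ => rfl)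
    (fun i => rfl) hb0 hb1 hj hj' hi hk
  have hd1 : ∀ t, |diagCoeff S t| ≤ 1 := by
    intro t
    rw [diagCoeff]
    split_ifs <;> simp [hS]
  have ho1 : ∀ u, |offCoeff S u| ≤ 1 := by
    intro u
    rw [offCoeff]
    split_ifs
    · simp
    · exact hd1 _
  have hdm : ∀ t ∈ Finset.Icc 1 m, diagCoeff S t = 1 := by
    intro t ht
    rw [Finset.mem_Icc] at ht
    rw [mem_window] at hi
    rw [diagCoeff, dif_pos (by omega)]
    rfl
  have h2 : ∀ u v, |offCoeff S u * offCoeff S v| ≤ 1 := fun u v => by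
    rw [abs_mul]
    exact mul_le_one₀ (ho1 u) (abs_nonneg _) (ho1 v)
  rw [lagTerm, hdm j hj, hdm j' hj', hS, hS, hS, hS] at h
  have b2 : 0 ≤ b ^ 2 := by positivity
  have b3 : 0 ≤ b ^ 3 := by positivity
  have b4 : 0 ≤ b ^ 4 := by positivity
  have q1 := mul_le_mul_of_nonneg_left (ho1 ((j : ℤ) - j')) b3
  have q2 := mul_le_mul_of_nonneg_left (hd1 (j + j')) b3
  have q3 := mul_le_mul_of_nonneg_left (h2 ((i : ℤ) - k) ((i - j : ℤ) + j' - k)) b4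
  have q4 := mul_le_mul_of_nonneg_left (h2 ((i : ℤ) + j' - k) ((i : ℤ) - j - k)) b4
  have h3 := (abs_le.1 h).2
  have e1 : |(1 : ℝ) * 1| = 1 := by norm_num
  rw [e1] at h3
  have cases : ∀ (P : Prop) [Decidable P] (x y : ℝ), x ≤ 3 * y →
      (if P then x else 0) ≤ 3 * (if P then y else 0) := by
    intro P _ x y hxy
    split_ifs
    · exact hxy
    · simp
  have c1 := cases ((k : ℕ) + j = i + j') (b ^ 3 * (|offCoeff S ((j : ℤ) - j')| + 2 * 1)) (b ^ 3)
    (by linarith)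
  have c2 := cases ((k : ℕ) = i + j') (b ^ 3 * (|diagCoeff S (j + j')| + 2 * 1)) (b ^ 3)
    (by linarith)
  have c3 := cases ((k : ℕ) + j = i) (b ^ 3 * (|diagCoeff S (j + j')| + 2 * 1)) (b ^ 3)
    (by linarith)
  have c4 : (if i = k then (if j = j' then b ^ 2 else 0) else 0) +
      (if i = k then (if j = j' then 2 * b ^ 2 * 1 ^ 2 else 0) +
        b ^ 3 * (|offCoeff S ((j : ℤ) - j')| + 2 * 1) else 0) ≤
      3 * (if i = k then (if j = j' then b ^ 2 else 0) + b ^ 3 else 0) := by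
    split_ifs <;> linarith
  linarith

/-- Generic pairs of positions have weight `a⁴`; each of the four coincidences contributes at most
`p - m` pairs of weight `a³`, and `i = k` with `j = j'` gives the weight `a²`. -/
lemma maskMoment_le (hm : m < p) {j j' : ℕ} (hj : j ∈ Finset.Icc 1 m)
    (hj' : j' ∈ Finset.Icc 1 m) :
    maskMoment m p a j j' ≤ ((p : ℝ) - m) ^ 2 * (a : ℝ) ^ 4 + 4 * ((p : ℝ) - m) * (a : ℝ) ^ 3 +
      (if j = j' then ((p : ℝ) - m) * (a : ℝ) ^ 2 else 0) := by
  have ha0 : (0 : ℝ) ≤ a := a.2.1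
  have ha1 : (a : ℝ) ≤ 1 := a.2.2
  have he := fun i : Fin p => (hasAllMoments_eval_maskLaw a i).pow 2
  have h4 : ∀ i k : Fin p, HasAllMoments (fun e : Fin p → ℝ =>
      e i ^ 2 * e (lagIndex i j) ^ 2 * e k ^ 2 * e (lagIndex k j') ^ 2) (maskLaw p a) :=
    fun i k => (((he i).mul (he _)).mul (he k)).mul (he _)
  have e1 : ∀ e : Fin p → ℝ, maskEnergy m j e * maskEnergy m j' e =
      ∑ i ∈ window m p, ∑ k ∈ window m p,
        e i ^ 2 * e (lagIndex i j) ^ 2 * e k ^ 2 * e (lagIndex k j') ^ 2 := by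
    intro e
    rw [maskEnergy, maskEnergy, lagSum_eq, lagSum_eq, Finset.sum_mul_sum]
    exact Finset.sum_congr rfl fun i _ => Finset.sum_congr rfl fun k _ => by ring
  rw [maskMoment]
  simp_rw [e1]
  rw [integral_finsetSum _ fun i _ => (HasAllMoments.sum fun k _ => h4 i k).integrable]
  have hrow : ∀ i ∈ window m p, ∫ e, ∑ k ∈ window m p,
      e i ^ 2 * e (lagIndex i j) ^ 2 * e k ^ 2 * e (lagIndex k j') ^ 2 ∂(maskLaw p a) ≤
      ((p : ℝ) - m) * (a : ℝ) ^ 4 + 4 * (a : ℝ) ^ 3 + (if j = j' then (a : ℝ) ^ 2 else 0) := by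
    intro i hi
    rw [integral_finsetSum _ fun k _ => (h4 i k).integrable]
    simp_rw [integral_mul_four_maskLaw a _ _ _ _ two_ne_zero]
    refine (Finset.sum_le_sum fun k hk => pow_card_le ha0 ha1 hj hj' hi hk).trans ?_
    simp only [Finset.sum_add_distrib, Finset.sum_const, nsmul_eq_mul, card_window hm]
    have a3 : 0 ≤ (a : ℝ) ^ 3 := by positivity
    have s1 := sum_ite_le_of_subsingleton (window m p) (fun k => i = k)
      (fun k _ k' _ h h' => h.symm.trans h')
      (c := (if j = j' then (a : ℝ) ^ 2 else 0) + (a : ℝ) ^ 3) (by positivity)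
    have s2 := sum_ite_le_of_subsingleton (window m p) (fun k => (k : ℕ) + j = i + j')
      (fun k _ k' _ h h' => Fin.ext (by omega)) a3
    have s3 := sum_ite_le_of_subsingleton (window m p) (fun k => (k : ℕ) = i + j')
      (fun k _ k' _ h h' => Fin.ext (by omega)) a3
    have s4 := sum_ite_le_of_subsingleton (window m p) (fun k => (k : ℕ) + j = i)
      (fun k _ k' _ h h' => Fin.ext (by omega)) a3
    linarith
  refine (Finset.sum_le_sum hrow).trans (le_of_eq ?_)
  rw [Finset.sum_const, nsmul_eq_mul, card_window hm]
  split_ifs <;> ring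

/-- The lag sums under the null hypothesis are centered and uncorrelated. -/
lemma isIsotropic_lagSum (hm : m < p) :
    IsIsotropic (Finset.Icc 1 m) (fun j (y : Fin p → ℝ) => lagSum m j y)
      (((p : ℝ) - m) * (a : ℝ) ^ 2) (obsLaw a 1) := by
  have hT : IsToeplitz (1 : Matrix (Fin p) (Fin p) ℝ) := isToeplitz_one
  have h0 : ∀ j ∈ Finset.Icc 1 m, ∫ y, lagSum m j y ∂(obsLaw a (1 : Matrix (Fin p) (Fin p) ℝ)) = 0 := by
    intro j hj
    rw [integral_lagSum Matrix.PosSemidef.one hT hm hj,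
      diagCoeff_one (by rw [Finset.mem_Icc] at hj; omega)]
    ring
  refine ⟨fun j => hasAllMoments_lagSum m j, h0, fun i hi j hj => ?_⟩
  rw [← lagCov_one hm hi hj, lagCov, covariance, h0 i hi, h0 j hj]
  simp

/-- Moments of the squared norm of the vector of lag sums. -/
lemma integral_normSq_sq_le (hm : m < p) :
    ∫ y, (∑ j ∈ Finset.Icc 1 m, lagSum m j y ^ 2) ^ 2
        ∂(obsLaw a (1 : Matrix (Fin p) (Fin p) ℝ)) ≤
      81 * ((m : ℝ) ^ 2 * (((p : ℝ) - m) ^ 2 * (a : ℝ) ^ 4 + 4 * ((p : ℝ) - m) * (a : ℝ) ^ 3) +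
        m * (((p : ℝ) - m) * (a : ℝ) ^ 2)) := by
  have hL := fun j => hasAllMoments_lagSum (a := a) (S := (1 : Matrix (Fin p) (Fin p) ℝ)) m j
  have e : ∀ y : Fin p → ℝ, (∑ j ∈ Finset.Icc 1 m, lagSum m j y ^ 2) ^ 2 =
      ∑ j ∈ Finset.Icc 1 m, ∑ j' ∈ Finset.Icc 1 m, lagSum m j y ^ 2 * lagSum m j' y ^ 2 := by
    intro y
    rw [sq, Finset.sum_mul_sum]
  simp_rw [e]
  rw [integral_finsetSum _ fun j _ =>
    (HasAllMoments.sum fun j' _ => ((hL j).pow 2).mul ((hL j').pow 2)).integrable]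
  have hrow : ∀ j ∈ Finset.Icc 1 m, ∫ y, ∑ j' ∈ Finset.Icc 1 m,
      lagSum m j y ^ 2 * lagSum m j' y ^ 2 ∂(obsLaw a (1 : Matrix (Fin p) (Fin p) ℝ)) ≤
      81 * (m * (((p : ℝ) - m) ^ 2 * (a : ℝ) ^ 4 + 4 * ((p : ℝ) - m) * (a : ℝ) ^ 3) +
        ((p : ℝ) - m) * (a : ℝ) ^ 2) := by
    intro j hj
    rw [integral_finsetSum _ fun j' _ => (((hL j).pow 2).mul ((hL j').pow 2)).integrable]
    refine (Finset.sum_le_sum fun j' hj' => (integral_lagSum_sq_mul_sq_le hj hj').trans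
      (mul_le_mul_of_nonneg_left (maskMoment_le hm hj hj') (by norm_num))).trans (le_of_eq ?_)
    rw [← Finset.mul_sum, Finset.sum_add_distrib, Finset.sum_ite_eq, if_pos hj]
    simp
    ring
  refine (Finset.sum_le_sum hrow).trans (le_of_eq ?_)
  simp
  ring

/-- Fourth moment of the kernel of the U-statistic. -/
lemma integral_kernel_pow_four_le (hm : m < p) :
    ∫ z : (Fin p → ℝ) × (Fin p → ℝ), (∑ j ∈ Finset.Icc 1 m, lagSum m j z.1 * lagSum m j z.2) ^ 4
        ∂((obsLaw a (1 : Matrix (Fin p) (Fin p) ℝ)).prod (obsLaw a 1)) ≤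
      3 * 81 ^ 2 * ((m : ℝ) ^ 2 * (((p : ℝ) - m) ^ 4 * (a : ℝ) ^ 8 +
        16 * ((p : ℝ) - m) ^ 2 * (a : ℝ) ^ 6) + m * (((p : ℝ) - m) ^ 2 * (a : ℝ) ^ 4)) := by
  have hL := fun j => hasAllMoments_lagSum (a := a) (S := (1 : Matrix (Fin p) (Fin p) ℝ)) m j
  have hH := (hasAllMoments_sum_mul (J := Finset.Icc 1 m) hL hL).pow 4
  have hp : ∀ j j', HasAllMoments (fun y : Fin p → ℝ => lagSum m j y ^ 2 * lagSum m j' y ^ 2 *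
      maskMoment m p a j j') (obsLaw a 1) :=
    fun j j' => (((hL j).pow 2).mul ((hL j').pow 2)).mul_const _
  have hsum := (HasAllMoments.sum (J := Finset.Icc 1 m) fun j _ =>
    HasAllMoments.sum (J := Finset.Icc 1 m) fun j' _ => hp j j').const_mul 81
  rw [integral_prod _ hH.integrable]
  -- For a fixed first observation the kernel is a combination of lag sums of the second one, to
  -- which the hypercontractive bound applies. Integrating the coefficients then yields a second
  -- factor `maskMoment`.
  refine (integral_mono hH.integrable.integral_prod_left hsum.integrable fun y =>
    integral_combination_obsLaw_le fun j => lagSum m j y).trans ?_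
  rw [integral_const_mul, integral_finsetSum _ fun j _ =>
    (HasAllMoments.sum fun j' _ => hp j j').integrable]
  have hT0 : (0 : ℝ) ≤ (p : ℝ) - m := sub_nonneg.2 (by exact_mod_cast hm.le)
  have ha0 : (0 : ℝ) ≤ a := a.2.1
  have hrow : ∀ j ∈ Finset.Icc 1 m, ∫ y, ∑ j' ∈ Finset.Icc 1 m,
      lagSum m j y ^ 2 * lagSum m j' y ^ 2 * maskMoment m p a j j'
        ∂(obsLaw a (1 : Matrix (Fin p) (Fin p) ℝ)) ≤
      3 * 81 * (m * (((p : ℝ) - m) ^ 4 * (a : ℝ) ^ 8 +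
        16 * ((p : ℝ) - m) ^ 2 * (a : ℝ) ^ 6) + ((p : ℝ) - m) ^ 2 * (a : ℝ) ^ 4) := by
    intro j hj
    rw [integral_finsetSum _ fun j' _ => (hp j j').integrable]
    have hterm : ∀ j' ∈ Finset.Icc 1 m, ∫ y, lagSum m j y ^ 2 * lagSum m j' y ^ 2 *
        maskMoment m p a j j' ∂(obsLaw a (1 : Matrix (Fin p) (Fin p) ℝ)) ≤
        3 * 81 * ((((p : ℝ) - m) ^ 4 * (a : ℝ) ^ 8 + 16 * ((p : ℝ) - m) ^ 2 * (a : ℝ) ^ 6) +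
          (if j = j' then ((p : ℝ) - m) ^ 2 * (a : ℝ) ^ 4 else 0)) := by
      intro j' hj'
      rw [integral_mul_const]
      have h0 := maskMoment_nonneg (m := m) (p := p) (a := a) j j'
      have h1 := maskMoment_le (a := a) hm hj hj'
      refine (mul_le_mul_of_nonneg_right (integral_lagSum_sq_mul_sq_le hj hj') h0).trans ?_
      have h2 : maskMoment m p a j j' ^ 2 ≤ (((p : ℝ) - m) ^ 2 * (a : ℝ) ^ 4 +
          4 * ((p : ℝ) - m) * (a : ℝ) ^ 3 +
          (if j = j' then ((p : ℝ) - m) * (a : ℝ) ^ 2 else 0)) ^ 2 := pow_le_pow_left₀ h0 h1 2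
      have three : ∀ x y z : ℝ, (x + y + z) ^ 2 ≤ 3 * (x ^ 2 + y ^ 2 + z ^ 2) := fun x y z => by
        nlinarith [sq_nonneg (x - y), sq_nonneg (x - z), sq_nonneg (y - z)]
      have h3 := h2.trans (three _ _ _)
      have e : 81 * maskMoment m p a j j' * maskMoment m p a j j' =
          81 * maskMoment m p a j j' ^ 2 := by ring
      rw [e]
      refine (mul_le_mul_of_nonneg_left h3 (by norm_num)).trans (le_of_eq ?_)
      split_ifs <;> ring
    refine (Finset.sum_le_sum hterm).trans (le_of_eq ?_)
    rw [← Finset.mul_sum, Finset.sum_add_distrib, Finset.sum_ite_eq, if_pos hj]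
    simp
    ring
  refine (mul_le_mul_of_nonneg_left (Finset.sum_le_sum hrow) (by norm_num)).trans (le_of_eq ?_)
  simp
  ring

end null

/-! ### Asymptotic normality under the null hypothesis -/

section normality

/-- The error in the Gaussian approximation, in terms of normalized moments. -/
lemma clt_error_le {N M v s η K K2 K4 k2 k4 : ℝ} (hN : 0 < N) (hM : 0 < M) (hv : 0 ≤ v)
    (hη : 0 < η) (hk2 : 0 ≤ k2) (hk4 : 0 ≤ k4) (hK2 : K2 ≤ k2 * (N * M ^ 2 * v ^ 2))
    (hK4 : K4 ≤ k4 * (N ^ 2 * M ^ 2 * v ^ 4)) (hK : s ^ 2 * v ^ 2 * M * N ^ 2 ≤ K) :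
    N * (2 * η * (s ^ 2 * (N * M * v ^ 2)) +
      2 / η * (s ^ 4 * (N * K4 + 3 * N ^ 2 * v ^ 2 * K2)) +
      s ^ 2 * v / 2 * √(N * K2 + 2 * N ^ 2 * M * v ^ 2) + (s ^ 2 * v ^ 2 * M * N / 2) ^ 2) ≤
    2 * η * K + 2 / η * (K ^ 2 * (k4 + 3 * k2)) + K / 2 * √(k2 + 2 * (1 / M)) +
      K ^ 2 / 4 * (1 / N) := by
  -- This is the order of the variance of `s` times the U-statistic. Each of the four error terms is
  -- a power of it times a normalized moment.
  set κ := s ^ 2 * v ^ 2 * M * N ^ 2 with hκ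
  have hκ0 : 0 ≤ κ := by positivity
  have hκ2 : κ ^ 2 ≤ K ^ 2 := pow_le_pow_left₀ hκ0 hK 2
  have hA : N * (2 * η * (s ^ 2 * (N * M * v ^ 2))) ≤ 2 * η * K := by
    have e : N * (2 * η * (s ^ 2 * (N * M * v ^ 2))) = 2 * η * κ := by rw [hκ]; ring
    rw [e]
    exact mul_le_mul_of_nonneg_left hK (by positivity)
  have hB : N * (2 / η * (s ^ 4 * (N * K4 + 3 * N ^ 2 * v ^ 2 * K2))) ≤
      2 / η * (K ^ 2 * (k4 + 3 * k2)) := by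
    have h1 : N * K4 + 3 * N ^ 2 * v ^ 2 * K2 ≤ N ^ 3 * M ^ 2 * v ^ 4 * (k4 + 3 * k2) := by
      have h2 := mul_le_mul_of_nonneg_left hK4 hN.le
      have h3 := mul_le_mul_of_nonneg_left hK2 (by positivity : 0 ≤ 3 * N ^ 2 * v ^ 2)
      linarith
    calc N * (2 / η * (s ^ 4 * (N * K4 + 3 * N ^ 2 * v ^ 2 * K2)))
        ≤ N * (2 / η * (s ^ 4 * (N ^ 3 * M ^ 2 * v ^ 4 * (k4 + 3 * k2)))) := by gcongr
      _ = 2 / η * (κ ^ 2 * (k4 + 3 * k2)) := by rw [hκ]; ring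
      _ ≤ _ := by gcongr
  have hC : N * (s ^ 2 * v / 2 * √(N * K2 + 2 * N ^ 2 * M * v ^ 2)) ≤
      K / 2 * √(k2 + 2 * (1 / M)) := by
    have h1 : N * K2 + 2 * N ^ 2 * M * v ^ 2 ≤ (N * M * v) ^ 2 * (k2 + 2 * (1 / M)) := by
      have e : (N * M * v) ^ 2 * (k2 + 2 * (1 / M)) =
          N * (k2 * (N * M ^ 2 * v ^ 2)) + 2 * N ^ 2 * M * v ^ 2 := by field_simp
      rw [e]
      linarith [mul_le_mul_of_nonneg_left hK2 hN.le]
    have h2 : √(N * K2 + 2 * N ^ 2 * M * v ^ 2) ≤ N * M * v * √(k2 + 2 * (1 / M)) := by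
      refine (Real.sqrt_le_sqrt h1).trans (le_of_eq ?_)
      rw [Real.sqrt_mul (sq_nonneg _), Real.sqrt_sq (by positivity)]
    calc N * (s ^ 2 * v / 2 * √(N * K2 + 2 * N ^ 2 * M * v ^ 2))
        ≤ N * (s ^ 2 * v / 2 * (N * M * v * √(k2 + 2 * (1 / M)))) := by gcongr
      _ = κ / 2 * √(k2 + 2 * (1 / M)) := by rw [hκ]; ring
      _ ≤ _ := by gcongr
  have hD : N * (s ^ 2 * v ^ 2 * M * N / 2) ^ 2 ≤ K ^ 2 / 4 * (1 / N) := by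
    have e : N * (s ^ 2 * v ^ 2 * M * N / 2) ^ 2 = κ ^ 2 / 4 * (1 / N) := by
      rw [hκ]; field_simp; ring
    rw [e]
    gcongr
  linarith

variable {n p m : ℕ} {a : unitInterval}

/-- The statistic, normalized under the null hypothesis. -/
noncomputable def normalizedAhat (n p m : ℕ) (a : unitInterval) (Y : Fin n → Fin p → ℝ) : ℝ :=
  (n : ℝ) * ((p : ℝ) - m) / (a : ℝ) ^ 2 * Ahat n p m Y

lemma aemeasurable_normalizedAhat (S : Matrix (Fin p) (Fin p) ℝ) :
    AEMeasurable (normalizedAhat n p m a) (sampleLaw n a S) :=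
  (hasAllMoments_Ahat.integrable.aemeasurable).const_mul _

/-- The scale of the U-statistic in the normalized statistic. -/
noncomputable def ustatScale (n p m : ℕ) (a : unitInterval) : ℝ :=
  2 / (((n : ℝ) - 1) * (((p : ℝ) - m) * (a : ℝ) ^ 2) * √(2 * (m : ℝ)))

lemma normalizedAhat_eq (hn : 2 ≤ n) (hm1 : 1 ≤ m) (hm : m < p) (ha : (0 : ℝ) < a)
    (Y : Fin n → Fin p → ℝ) : normalizedAhat n p m a Y =
      ustatScale n p m a * ustat (Finset.Icc 1 m) (fun j y => lagSum m j y) Y := by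
  have hT : (0 : ℝ) < (p : ℝ) - m := sub_pos.2 (by exact_mod_cast hm)
  have hn1 : (0 : ℝ) < (n : ℝ) - 1 := sub_pos.2 (by exact_mod_cast hn)
  have hn0 : (0 : ℝ) < (n : ℝ) := by linarith
  have hm0 : (0 : ℝ) < √(2 * (m : ℝ)) := by
    have : (0 : ℝ) < m := by exact_mod_cast hm1
    positivity
  rw [normalizedAhat, Ahat_eq_ustat, ustatScale, ← mul_assoc]
  congr 1
  field_simp

lemma ustatScale_sq (hn : 2 ≤ n) (hm1 : 1 ≤ m) (hm : m < p) (ha : (0 : ℝ) < a) :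
    ustatScale n p m a ^ 2 * (((p : ℝ) - m) * (a : ℝ) ^ 2) ^ 2 * m = 2 / ((n : ℝ) - 1) ^ 2 := by
  have hT : (0 : ℝ) < (p : ℝ) - m := sub_pos.2 (by exact_mod_cast hm)
  have hn1 : (0 : ℝ) < (n : ℝ) - 1 := sub_pos.2 (by exact_mod_cast hn)
  have hm0 : (0 : ℝ) < m := by exact_mod_cast hm1
  rw [ustatScale, div_pow, mul_pow _ (√(2 * (m : ℝ))), Real.sq_sqrt (by positivity)]
  field_simp

lemma charFun_normalizedAhat (hn : 2 ≤ n) (hm1 : 1 ≤ m) (hm : m < p) (ha : (0 : ℝ) < a) (t : ℝ) :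
    charFun ((sampleLaw n a (1 : Matrix (Fin p) (Fin p) ℝ)).map (normalizedAhat n p m a)) t =
      ustatCF (obsLaw a (1 : Matrix (Fin p) (Fin p) ℝ)) (Finset.Icc 1 m)
        (fun j y => lagSum m j y) (t * ustatScale n p m a) n := by
  rw [charFun_apply_real, integral_map (aemeasurable_normalizedAhat 1)
    (by fun_prop), ustatCF, sampleLaw]
  refine integral_congr_ae (.of_forall fun Y => ?_)
  simp only [normalizedAhat_eq hn hm1 hm ha]
  push_cast
  ring_nf

/-- The error bound for the characteristic function of the normalized statistic, in terms of
`x = 1 / n`, `y = 1 / (a² n (p - m))` and `z = 1 / m`. -/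
noncomputable def charFunError (K η x y z : ℝ) : ℝ :=
  2 * η * K + 2 / η * (K ^ 2 * (3 * 81 ^ 2 * (x ^ 2 + 17 * y ^ 2) + 3 * (81 * (x + 5 * y)))) +
    K / 2 * √(81 * (x + 5 * y) + 2 * z) + K ^ 2 / 4 * x

/-- The lower-order terms are absorbed using `b³ ≤ b²` and `M ≤ M²`, whence `5 = 4 + 1`; in the same
way `17 = 16 + 1` in the bound for the kernel. -/
lemma normSq_bound_le {N M T b : ℝ} (hN : 0 < N) (hM : 1 ≤ M) (hT : 0 < T) (hb : 0 < b)
    (hb1 : b ≤ 1) : M ^ 2 * (T ^ 2 * b ^ 4 + 4 * T * b ^ 3) + M * (T * b ^ 2) ≤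
      (1 / N + 5 * (1 / (b ^ 2 * N * T))) * (N * M ^ 2 * (T * b ^ 2) ^ 2) := by
  have e : (1 / N + 5 * (1 / (b ^ 2 * N * T))) * (N * M ^ 2 * (T * b ^ 2) ^ 2) =
      M ^ 2 * (T ^ 2 * b ^ 4 + 5 * T * b ^ 2) := by
    field_simp
  rw [e]
  have h3 : b ^ 3 ≤ b ^ 2 := pow_le_pow_of_le_one hb.le hb1 (by norm_num)
  have h4 : M ≤ M ^ 2 := by nlinarith
  have h5 := mul_le_mul_of_nonneg_right h4 (by positivity : 0 ≤ T * b ^ 2)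
  have h6 := mul_le_mul_of_nonneg_left h3 (by positivity : 0 ≤ M ^ 2 * (4 * T))
  linarith

lemma kernel_bound_le {N M T b : ℝ} (hN : 0 < N) (hM : 1 ≤ M) (hT : 0 < T) (hb : 0 < b)
    (hb1 : b ≤ 1) :
    M ^ 2 * (T ^ 4 * b ^ 8 + 16 * T ^ 2 * b ^ 6) + M * (T ^ 2 * b ^ 4) ≤
      ((1 / N) ^ 2 + 17 * (1 / (b ^ 2 * N * T)) ^ 2) * (N ^ 2 * M ^ 2 * (T * b ^ 2) ^ 4) := by
  have e : ((1 / N) ^ 2 + 17 * (1 / (b ^ 2 * N * T)) ^ 2) * (N ^ 2 * M ^ 2 * (T * b ^ 2) ^ 4) =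
      M ^ 2 * (T ^ 4 * b ^ 8 + 17 * T ^ 2 * b ^ 4) := by
    field_simp
  rw [e]
  have h3 : b ^ 6 ≤ b ^ 4 := pow_le_pow_of_le_one hb.le hb1 (by norm_num)
  have h4 : M ≤ M ^ 2 := by nlinarith
  have h5 := mul_le_mul_of_nonneg_right h4 (by positivity : 0 ≤ T ^ 2 * b ^ 4)
  have h6 := mul_le_mul_of_nonneg_left h3 (by positivity : 0 ≤ M ^ 2 * (16 * T ^ 2))
  linarith

lemma norm_charFun_normalizedAhat_sub_le (hn : 2 ≤ n) (hm1 : 1 ≤ m) (hm : m < p)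
    (ha : (0 : ℝ) < a) (t : ℝ) {η : ℝ} (hη : 0 < η) :
    ‖charFun ((sampleLaw n a (1 : Matrix (Fin p) (Fin p) ℝ)).map (normalizedAhat n p m a)) t -
        (Real.exp (-(t ^ 2 / 2 * ((n : ℝ) / ((n : ℝ) - 1)))) : ℝ)‖ ≤
      charFunError (8 * t ^ 2) η (1 / n) (1 / ((a : ℝ) ^ 2 * n * ((p : ℝ) - m))) (1 / m) := by
  have hT : (0 : ℝ) < (p : ℝ) - m := sub_pos.2 (by exact_mod_cast hm)
  have hn2 : (2 : ℝ) ≤ n := by exact_mod_cast hn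
  have hn1 : (0 : ℝ) < (n : ℝ) - 1 := by linarith
  have hn0 : (0 : ℝ) < (n : ℝ) := by linarith
  have hm0 : (0 : ℝ) < m := by exact_mod_cast hm1
  have hm1' : (1 : ℝ) ≤ m := by exact_mod_cast hm1
  have ha1 : (a : ℝ) ≤ 1 := a.2.2
  have h := (isIsotropic_lagSum (a := a) hm).norm_ustatCF_sub_exp_le (by positivity)
    (t * ustatScale n p m a) hη n
  have hsq := ustatScale_sq (n := n) (p := p) (m := m) (a := a) hn hm1 hm ha
  rw [← charFun_normalizedAhat hn hm1 hm ha t, Nat.card_Icc, Nat.add_sub_cancel] at h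
  have e : (t * ustatScale n p m a) ^ 2 * (((p : ℝ) - m) * (a : ℝ) ^ 2) ^ 2 * m *
      (n * (n - 1)) / 4 = t ^ 2 / 2 * ((n : ℝ) / ((n : ℝ) - 1)) := by
    have e' : (t * ustatScale n p m a) ^ 2 * (((p : ℝ) - m) * (a : ℝ) ^ 2) ^ 2 * m *
      (n * (n - 1)) / 4 = t ^ 2 * (ustatScale n p m a ^ 2 * (((p : ℝ) - m) * (a : ℝ) ^ 2) ^ 2 * m) *
      (n * (n - 1)) / 4 := by ring
    rw [e', hsq]
    field_simp
    norm_num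
  rw [e] at h
  have hK : (t * ustatScale n p m a) ^ 2 * (((p : ℝ) - m) * (a : ℝ) ^ 2) ^ 2 * m * (n : ℝ) ^ 2 ≤
      8 * t ^ 2 := by
    have e' : (t * ustatScale n p m a) ^ 2 * (((p : ℝ) - m) * (a : ℝ) ^ 2) ^ 2 * m * (n : ℝ) ^ 2 =
      t ^ 2 * (ustatScale n p m a ^ 2 * (((p : ℝ) - m) * (a : ℝ) ^ 2) ^ 2 * m) * (n : ℝ) ^ 2 := by
      ring
    -- As `n ≥ 2`, `n ≤ 2 (n - 1)`, and `2 t² n² / (n - 1)²` is at most `8 t²`.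
    have h4 : (n : ℝ) ^ 2 ≤ 4 * ((n : ℝ) - 1) ^ 2 := by nlinarith
    rw [e', hsq, show t ^ 2 * (2 / ((n : ℝ) - 1) ^ 2) * (n : ℝ) ^ 2 =
      t ^ 2 * 2 * (n : ℝ) ^ 2 / ((n : ℝ) - 1) ^ 2 by ring, div_le_iff₀ (by positivity)]
    nlinarith [mul_le_mul_of_nonneg_left h4 (sq_nonneg t)]
  have hy0 : 0 ≤ 1 / ((a : ℝ) ^ 2 * n * ((p : ℝ) - m)) := by positivity
  have hx0 : 0 ≤ 1 / (n : ℝ) := by positivity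
  refine h.trans (clt_error_le hn0 hm0 (by positivity) hη (by positivity) (by positivity) ?_ ?_ hK)
  · refine (integral_normSq_sq_le hm).trans ?_
    rw [mul_assoc 81]
    exact mul_le_mul_of_nonneg_left (normSq_bound_le hn0 hm1' hT ha ha1) (by norm_num)
  · refine (integral_kernel_pow_four_le hm).trans ?_
    rw [mul_assoc (3 * 81 ^ 2)]
    exact mul_le_mul_of_nonneg_left (kernel_bound_le hn0 hm1' hT ha ha1) (by norm_num)

/-- The error is continuous in `(x, y, z)`; at the origin only the part `2ηK` of the Taylor
remainder survives, and `η` is arbitrary. -/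
lemma tendsto_charFunError (K η : ℝ) {x y z : ℕ → ℝ} (hx : Tendsto x atTop (𝓝 0))
    (hy : Tendsto y atTop (𝓝 0)) (hz : Tendsto z atTop (𝓝 0)) :
    Tendsto (fun t => charFunError K η (x t) (y t) (z t)) atTop (𝓝 (2 * η * K)) := by
  have hc : Continuous fun w : ℝ × ℝ × ℝ => charFunError K η w.1 w.2.1 w.2.2 := by
    unfold charFunError
    fun_prop
  have h := (hc.tendsto (0, 0, 0)).comp (hx.prodMk_nhds (hy.prodMk_nhds hz))
  simpa [charFunError, Function.comp_def] using h

/-- Asymptotic normality of the normalized statistic under the null hypothesis. -/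
lemma tendstoInDistribution_normalizedAhat {n p m : ℕ → ℕ} {a : ℕ → unitInterval}
    (hm : ∀ t, m t < p t) (ha : ∀ t, (0 : ℝ) < a t) (hn : Tendsto n atTop atTop)
    (hmt : Tendsto m atTop atTop)
    (hrate : Tendsto (fun t => (a t : ℝ) ^ 2 * (n t : ℝ) * ((p t : ℝ) - m t)) atTop atTop) :
    TendstoInDistribution (fun t => normalizedAhat (n t) (p t) (m t) (a t)) atTop (id : ℝ → ℝ)
      (fun t => sampleLaw (n t) (a t) (1 : Matrix (Fin (p t)) (Fin (p t)) ℝ))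
      (gaussianReal 0 1) where
  forall_aemeasurable t := aemeasurable_normalizedAhat 1
  aemeasurable_limit := aemeasurable_id
  tendsto := by
    -- Lévy's continuity theorem. The approximating Gaussian has variance `n / (n - 1)`, which tends
    -- to `1`.
    refine ProbabilityMeasure.tendsto_iff_tendsto_charFun.2 fun t => ?_
    simp only [ProbabilityMeasure.coe_mk, Measure.map_id, charFun_gaussianReal]
    have hnR : Tendsto (fun k => (n k : ℝ)) atTop atTop := tendsto_natCast_atTop_atTop.comp hn
    have hx : Tendsto (fun k => 1 / (n k : ℝ)) atTop (𝓝 0) := hnR.const_div_atTop 1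
    have hz : Tendsto (fun k => 1 / (m k : ℝ)) atTop (𝓝 0) :=
      (tendsto_natCast_atTop_atTop.comp hmt).const_div_atTop 1
    have hy := hrate.const_div_atTop 1
    have hquot : Tendsto (fun k => (n k : ℝ) / ((n k : ℝ) - 1)) atTop (𝓝 1) := by
      have h1 : Tendsto (fun k => 1 + 1 / ((n k : ℝ) - 1)) atTop (𝓝 (1 + 0)) :=
        tendsto_const_nhds.add ((tendsto_atTop_add_const_right _ (-1) hnR).const_div_atTop 1)
      rw [add_zero] at h1
      refine h1.congr' ?_
      filter_upwards [hn.eventually_ge_atTop 2] with k hk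
      have : (0 : ℝ) < (n k : ℝ) - 1 := sub_pos.2 (by exact_mod_cast hk)
      field_simp
      ring
    have hexp : Tendsto (fun k => ((Real.exp (-(t ^ 2 / 2 * ((n k : ℝ) / ((n k : ℝ) - 1)))) : ℝ) :
        ℂ)) atTop (𝓝 ((Real.exp (-(t ^ 2 / 2 * 1)) : ℝ) : ℂ)) := by
      refine (Complex.continuous_ofReal.tendsto _).comp ((Real.continuous_exp.tendsto _).comp ?_)
      exact (hquot.const_mul (t ^ 2 / 2)).neg
    have hdiff : Tendsto (fun k => charFun ((sampleLaw (n k) (a k)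
        (1 : Matrix (Fin (p k)) (Fin (p k)) ℝ)).map (normalizedAhat (n k) (p k) (m k) (a k))) t -
        ((Real.exp (-(t ^ 2 / 2 * ((n k : ℝ) / ((n k : ℝ) - 1)))) : ℝ) : ℂ)) atTop (𝓝 0) := by
      rw [tendsto_zero_iff_norm_tendsto_zero]
      refine tendsto_order.2 ⟨fun c hc => .of_forall fun k => hc.trans_le (norm_nonneg _),
        fun ε hε => ?_⟩
      -- This `η` makes the limiting error `2 η · 8 t²` less than `ε / 2`.
      have hη : 0 < ε / (32 * (t ^ 2 + 1)) := by positivity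
      have hlt : 2 * (ε / (32 * (t ^ 2 + 1))) * (8 * t ^ 2) < ε := by
        rw [show 2 * (ε / (32 * (t ^ 2 + 1))) * (8 * t ^ 2) =
          ε * (16 * t ^ 2) / (32 * (t ^ 2 + 1)) by ring, div_lt_iff₀ (by positivity)]
        nlinarith [mul_nonneg hε.le (sq_nonneg t)]
      filter_upwards [(tendsto_charFunError (8 * t ^ 2) (ε / (32 * (t ^ 2 + 1))) hx hy
        hz).eventually_lt_const hlt, hn.eventually_ge_atTop 2, hmt.eventually_ge_atTop 1]
        with k hk hnk hmk
      exact (norm_charFun_normalizedAhat_sub_le hnk hmk (hm k) (ha k) t hη).trans_lt hk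
    have hfin := hdiff.add hexp
    simp only [sub_add_cancel, zero_add, mul_one] at hfin
    convert hfin using 2
    push_cast
    congr 1
    simp

end normality

/-! ### Mean and variance under the null hypothesis -/

section nullMoments

variable {n p m : ℕ} {a : unitInterval}

lemma lowEnergy_one : lowEnergy m (1 : Matrix (Fin p) (Fin p) ℝ) = 0 :=
  Finset.sum_eq_zero fun j hj => by
    rw [diagCoeff_one (Nat.one_le_iff_ne_zero.1 (Finset.mem_Icc.1 hj).1)]
    ring

lemma meanA_one (hn : 2 ≤ n) (hm : m < p) :
    meanA n p m a (1 : Matrix (Fin p) (Fin p) ℝ) = 0 := by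
  rw [meanA_eq Matrix.PosSemidef.one isToeplitz_one hn hm, lowEnergy_one, mul_zero]

lemma varA_one (hn : 2 ≤ n) (hm1 : 1 ≤ m) (hm : m < p) :
    varA n p m a (1 : Matrix (Fin p) (Fin p) ℝ) =
      (a : ℝ) ^ 4 / ((n : ℝ) * ((n : ℝ) - 1) * ((p : ℝ) - m) ^ 2) := by
  have hT : (0 : ℝ) < (p : ℝ) - m := sub_pos.2 (by exact_mod_cast hm)
  have hn1 : (0 : ℝ) < (n : ℝ) - 1 := sub_pos.2 (by exact_mod_cast hn)
  have hn0 : (0 : ℝ) < (n : ℝ) := by linarith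
  have hm0 : (0 : ℝ) < m := by exact_mod_cast hm1
  have hR₁ : R₁ m a (1 : Matrix (Fin p) (Fin p) ℝ) = (((p : ℝ) - m) * (a : ℝ) ^ 2) ^ 2 := by
    have h : ∑ j ∈ Finset.Icc 1 m, ∑ j' ∈ Finset.Icc 1 m,
        lagCov m a (1 : Matrix (Fin p) (Fin p) ℝ) j j' ^ 2 =
        ∑ j ∈ Finset.Icc 1 m, (((p : ℝ) - m) * (a : ℝ) ^ 2) ^ 2 := by
      refine Finset.sum_congr rfl fun j hj => ?_
      rw [Finset.sum_eq_single_of_mem j hj fun j' hj' hne => by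
        rw [lagCov_one hm hj hj', if_neg hne.symm]; ring]
      rw [lagCov_one hm hj hj, if_pos rfl]
    rw [R₁, h]
    simp only [Finset.sum_const, Nat.card_Icc, Nat.add_sub_cancel, nsmul_eq_mul]
    field_simp
  have hR₂ : R₂ m a (1 : Matrix (Fin p) (Fin p) ℝ) = 0 := by
    rw [R₂, Finset.sum_eq_zero fun j hj => Finset.sum_eq_zero fun j' _ => by
      rw [diagCoeff_one (Nat.one_le_iff_ne_zero.1 (Finset.mem_Icc.1 hj).1), zero_mul, zero_mul], mul_zero]
  rw [varA_eq Matrix.PosSemidef.one isToeplitz_one hn hm1 hm, hR₁, hR₂]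
  field_simp
  ring

end nullMoments

end ToeplitzMissing

theorem mainTheorem6 :
    -- null hypothesis: mean and variance
    (∀ (n p m : ℕ) (a : unitInterval), 2 ≤ n → 1 ≤ m → m < p → (0 : ℝ) < a → (a : ℝ) < 1 →
      MemLp (ToeplitzMissing.Ahat n p m) 2
          (ToeplitzMissing.sampleLaw n a (1 : Matrix (Fin p) (Fin p) ℝ)) ∧
        ToeplitzMissing.meanA n p m a 1 = 0 ∧
        ToeplitzMissing.varA n p m a 1 =
          (a : ℝ) ^ 4 / ((n : ℝ) * ((n : ℝ) - 1) * ((p : ℝ) - m) ^ 2)) ∧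
    -- null hypothesis: asymptotic normality
    (∀ (n p m : ℕ → ℕ) (a : ℕ → unitInterval),
      (∀ t, m t < p t) → (∀ t, (0 : ℝ) < a t ∧ (a t : ℝ) < 1) →
      Tendsto n atTop atTop → Tendsto p atTop atTop → Tendsto m atTop atTop →
      Tendsto (fun t => (a t : ℝ) ^ 2 * (n t : ℝ) * ((p t : ℝ) - m t)) atTop atTop →
      TendstoInDistribution
        (fun t (Y : Fin (n t) → Fin (p t) → ℝ) =>
          (n t : ℝ) * ((p t : ℝ) - m t) / (a t : ℝ) ^ 2 *
            ToeplitzMissing.Ahat (n t) (p t) (m t) Y)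
        atTop (id : ℝ → ℝ)
        (fun t => ToeplitzMissing.sampleLaw (n t) (a t) (1 : Matrix (Fin (p t)) (Fin (p t)) ℝ))
        (gaussianReal 0 1)) ∧
    -- alternative: mean and decomposition of the variance
    (∀ (α : ℝ) (n p m : ℕ) (a : unitInterval) (S : Matrix (Fin p) (Fin p) ℝ),
      0 < α → 2 ≤ n → 1 ≤ m → m < p → (0 : ℝ) < a → (a : ℝ) < 1 →
      S ∈ ToeplitzMissing.toeplitzClass α p →
      MemLp (ToeplitzMissing.Ahat n p m) 2 (ToeplitzMissing.sampleLaw n a S) ∧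
        ToeplitzMissing.meanA n p m a S =
          (a : ℝ) ^ 4 / √(2 * (m : ℝ)) *
            ∑ j ∈ Finset.Icc 1 m, ToeplitzMissing.diagCoeff S j ^ 2 ∧
        ToeplitzMissing.varA n p m a S =
          ToeplitzMissing.R₁ m a S / ((n : ℝ) * ((n : ℝ) - 1) * ((p : ℝ) - m) ^ 4) +
            ToeplitzMissing.R₂ m a S / ((n : ℝ) * ((p : ℝ) - m) ^ 2)) ∧
    -- alternative: bounds, uniform over everything but `α`; `r m` is the `o(1)` term
    (∀ α : ℝ, 1 / 4 < α → ∃ (C : ℝ) (r : ℕ → ℝ), 0 < C ∧ Tendsto r atTop (𝓝 0) ∧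
      ∀ (n p m : ℕ) (a : unitInterval) (S : Matrix (Fin p) (Fin p) ℝ),
        2 ≤ n → 1 ≤ m → m < p → (0 : ℝ) < a → (a : ℝ) < 1 →
        S ∈ ToeplitzMissing.toeplitzClass α p →
        ToeplitzMissing.R₁ m a S ≤ ((p : ℝ) - m) ^ 2 *
          ((a : ℝ) ^ 4 * (1 + r m) +
            ToeplitzMissing.meanA n p m a S *
              (C * (a : ℝ) ^ 2 * (m : ℝ) + C * (a : ℝ) ^ 3 * (m : ℝ) ^ (3 / 2 - 2 * α)) +
            ToeplitzMissing.meanA n p m a S ^ 2 * (C * (m : ℝ) ^ 2)) ∧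
        ToeplitzMissing.R₂ m a S ≤ ((p : ℝ) - m) *
          ((a : ℝ) ^ 2 * ToeplitzMissing.meanA n p m a S * r m +
            ToeplitzMissing.meanA n p m a S ^ (3 / 2 : ℝ) *
              (C * (a : ℝ) * (m : ℝ) ^ (1 / 4 : ℝ) +
                C * (a : ℝ) ^ 2 * (m : ℝ) ^ (3 / 4 - α)) +
            ToeplitzMissing.meanA n p m a S ^ 2 * (C * (m : ℝ)))) := by
  refine ⟨fun n p m a hn hm1 hm _ _ => ⟨ToeplitzMissing.hasAllMoments_Ahat.memLp_two,
      ToeplitzMissing.meanA_one hn hm, ToeplitzMissing.varA_one hn hm1 hm⟩,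
    fun n p m a hm ha hn _ hmt hrate => ToeplitzMissing.tendstoInDistribution_normalizedAhat hm
      (fun t => (ha t).1) hn hmt hrate,
    fun α n p m a S _ hn hm1 hm _ _ hS => ⟨ToeplitzMissing.hasAllMoments_Ahat.memLp_two,
      ToeplitzMissing.meanA_eq hS.1.posSemidef hS.2.1 hn hm,
      ToeplitzMissing.varA_eq hS.1.posSemidef hS.2.1 hn hm1 hm⟩,
    fun α hα => ⟨1000, ToeplitzMissing.vanishingRate α, by norm_num,
      ToeplitzMissing.tendsto_vanishingRate hα, fun n p m a S hn hm1 hm _ _ hS =>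
        ToeplitzMissing.R₁_le_and_R₂_le (by linarith) hn hm1 hm hS⟩⟩
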